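/- **Conventions.** A *surface* is a Hausdorff space with a countable base in which every point $v$ is the centre of an open neighbourhood homeomorphic to a wedge of finitely many open disks (an open disk if there is only one), or lies on the diameter of an open neighbourhood homeomorphic to an open half-disk united with its diameter (these $v$ form the *boundary*), together with a *local genus* $g_v\in\mathbb Z_{\ge0}$ that is non-zero at finitely many points only and vanishes on the boundary. Let $m_v$ be the number of disks (*branches*) at $v$ ($m_v=1$ on the boundary) and $\mu_v=2g_v+m_v-1$ the *Milnor number*; $v$ is *singular* if $\mu_v>0$, and a surface is *nonsingular* if it has no singular points. A surface is *closed* if it is compact without boundary. $b_i$ are the rational Betti numbers and $\chi=b_0-b_1+b_2$. A *branched covering* $f:\Sigma\to S^2$ of the sphere by a closed surface is a continuous map which, near every point $v$, has the form $z\mapsto z^{k_i}$, $k_i\ge1$, on the $i$-th branch at $v$ in suitable topological coordinates (equivalently, it is a branched covering on every component of the normalization of $\Sigma$), and for which $\sum_i k_i\ge2$ at every singular point with $m_v=1$. (The surface has a unique orientation for which $f$ is orientation preserving, so orientations need not be mentioned.) The *local degree* is $\deg_vf=\sum_{i=1}^{m_v}k_i$. *Critical points* are the singular points of $\Sigma$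 and the points where some $k_i\ge2$; *critical values* are their images. $f$ is *$n$-fold* if every non-critical value has exactly $n$ preimages. The *index* of $v$ is $\mathrm{ind}_v=\mu_v+\deg_vf$, and the *multiplicity* of a critical value $w$ is $\sum_{v\in f^{-1}(w)}(\mathrm{ind}_v-1)$. Let $v$ be a critical point of a branched covering $f_0:\Sigma_0\to S^2$ and $D\subset S^2$ a closed disk with $f_0(v)$ in its interior, such that the connected component $U_v$ of $f_0^{-1}(D)$ containing $v$ contains no other critical point. A branched covering $f_1:\Sigma_1\to S^2$ is a *local perturbation* of $f_0$ at $v$ with *perturbation domain* $D$ if $\Sigma_1$ is obtained by gluing $\Sigma_0\setminus\mathrm{Int}\,U_v$ and a surface $\tilde U_v$ along their common boundary, where $\tilde U_v$ is a compact connected (possibly singular) surface with $m_v$ boundary components, $b_1(\tilde U_v)+\sum_{x\in\tilde U_v}\mu_x=\mu_v$ and $b_2(\tilde U_v)=0$, and if $f_1=f_0$ on $\Sigma_0\setminus\mathrm{Int}\,U_v$ and $f_1(\tilde U_v)\subset D$. Choose pairwise disjoint closed disks, one around each critical value of $f_0$. A branched covering $f$ obtained from $f_0$ by finitely many successive local perturbations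 whose domains are among these disks is a *perturbation* of $f_0$, and $f_0$ is then a *degeneration* of $f$. **Proposition 1.** Let $\Sigma$ be a closed nonsingular surface, $f:\Sigma\to S^2$ an $n$-fold branched covering, and $f':\Sigma'\to S^2$ a degeneration of $f$. Then $f'$ is an $n$-fold branched covering, it has finitely many critical points, and the sum of the multiplicities of the critical values of $f'$ equals $2n-\chi(\Sigma)$. In particular, this sum does not depend on $f'$. -/

import Mathlib

open Topology

noncomputable section

namespace SingularSurface

/-! ### Local models -/

/-- The two-dimensional sphere. -/
abbrev Sphere2 : Type := Metric.sphere (0 : EuclideanSpace ℝ (Fin 3)) 1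

/-- The open unit disk. -/
abbrev unitDisk : Set ℂ := Metric.ball (0 : ℂ) 1

/-- The wedge of `m` open disks, realised as the union of the `m` coordinate unit disks in `ℂ^m`.
Its centre is the origin. -/
def diskWedge (m : ℕ) : Set (Fin m → ℂ) :=
  {p | (∀ i, ‖p i‖ < 1) ∧ ∀ i j, p i ≠ 0 → p j ≠ 0 → i = j}

/-- The centre of the wedge. -/
def wedgeCenter (m : ℕ) : diskWedge m :=
  ⟨0, fun _ => by simp, fun i _ h => absurd (Pi.zero_apply i) h⟩

/-- The inclusion of the `i`-th disk (the `i`-th branch) into the wedge. -/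
def wedgeBranch {m : ℕ} (i : Fin m) (z : unitDisk) : diskWedge m :=
  ⟨Pi.single i (z : ℂ), by
    refine ⟨fun j => ?_, fun j l hj hl => ?_⟩
    · by_cases h : j = i
      · subst h
        have hz : ‖(z : ℂ)‖ < 1 := mem_ball_zero_iff.mp z.2
        simp only [Pi.single_eq_same]
        exact hz
      · simp [h]
    · have h1 : j = i := by
        by_contra h
        exact hj (by simp [h])
      have h2 : l = i := by
        by_contra h
        exact hl (by simp [h])
      rw [h1, h2]⟩

/-- The power map `z ↦ z ^ k` (`k ≥ 1`) of the open unit disk to itself. -/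
def diskPow (k : ℕ) (hk : 1 ≤ k) (z : unitDisk) : unitDisk :=
  ⟨(z : ℂ) ^ k, by
    have hz : ‖(z : ℂ)‖ < 1 := mem_ball_zero_iff.mp z.2
    simpa using pow_lt_one₀ (norm_nonneg (z : ℂ)) hz (by omega)⟩

/-- The union of an open half-disk with its (open) diameter. -/
def halfDisk : Set ℂ := {z | ‖z‖ < 1 ∧ 0 ≤ z.im}

/-- The midpoint of the diameter of the half-disk. -/
def halfDiskCenter : halfDisk := ⟨0, by simp [halfDisk]⟩

/-- `x` is the centre of an open neighbourhood homeomorphic to a wedge of `m ≥ 1` open disks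
(for `m = 1`: to an open disk). -/
def HasWedgeNbhd (X : Type) [TopologicalSpace X] (x : X) (m : ℕ) : Prop :=
  1 ≤ m ∧ ∃ φ : diskWedge m → X, IsOpenEmbedding φ ∧ φ (wedgeCenter m) = x

/-- `x` has an open neighbourhood homeomorphic to a half-disk with its diameter, in which `x` lies
on the diameter. -/
def HasHalfDiskNbhd (X : Type) [TopologicalSpace X] (x : X) : Prop :=
  ∃ φ : halfDisk → X, IsOpenEmbedding φ ∧ φ halfDiskCenter = x

/-! ### Surfaces -/

/-- A (possibly singular) surface, possibly with boundary: a Hausdorff space with a countable base,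
locally homeomorphic to a disk, to a wedge of finitely many disks, or to a half-disk with its
diameter, together with a finitely supported local genus that vanishes on the boundary. -/
structure Surface where
  /-- the underlying set -/
  carrier : Type
  /-- its topology -/
  [top : TopologicalSpace carrier]
  [t2 : T2Space carrier]
  [secondCountable : SecondCountableTopology carrier]
  admissible : ∀ x : carrier, (∃ m, HasWedgeNbhd carrier x m) ∨ HasHalfDiskNbhd carrier x
  /-- the local genus -/
  genus : carrier → ℕ
  genus_finite : (Function.support genus).Finite
  genus_boundary : ∀ x, HasHalfDiskNbhd carrier x → genus x = 0

attribute [instance] Surface.top Surface.t2 Surface.secondCountable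

namespace Surface

/-- The boundary of a surface. -/
def boundary (S : Surface) : Set S.carrier := {x | HasHalfDiskNbhd S.carrier x}

open Classical in
/-- The number `m_v` of branches at `v` (the number `m` is determined by `v`; a boundary point
has one branch). -/
def branches (S : Surface) (v : S.carrier) : ℕ :=
  if h : ∃ m, HasWedgeNbhd S.carrier v m then Nat.find h else 1

/-- The Milnor number `μ_v = 2 g_v + m_v - 1` (note that `m_v ≥ 1`). -/
def milnor (S : Surface) (v : S.carrier) : ℕ := 2 * S.genus v + S.branches v - 1

/-- A singular point of a surface. -/
def IsSingularPoint (S : Surface) (v : S.carrier) : Prop := 0 < S.milnor v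

/-- A surface is nonsingular if it has no singular points. -/
def IsNonsingular (S : Surface) : Prop := ∀ v, ¬ S.IsSingularPoint v

end Surface

/-! ### Betti numbers and the Euler characteristic -/

/-- The `i`-th Betti number: the dimension of the `i`-th singular homology with rational
coefficients. -/
def betti (i : ℕ) (X : Type) [TopologicalSpace X] : ℕ :=
  Module.finrank ℚ
    (((AlgebraicTopology.singularHomologyFunctor (ModuleCat.{0} ℚ) i).obj
      (ModuleCat.of ℚ ℚ)).obj (TopCat.of X))

/-- The Euler characteristic `b₀ - b₁ + b₂` of a space of dimension two. -/
def eulerChar (X : Type) [TopologicalSpace X] : ℤ :=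
  (betti 0 X : ℤ) - betti 1 X + betti 2 X

/-! ### Branched coverings of the sphere -/

/-- `v` is the centre of an admissible neighbourhood with `m` branches such that on the `i`-th
branch (a disk of the normalization) the map `f` is, in suitable coordinates of the disk and
of the sphere, the map `z ↦ z ^ (k i)`. -/
def HasBranchDegrees {X : Type} [TopologicalSpace X] (f : X → Sphere2) (v : X)
    (m : ℕ) (k : Fin m → ℕ) : Prop :=
  1 ≤ m ∧ ∃ φ : diskWedge m → X, IsOpenEmbedding φ ∧ φ (wedgeCenter m) = v ∧
    ∀ i, ∃ hk : 1 ≤ k i, ∃ ψ : unitDisk → Sphere2, IsOpenEmbedding ψ ∧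
      ∀ z : unitDisk, f (φ (wedgeBranch i z)) = ψ (diskPow (k i) hk z)

/-- The local degree of `f` at `v`: the sum, over the branches at `v`, of the degrees of `f`
on the branches (it does not depend on the choice of coordinates). -/
def localDegree {X : Type} [TopologicalSpace X] (f : X → Sphere2) (v : X) : ℕ :=
  sInf {d | ∃ (m : ℕ) (k : Fin m → ℕ), HasBranchDegrees f v m k ∧ d = ∑ i, k i}

/-- A ramification point of `f`: a point at which `f` has degree greater than one on some branch,
that is, at which the local degree exceeds the number of branches. -/
def IsRamificationPoint (S : Surface) (f : S.carrier → Sphere2) (v : S.carrier) : Prop :=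
  S.branches v < localDegree f v

/-- A branched covering of the sphere by a closed, possibly singular, surface: a map that is a
branched covering on the normalization of the surface, and for which every singular point
with exactly one branch is a ramification point. The surface carries a unique orientation for which
the map is orientation preserving (pulled back from the sphere), so that no orientation has
to be recorded. -/
structure BranchedCovering where
  /-- the covering surface -/
  surface : Surface
  compact : CompactSpace surface.carrier
  boundary_eq : surface.boundary = ∅
  /-- the covering map -/
  map : surface.carrier → Sphere2
  continuous_map : Continuous map
  branched : ∀ v, ∃ (m : ℕ) (k : Fin m → ℕ), HasBranchDegrees map v m k
  ramified : ∀ v, surface.IsSingularPoint v → surface.branches v = 1 →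
    IsRamificationPoint surface map v

namespace BranchedCovering

/-- The critical points: the ramification points and the singular points of the surface. -/
def criticalPoints (F : BranchedCovering) : Set F.surface.carrier :=
  {v | IsRamificationPoint F.surface F.map v ∨ F.surface.IsSingularPoint v}

/-- The critical values. -/
def criticalValues (F : BranchedCovering) : Set Sphere2 := F.map '' F.criticalPoints

/-- `F` is an `n`-fold branched covering: every point of the sphere that is not a critical value has
exactly `n` preimages. -/
def IsFold (F : BranchedCovering) (n : ℕ) : Prop :=
  ∀ w, w ∉ F.criticalValues → (F.map ⁻¹' {w}).encard = n

/-- The index `ind_v = μ_v + deg_v`. -/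
def index (F : BranchedCovering) (v : F.surface.carrier) : ℕ :=
  F.surface.milnor v + localDegree F.map v

/-- The multiplicity of a critical value `w`: the sum of `ind_v - 1` over the preimages
of `w`. -/
def multiplicity (F : BranchedCovering) (w : Sphere2) : ℤ :=
  ∑ᶠ v ∈ F.map ⁻¹' {w}, ((F.index v : ℤ) - 1)

end BranchedCovering

/-! ### Perturbations and degenerations -/

/-- A closed disk in the sphere: the image of the closed unit disk under an open embedding of
the plane. (By the Schoenflies theorem, every subset of the sphere homeomorphic to a closed
disk is of this form.) -/
def IsClosedDisk (D : Set Sphere2) : Prop :=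
  ∃ φ : ℂ → Sphere2, IsOpenEmbedding φ ∧ D = φ '' Metric.closedBall (0 : ℂ) 1

/-- A perturbing piece: a compact connected surface `T`, possibly singular, which may replace
a neighbourhood of the point `v` of `S`: it has `m_v` boundary components,
`b₁(T) + ∑_{x ∈ T} μ_x = μ_v` and `b₂(T) = 0`. -/
structure IsPerturbingPiece (S : Surface) (v : S.carrier) (T : Surface) : Prop where
  compact : CompactSpace T.carrier
  connected : ConnectedSpace T.carrier
  boundary_components : Nat.card (ConnectedComponents T.boundary) = S.branches v
  betti_one : betti 1 T.carrier + ∑ᶠ x, T.milnor x = S.milnor v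
  betti_two : betti 2 T.carrier = 0

/-- `S₁` is obtained by gluing the complement of the interior of `U ⊆ S₀` and the surface `T` along
their common boundary; `i` and `j` are the inclusions of the two parts. -/
structure IsGluing (S₀ S₁ T : Surface) (U : Set S₀.carrier)
    (i : ((interior U)ᶜ : Set S₀.carrier) → S₁.carrier) (j : T.carrier → S₁.carrier) : Prop where
  closed_left : IsClosedEmbedding i
  closed_right : IsClosedEmbedding j
  cover : Set.range i ∪ Set.range j = Set.univ
  inter_left : Set.range i ∩ Set.range j = i '' {x | (x : S₀.carrier) ∈ frontier U}
  inter_right : Set.range i ∩ Set.range j = j '' T.boundary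
  genus_left : ∀ x, S₁.genus (i x) = S₀.genus x
  genus_right : ∀ y, S₁.genus (j y) = T.genus y

/-- `F₁` is a local perturbation of `F₀` at a critical point, with perturbation domain `D`:
the connected component `U` of the preimage of `D` that contains the critical point `v` (and no
other critical point) is replaced by a piece `T`, the covering map being unchanged outside the
interior of `U`, and `T` being mapped into `D`. -/
def IsLocalPerturbation (F₀ F₁ : BranchedCovering) (D : Set Sphere2) : Prop :=
  ∃ v ∈ F₀.criticalPoints, F₀.map v ∈ interior D ∧
    (∀ x ∈ connectedComponentIn (F₀.map ⁻¹' D) v, x ∈ F₀.criticalPoints → x = v) ∧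
    ∃ T : Surface, IsPerturbingPiece F₀.surface v T ∧
      ∃ i j, IsGluing F₀.surface F₁.surface T (connectedComponentIn (F₀.map ⁻¹' D) v) i j ∧
        (∀ x, F₁.map (i x) = F₀.map x) ∧ ∀ y, F₁.map (j y) ∈ D

/-- `F₁` is a perturbation of `F₀`, the perturbation domain being the union of disjoint closed
disks `D w`, one around each critical value `w` of `F₀`: it is obtained by finitely many local
perturbations whose perturbation domains are among these disks. -/
def IsPerturbation (F₀ F₁ : BranchedCovering) (D : Sphere2 → Set Sphere2) : Prop :=
  (∀ w ∈ F₀.criticalValues, IsClosedDisk (D w) ∧ w ∈ interior (D w)) ∧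
  F₀.criticalValues.PairwiseDisjoint D ∧
  Relation.ReflTransGen
    (fun A B => ∃ w ∈ F₀.criticalValues, IsLocalPerturbation A B (D w)) F₀ F₁

/-- `F'` is a degeneration of `F` if `F` is a perturbation of `F'`, with some perturbation
domain. -/
def IsDegeneration (F' F : BranchedCovering) : Prop := ∃ D, IsPerturbation F' F D

end SingularSurface

end

/-! Two numbers attached to a branched covering are unchanged by every local perturbation: the
number of sheets, and the total defect, which is the sum over all points v of μ_v + deg_v − 1.
Grouping the second sum by fibres shows that it is the sum of the multiplicities of the critical
values (`BranchedCovering.sum_multiplicity`). On a nonsingular surface all μ_v vanish, so the total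
defect is the total ramification, and the Riemann–Hurwitz formula gives 2n − χ
(`BranchedCovering.finsum_defect_eq`). Invariance along the chain of perturbations carries both
facts over to the degeneration.

Invariance (`IsLocalPerturbation.invariants`): let U be the component of the preimage of D around v
and T the piece that replaces it. Over a point outside D nothing changes, and the sum of local
degrees over a fibre is locally constant, so the number of sheets is the same. Hence T and U cover D
with the same degree, and this degree is deg_v f₀ because U contains only v over f₀(v).
Riemann–Hurwitz over the disk gives χ(T) = deg_v f₀ − ram(T). Since T is connected, χ(T) = 1 −
b₁(T). Together with b₁(T) + ∑ μ_x = μ_v this says that the defects on T add up to μ_v + deg_v − 1,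
the defect of v. Points on the seam between T and the rest have defect zero
(`IsGluing.notMem_criticalPoints`).

Riemann–Hurwitz is proved on the level of singular homology and without triangulations, for
coverings by spaces that may be singular. Over a star-shaped set with no critical value except
perhaps its centre, radial contraction lifts, so the covering space retracts onto a finite fibre
(`IsBranched.retractsOnto`). A convex set with more critical values is cut into two overlapping
convex sets with no critical value in the overlap (`IsBranched.hasChi_of_convex`). The sphere is a
plane and a small disk that overlap in a punctured disk, over which χ = 0 (`IsBranched.hasChi`).

The gluing of Euler characteristics is the Mayer–Vietoris principle `EulerChar.HasChi.union`. It
rests on the theorem of small chains, obtained from barycentric subdivision. Subdivision is carried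
out on formal combinations of tuples of points, where everything follows from the cone formula
`TupleChain.bdry_cone`, and is then transported to singular simplices. -/

noncomputable section

/-! ### Chains of tuples -/

namespace TupleChain

/-- Formal rational combinations of `m`-tuples of points of `P`. -/
abbrev Chain (P : Type) (m : ℕ) : Type := (Fin m → P) →₀ ℚ

variable {P Q : Type}

/-- The (augmented) simplicial boundary of tuples. -/
def bdry (P : Type) (m : ℕ) : Chain P (m + 1) →ₗ[ℚ] Chain P m :=
  ∑ i : Fin (m + 1), (-1 : ℚ) ^ (i : ℕ) • Finsupp.lmapDomain ℚ ℚ (fun v j => v (i.succAbove j))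

/-- The cone over a chain with apex `b`. -/
def cone (b : P) (m : ℕ) : Chain P m →ₗ[ℚ] Chain P (m + 1) :=
  Finsupp.lmapDomain ℚ ℚ (fun v => (Fin.cons b v : Fin (m + 1) → P))

/-- The push-forward of tuples. -/
def push (f : P → Q) (m : ℕ) : Chain P m →ₗ[ℚ] Chain Q m :=
  Finsupp.lmapDomain ℚ ℚ (fun v j => f (v j))

lemma bdry_single (m : ℕ) (v : Fin (m + 1) → P) :
    bdry P m (Finsupp.single v 1) =
      ∑ i : Fin (m + 1), (-1 : ℚ) ^ (i : ℕ) • Finsupp.single (fun j => v (i.succAbove j)) 1 := by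
  simp [bdry]

@[simp] lemma cone_single (b : P) (m : ℕ) (v : Fin m → P) :
    cone b m (Finsupp.single v 1) = Finsupp.single (Fin.cons b v) 1 := by simp [cone]

@[simp] lemma push_single (f : P → Q) (m : ℕ) (v : Fin m → P) :
    push f m (Finsupp.single v 1) = Finsupp.single (fun j => f (v j)) 1 := by simp [push]

lemma hom_ext {m : ℕ} {M : Type*} [AddCommGroup M] [Module ℚ M] {f g : Chain P m →ₗ[ℚ] M}
    (h : ∀ v, f (Finsupp.single v 1) = g (Finsupp.single v 1)) : f = g :=
  Finsupp.lhom_ext' fun v => LinearMap.ext_ring (h v)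

/-- Omitting the apex returns the chain; omitting any other point gives a cone over a face, with the
sign shifted by one. Grading by the number of points keeps the empty tuple, so the formula needs no
exceptional augmentation term. -/
lemma bdry_cone (b : P) (m : ℕ) (x : Chain P (m + 1)) :
    bdry P (m + 1) (cone b (m + 1) x) = x - cone b m (bdry P m x) := by
  suffices H : bdry P (m + 1) ∘ₗ cone b (m + 1) = LinearMap.id - cone b m ∘ₗ bdry P m from
    LinearMap.congr_fun H x
  refine hom_ext fun v => ?_
  simp only [LinearMap.comp_apply, cone_single, LinearMap.sub_apply, LinearMap.id_apply,
    bdry_single, map_sum, map_smul]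
  rw [Fin.sum_univ_succ, sub_eq_add_neg, ← Finset.sum_neg_distrib]
  congr 1
  · simp
  · refine Finset.sum_congr rfl fun i _ => ?_
    have : (fun j => (Fin.cons b v : Fin (m + 2) → P) (i.succ.succAbove j))
        = Fin.cons b (fun j => v (i.succAbove j)) := by
      funext j
      refine Fin.cases ?_ (fun j => ?_) j
      · simp
      · simp
    rw [this, Fin.val_succ, pow_succ]
    simp

lemma bdry_cone_zero (b : P) (x : Chain P 0) : bdry P 0 (cone b 0 x) = x := by
  suffices H : bdry P 0 ∘ₗ cone b 0 = LinearMap.id from LinearMap.congr_fun H x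
  refine hom_ext fun v => ?_
  simp only [LinearMap.comp_apply, cone_single, LinearMap.id_apply, bdry_single]
  rw [Fin.sum_univ_succ, Finset.univ_eq_empty, Finset.sum_empty, add_zero, Fin.val_zero, pow_zero,
    one_smul]
  congr 1

/-- Every non-empty tuple is the cone over its tail, so the cone formula and induction on the length
replace the simplicial identities. -/
lemma bdry_bdry (m : ℕ) (x : Chain P (m + 2)) : bdry P m (bdry P (m + 1) x) = 0 := by
  suffices H : ∀ m, bdry P m ∘ₗ bdry P (m + 1) = 0 from LinearMap.congr_fun (H m) x
  intro m
  induction m with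
  | zero =>
    refine hom_ext fun v => ?_
    obtain ⟨b, w, rfl⟩ : ∃ b w, v = Fin.cons b w := ⟨v 0, Fin.tail v, (Fin.cons_self_tail v).symm⟩
    rw [← cone_single, LinearMap.comp_apply, bdry_cone, map_sub, bdry_cone_zero, sub_self]
    simp
  | succ m ih =>
    refine hom_ext fun v => ?_
    obtain ⟨b, w, rfl⟩ : ∃ b w, v = Fin.cons b w := ⟨v 0, Fin.tail v, (Fin.cons_self_tail v).symm⟩
    rw [← cone_single, LinearMap.comp_apply, bdry_cone, map_sub, bdry_cone, ← LinearMap.comp_apply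
      (f := bdry P m), ih]
    simp

lemma bdry_push (f : P → Q) (m : ℕ) (x : Chain P (m + 1)) :
    bdry Q m (push f (m + 1) x) = push f m (bdry P m x) := by
  suffices H : bdry Q m ∘ₗ push f (m + 1) = push f m ∘ₗ bdry P m from LinearMap.congr_fun H x
  refine hom_ext fun v => ?_
  simp only [LinearMap.comp_apply, push_single, bdry_single, map_sum, map_smul]

lemma push_cone (f : P → Q) (b : P) (m : ℕ) (x : Chain P m) :
    push f (m + 1) (cone b m x) = cone (f b) m (push f m x) := by
  suffices H : push f (m + 1) ∘ₗ cone b m = cone (f b) m ∘ₗ push f m from LinearMap.congr_fun H x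
  refine hom_ext fun v => ?_
  simp only [LinearMap.comp_apply, cone_single, push_single]
  congr 1
  funext j
  refine Fin.cases ?_ (fun j => ?_) j <;> simp

/-- A choice of a centre for every non-empty tuple. -/
abbrev Center (P : Type) : Type := ∀ m : ℕ, (Fin (m + 1) → P) → P

/-- The subdivision operator defined by a choice of centres. -/
def sd (b : Center P) : ∀ m : ℕ, Chain P m →ₗ[ℚ] Chain P m
  | 0 => LinearMap.id
  | m + 1 => Finsupp.linearCombination ℚ
      fun v => cone (b m v) m (sd b m (bdry P m (Finsupp.single v 1)))

/-- The chain homotopy between the identity and the subdivision operator. -/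
def htpy (b : Center P) : ∀ m : ℕ, Chain P m →ₗ[ℚ] Chain P (m + 1)
  | 0 => 0
  | m + 1 => Finsupp.linearCombination ℚ
      fun v => cone (b m v) (m + 1)
        (Finsupp.single v 1 - htpy b m (bdry P m (Finsupp.single v 1)))

lemma sd_succ_single (b : Center P) (m : ℕ) (v : Fin (m + 1) → P) :
    sd b (m + 1) (Finsupp.single v 1) =
      cone (b m v) m (sd b m (bdry P m (Finsupp.single v 1))) := by simp [sd]

lemma htpy_succ_single (b : Center P) (m : ℕ) (v : Fin (m + 1) → P) :
    htpy b (m + 1) (Finsupp.single v 1) =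
      cone (b m v) (m + 1)
        (Finsupp.single v 1 - htpy b m (bdry P m (Finsupp.single v 1))) := by simp [htpy]

/-- Subdivision cones off the subdivided boundary. The cone formula returns that subdivided boundary
minus a cone over its own boundary, which vanishes by induction and ∂∂ = 0. -/
lemma bdry_sd (b : Center P) (m : ℕ) (x : Chain P (m + 1)) :
    bdry P m (sd b (m + 1) x) = sd b m (bdry P m x) := by
  suffices H : ∀ m, bdry P m ∘ₗ sd b (m + 1) = sd b m ∘ₗ bdry P m from LinearMap.congr_fun (H m) x
  intro m
  induction m with
  | zero =>
    refine hom_ext fun v => ?_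
    rw [LinearMap.comp_apply, sd_succ_single, bdry_cone_zero, LinearMap.comp_apply]
  | succ m ih =>
    refine hom_ext fun v => ?_
    rw [LinearMap.comp_apply, sd_succ_single, bdry_cone, ← LinearMap.comp_apply (f := bdry P m), ih]
    simp [bdry_bdry]

/-- By the cone formula ∂h v is v − h∂v minus the cone over ∂(v − h∂v). By induction ∂(v − h∂v) = sd
∂v, and the cone over that is sd v. -/
lemma bdry_htpy (b : Center P) (m : ℕ) (x : Chain P (m + 1)) :
    bdry P (m + 1) (htpy b (m + 1) x) = x - sd b (m + 1) x - htpy b m (bdry P m x) := by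
  suffices H : ∀ m, bdry P (m + 1) ∘ₗ htpy b (m + 1)
      = LinearMap.id - sd b (m + 1) - htpy b m ∘ₗ bdry P m from LinearMap.congr_fun (H m) x
  intro m
  induction m with
  | zero =>
    refine hom_ext fun v => ?_
    rw [LinearMap.comp_apply, htpy_succ_single, bdry_cone]
    simp [htpy, sd]
  | succ m ih =>
    refine hom_ext fun v => ?_
    rw [LinearMap.comp_apply, htpy_succ_single, bdry_cone, map_sub (bdry P (m + 1)),
      ← LinearMap.comp_apply (f := bdry P (m + 1)), ih]
    simp only [LinearMap.sub_apply, LinearMap.id_apply, LinearMap.comp_apply, bdry_bdry, map_zero,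
      sub_zero, sub_sub_cancel, sd_succ_single]
    abel

/-- The hypothesis on centres holds for barycentres and affine maps. This naturality is what makes
subdivision well behaved on singular chains. -/
lemma sd_push (f : P → Q) (b : Center P) (c : Center Q)
    (h : ∀ m v, f (b m v) = c m fun j => f (v j)) (m : ℕ) (x : Chain P m) :
    sd c m (push f m x) = push f m (sd b m x) := by
  suffices H : ∀ m, sd c m ∘ₗ push f m = push f m ∘ₗ sd b m from LinearMap.congr_fun (H m) x
  intro m
  induction m with
  | zero => rfl
  | succ m ih =>
    refine hom_ext fun v => ?_
    rw [LinearMap.comp_apply, LinearMap.comp_apply, push_single, sd_succ_single, sd_succ_single,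
      push_cone, h, ← LinearMap.comp_apply (f := push f m), ← ih, LinearMap.comp_apply,
      ← bdry_push, push_single]

lemma htpy_push (f : P → Q) (b : Center P) (c : Center Q)
    (h : ∀ m v, f (b m v) = c m fun j => f (v j)) (m : ℕ) (x : Chain P m) :
    htpy c m (push f m x) = push f (m + 1) (htpy b m x) := by
  suffices H : ∀ m, htpy c m ∘ₗ push f m = push f (m + 1) ∘ₗ htpy b m from
    LinearMap.congr_fun (H m) x
  intro m
  induction m with
  | zero => simp [htpy]
  | succ m ih =>
    refine hom_ext fun v => ?_
    rw [LinearMap.comp_apply, LinearMap.comp_apply, push_single, htpy_succ_single,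
      htpy_succ_single, push_cone, h, map_sub (push f (m + 1)),
      ← LinearMap.comp_apply (f := push f (m + 1)), ← ih, LinearMap.comp_apply,
      ← bdry_push, push_single]

lemma mem_supported_cone {m : ℕ} {b : P} {s : Set (Fin m → P)} {t : Set (Fin (m + 1) → P)}
    (h : ∀ v ∈ s, (Fin.cons b v : Fin (m + 1) → P) ∈ t)
    {x : Chain P m} (hx : x ∈ Finsupp.supported ℚ ℚ s) :
    cone b m x ∈ Finsupp.supported ℚ ℚ t := by
  rw [Finsupp.supported_eq_span_single] at hx
  induction hx using Submodule.span_induction with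
  | mem x hx =>
    obtain ⟨v, hv, rfl⟩ := hx
    rw [cone_single]
    exact Finsupp.single_mem_supported _ _ (h v hv)
  | zero => simp
  | add x y _ _ hx hy => rw [map_add]; exact add_mem hx hy
  | smul a x _ hx => rw [map_smul]; exact Submodule.smul_mem _ _ hx

/-! ### The mesh of the barycentric subdivision -/

section Mesh

variable {E : Type*} [NormedAddCommGroup E] [NormedSpace ℝ E]

/-- The tuples whose pairwise distances (measured after `f`) are at most `r`, with values in `K`. -/
def meshSet (f : P → E) (m : ℕ) (K : Set E) (r : ℝ) : Set (Fin m → P) :=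
  {v | (∀ i, f (v i) ∈ K) ∧ ∀ i j, ‖f (v i) - f (v j)‖ ≤ r}

/-- The difference between the barycentre and a vertex is the average of m + 1 differences of
vertices, one of which is zero; this gives the factor m/(m+1). Balls are convex, so the bound
extends from the vertices to their hull. -/
lemma norm_barycenter_sub_le {m : ℕ} (p : Fin (m + 1) → E) {r : ℝ}
    (h : ∀ i j, ‖p i - p j‖ ≤ r) {y : E} (hy : y ∈ convexHull ℝ (Set.range p)) :
    ‖((m : ℝ) + 1)⁻¹ • ∑ i, p i - y‖ ≤ m / (m + 1) * r := by
  have hm : (0 : ℝ) < m + 1 := by positivity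
  have key : convexHull ℝ (Set.range p) ⊆
      Metric.closedBall (((m : ℝ) + 1)⁻¹ • ∑ i, p i) (m / (m + 1) * r) := by
    refine convexHull_min ?_ (convex_closedBall _ _)
    rintro _ ⟨i, rfl⟩
    rw [Metric.mem_closedBall, dist_eq_norm, norm_sub_rev]
    have e : ((m : ℝ) + 1)⁻¹ • ∑ j, p j - p i = ((m : ℝ) + 1)⁻¹ • ∑ j, (p j - p i) := by
      rw [Finset.sum_sub_distrib, smul_sub, Finset.sum_const, Finset.card_univ, Fintype.card_fin,
        ← Nat.cast_smul_eq_nsmul ℝ, smul_smul]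
      push_cast
      rw [inv_mul_cancel₀ hm.ne', one_smul]
    rw [e, norm_smul, Real.norm_of_nonneg (by positivity)]
    have hs : ‖∑ j, (p j - p i)‖ ≤ m * r := by
      rw [Fin.sum_univ_succAbove _ i, sub_self, zero_add]
      refine (norm_sum_le _ _).trans ?_
      refine (Finset.sum_le_sum fun j _ => h (i.succAbove j) i).trans ?_
      simp
    calc ((m : ℝ) + 1)⁻¹ * ‖∑ j, (p j - p i)‖ ≤ ((m : ℝ) + 1)⁻¹ * (m * r) := by gcongr
      _ = m / (m + 1) * r := by ring
  have := key hy
  rwa [Metric.mem_closedBall, dist_eq_norm, norm_sub_rev] at this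

/-- The centre `b` is the barycentre, measured after the injection `f`. -/
def IsBarycentric (f : P → E) (b : Center P) : Prop :=
  ∀ m v, f (b m v) = ((m : ℝ) + 1)⁻¹ • ∑ i, f (v i)

lemma barycenter_mem_convexHull {m : ℕ} (p : Fin (m + 1) → E) :
    ((m : ℝ) + 1)⁻¹ • ∑ i, p i ∈ convexHull ℝ (Set.range p) := by
  rw [Finset.smul_sum]
  refine (convex_convexHull ℝ _).sum_mem (fun _ _ => by positivity) ?_
    fun i _ => subset_convexHull _ _ ⟨i, rfl⟩
  rw [Finset.sum_const, Finset.card_univ, Fintype.card_fin, nsmul_eq_mul]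
  push_cast
  exact mul_inv_cancel₀ (by positivity)

/-- Two points of a subdivided face are controlled by induction, and a pair containing the apex by
`norm_barycenter_sub_le`. The latter needs the other point to lie in the convex hull, which is why
the hull is part of the induction. -/
lemma sd_mem_meshSet {f : P → E} {b : Center P} (hb : IsBarycentric f b) :
    ∀ (m : ℕ) (v : Fin (m + 1) → P) {r : ℝ}, (∀ i j, ‖f (v i) - f (v j)‖ ≤ r) →
    sd b (m + 1) (Finsupp.single v 1) ∈ Finsupp.supported ℚ ℚ
      (meshSet f (m + 1) (convexHull ℝ (Set.range fun i => f (v i))) (m / (m + 1) * r)) := by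
  intro m
  induction m with
  | zero =>
    intro v r hr
    have hs : Subsingleton (Fin (0 + 1)) := inferInstanceAs (Subsingleton (Fin 1))
    rw [sd_succ_single]
    have : sd b 0 (bdry P 0 (Finsupp.single v 1)) ∈ Finsupp.supported ℚ ℚ Set.univ := by
      simp [Finsupp.supported_univ]
    refine mem_supported_cone (fun w _ => ?_) this
    refine ⟨fun i => ?_, fun i j => ?_⟩
    · rw [Subsingleton.elim i 0, Fin.cons_zero, hb]
      exact barycenter_mem_convexHull fun i => f (v i)
    · rw [Subsingleton.elim i j]; simp
  | succ m ih =>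
    intro v r hr
    have hr0 : 0 ≤ r := (norm_nonneg _).trans (hr 0 0)
    rw [sd_succ_single]
    have : sd b (m + 1) (bdry P (m + 1) (Finsupp.single v 1)) ∈ Finsupp.supported ℚ ℚ
        (meshSet f (m + 1) (convexHull ℝ (Set.range fun i => f (v i))) (m / (m + 1) * r)) := by
      rw [bdry_single, map_sum]
      refine Submodule.sum_mem _ fun i _ => ?_
      rw [map_smul]
      refine Submodule.smul_mem _ _ ?_
      refine Finsupp.supported_mono ?_
        (ih (fun j => v (i.succAbove j)) (r := r) fun j k => hr _ _)
      refine fun w hw => ⟨fun j => convexHull_mono ?_ (hw.1 j), hw.2⟩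
      rintro _ ⟨j, rfl⟩
      exact ⟨_, rfl⟩
    -- The factor m/(m+1) increases with m, so the bound for the faces is stronger than the one
    -- required.
    have hle : (m : ℝ) / (m + 1) * r ≤ ((m + 1 : ℕ) : ℝ) / ((m + 1 : ℕ) + 1) * r := by
      gcongr ?_ * r
      rw [div_le_div_iff₀ (by positivity) (by positivity)]
      push_cast
      nlinarith
    refine mem_supported_cone (fun w hw => ?_) this
    refine ⟨fun i => ?_, fun i j => ?_⟩
    · refine Fin.cases ?_ (fun i => ?_) i
      · rw [Fin.cons_zero, hb]
        exact barycenter_mem_convexHull fun i => f (v i)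
      · rw [Fin.cons_succ]
        exact hw.1 i
    · have hbar : ∀ i, ‖f (b (m + 1) v) - f (w i)‖ ≤ ((m + 1 : ℕ) : ℝ) / ((m + 1 : ℕ) + 1) * r := by
        intro i
        rw [hb]
        exact norm_barycenter_sub_le _ hr (hw.1 i)
      refine Fin.cases (Fin.cases ?_ (fun j => ?_) j) (fun i => Fin.cases ?_ (fun j => ?_) j) i
      · simp only [sub_self, norm_zero]
        positivity
      · rw [Fin.cons_zero, Fin.cons_succ]
        exact hbar j
      · rw [Fin.cons_zero, Fin.cons_succ, norm_sub_rev]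
        exact hbar i
      · rw [Fin.cons_succ, Fin.cons_succ]
        exact (hw.2 i j).trans hle

lemma iterate_sd_mem_meshSet {f : P → E} {b : Center P} (hb : IsBarycentric f b) (m : ℕ)
    (v : Fin (m + 1) → P) {r : ℝ} (hr : ∀ i j, ‖f (v i) - f (v j)‖ ≤ r) (k : ℕ) :
    ((sd b (m + 1)) ^ k) (Finsupp.single v 1) ∈ Finsupp.supported ℚ ℚ
      (meshSet f (m + 1) Set.univ (((m : ℝ) / (m + 1)) ^ k * r)) := by
  induction k with
  | zero =>
    simp only [pow_zero, one_mul, Module.End.one_apply]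
    exact Finsupp.single_mem_supported _ _ ⟨fun _ => trivial, hr⟩
  | succ k ih =>
    rw [pow_succ' (sd b (m + 1)), Module.End.mul_apply]
    generalize ((sd b (m + 1)) ^ k) (Finsupp.single v 1) = x at ih
    rw [Finsupp.supported_eq_span_single] at ih
    induction ih using Submodule.span_induction with
    | mem x hx =>
      obtain ⟨w, hw, rfl⟩ := hx
      refine Finsupp.supported_mono ?_ (sd_mem_meshSet hb m w hw.2)
      rintro u ⟨-, hu⟩
      refine ⟨fun _ => trivial, fun i j => (hu i j).trans (le_of_eq ?_)⟩
      ring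
    | zero => simp
    | add x y _ _ hx hy => rw [map_add]; exact add_mem hx hy
    | smul a x _ hx => rw [map_smul]; exact Submodule.smul_mem _ _ hx

end Mesh

end TupleChain
end

noncomputable section

/-! ### Singular chains and their subdivision -/

namespace SingularChain

open TupleChain

/-- The standard simplex with `m` vertices. -/
abbrev Simplex (m : ℕ) : Type := stdSimplex ℝ (Fin m)

/-- The affine map of simplices with given values at the vertices. -/
def realize {m n : ℕ} (v : Fin m → Simplex n) : C(Simplex m, Simplex n) where
  toFun t := ⟨∑ i, t.1 i • (v i).1,
    (convex_stdSimplex ℝ (Fin n)).sum_mem (fun i _ => t.2.1 i) t.2.2 fun i _ => (v i).2⟩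
  continuous_toFun := by
    refine Continuous.subtype_mk (continuous_finsetSum _ fun i _ => ?_) _
    exact ((continuous_apply i).comp continuous_subtype_val).smul continuous_const

lemma realize_coe {m n : ℕ} (v : Fin m → Simplex n) (t : Simplex m) :
    (realize v t).1 = ∑ i, t.1 i • (v i).1 := rfl

lemma realize_realize {k m n : ℕ} (w : Fin m → Simplex n) (v : Fin k → Simplex m)
    (t : Simplex k) : realize w (realize v t) = realize (fun j => realize w (v j)) t := by
  apply Subtype.ext
  simp only [realize_coe, Finset.sum_apply, Pi.smul_apply, smul_eq_mul, Finset.sum_smul,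
    Finset.smul_sum, smul_smul]
  rw [Finset.sum_comm]

/-- The vertices of the standard simplex. -/
def vert (m : ℕ) (i : Fin m) : Simplex m := ⟨Pi.single i 1, single_mem_stdSimplex ℝ i⟩

lemma realize_vert {m n : ℕ} (v : Fin m → Simplex n) (i : Fin m) : realize v (vert m i) = v i := by
  apply Subtype.ext
  rw [realize_coe, Finset.sum_eq_single i]
  · simp [vert]
  · intro j _ hj
    simp [vert, hj]
  · simp

lemma realize_vert_self (m : ℕ) : realize (vert m) = ContinuousMap.id _ := by
  ext1 t
  apply Subtype.ext
  rw [realize_coe]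
  funext j
  simp [vert, Pi.single_apply, Finset.sum_apply]

/-- The `i`-th face of the standard simplex. -/
def face {m : ℕ} (i : Fin (m + 1)) : C(Simplex m, Simplex (m + 1)) :=
  realize fun j => vert (m + 1) (i.succAbove j)

lemma realize_comp_face {m n : ℕ} (v : Fin (m + 1) → Simplex n) (i : Fin (m + 1)) :
    (realize v).comp (face i) = realize fun j => v (i.succAbove j) := by
  ext1 t
  simp only [face, ContinuousMap.comp_apply, realize_realize, realize_vert]

/-- The barycentres of tuples of points of a simplex. -/
def bary (n : ℕ) : Center (Simplex n) := fun _ v => realize v stdSimplex.barycenter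

lemma isBarycentric_bary (n : ℕ) : IsBarycentric (Subtype.val : Simplex n → _) (bary n) := by
  intro m v
  rw [bary, realize_coe, Finset.smul_sum]
  refine Finset.sum_congr rfl fun i _ => ?_
  simp [stdSimplex.barycenter_apply]

/-- Affine maps preserve barycentres: this is the naturality hypothesis of `TupleChain.sd_push` and
`TupleChain.htpy_push`. -/
lemma realize_bary {m n : ℕ} (w : Fin m → Simplex n) (k : ℕ) (v : Fin (k + 1) → Simplex m) :
    realize w (bary m k v) = bary n k fun j => realize w (v j) :=
  realize_realize _ _ _

variable (X : Type) [TopologicalSpace X]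

/-- Singular chains, graded by the number of vertices. -/
abbrev Chain (m : ℕ) : Type := C(Simplex m, X) →₀ ℚ

/-- The singular boundary operator (with augmentation). -/
def bdry (m : ℕ) : Chain X (m + 1) →ₗ[ℚ] Chain X m :=
  ∑ i : Fin (m + 1), (-1 : ℚ) ^ (i : ℕ) • Finsupp.lmapDomain ℚ ℚ (fun σ => σ.comp (face i))

variable {X}

lemma bdry_single (m : ℕ) (σ : C(Simplex (m + 1), X)) :
    bdry X m (Finsupp.single σ 1) =
      ∑ i : Fin (m + 1), (-1 : ℚ) ^ (i : ℕ) • Finsupp.single (σ.comp (face i)) 1 := by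
  simp [bdry]

lemma hom_ext {m : ℕ} {M : Type*} [AddCommGroup M] [Module ℚ M] {f g : Chain X m →ₗ[ℚ] M}
    (h : ∀ v, f (Finsupp.single v 1) = g (Finsupp.single v 1)) : f = g :=
  Finsupp.lhom_ext' fun v => LinearMap.ext_ring (h v)

/-- The singular chain of a chain of tuples of points of a singular simplex. -/
def ofTuples {n : ℕ} (σ : C(Simplex n, X)) (m : ℕ) : TupleChain.Chain (Simplex n) m →ₗ[ℚ] Chain X m :=
  Finsupp.lmapDomain ℚ ℚ fun v => σ.comp (realize v)

@[simp] lemma ofTuples_single {n : ℕ} (σ : C(Simplex n, X)) (m : ℕ) (v : Fin m → Simplex n) :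
    ofTuples σ m (Finsupp.single v 1) = Finsupp.single (σ.comp (realize v)) 1 := by simp [ofTuples]

lemma ofTuples_vert {n : ℕ} (σ : C(Simplex n, X)) :
    ofTuples σ n (Finsupp.single (vert n) 1) = Finsupp.single σ 1 := by
  rw [ofTuples_single, realize_vert_self, ContinuousMap.comp_id]

/-- A face of an affine simplex is the affine simplex on the shortened tuple, so tuples map to
singular chains compatibly with boundaries. Since each singular simplex is the image of the tuple of
vertices (`ofTuples_vert`), identities for tuples pass to singular chains. -/
lemma bdry_ofTuples {n : ℕ} (σ : C(Simplex n, X)) (m : ℕ)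
    (x : TupleChain.Chain (Simplex n) (m + 1)) :
    bdry X m (ofTuples σ (m + 1) x) = ofTuples σ m (TupleChain.bdry _ m x) := by
  suffices H : bdry X m ∘ₗ ofTuples σ (m + 1) = ofTuples σ m ∘ₗ TupleChain.bdry _ m from
    LinearMap.congr_fun H x
  refine TupleChain.hom_ext fun v => ?_
  simp only [LinearMap.comp_apply, ofTuples_single, bdry_single, TupleChain.bdry_single, map_sum,
    map_smul, ContinuousMap.comp_assoc, realize_comp_face]

lemma bdry_bdry (m : ℕ) (x : Chain X (m + 2)) : bdry X m (bdry X (m + 1) x) = 0 := by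
  suffices H : bdry X m ∘ₗ bdry X (m + 1) = 0 from LinearMap.congr_fun H x
  refine hom_ext fun σ => ?_
  rw [LinearMap.comp_apply, ← ofTuples_vert, bdry_ofTuples, bdry_ofTuples, TupleChain.bdry_bdry]
  simp

lemma ofTuples_comp {k n : ℕ} (σ : C(Simplex n, X)) (v : Fin k → Simplex n) (m : ℕ)
    (x : TupleChain.Chain (Simplex k) m) :
    ofTuples (σ.comp (realize v)) m x = ofTuples σ m (push (realize v) m x) := by
  suffices H : ofTuples (σ.comp (realize v)) m = ofTuples σ m ∘ₗ push (realize v) m from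
    LinearMap.congr_fun H x
  refine TupleChain.hom_ext fun w => ?_
  rw [LinearMap.comp_apply, push_single, ofTuples_single, ofTuples_single]
  congr 1
  ext1 t
  simp only [ContinuousMap.comp_apply, realize_realize]

variable (X) in
/-- Barycentric subdivision of singular chains. -/
def sd (m : ℕ) : Chain X m →ₗ[ℚ] Chain X m :=
  Finsupp.linearCombination ℚ fun σ =>
    ofTuples σ m (TupleChain.sd (bary m) m (Finsupp.single (vert m) 1))

variable (X) in
/-- The chain homotopy between the identity and the barycentric subdivision. -/
def htpy (m : ℕ) : Chain X m →ₗ[ℚ] Chain X (m + 1) :=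
  Finsupp.linearCombination ℚ fun σ =>
    ofTuples σ (m + 1) (TupleChain.htpy (bary m) m (Finsupp.single (vert m) 1))

lemma sd_single {m : ℕ} (σ : C(Simplex m, X)) : sd X m (Finsupp.single σ 1) =
    ofTuples σ m (TupleChain.sd (bary m) m (Finsupp.single (vert m) 1)) := by simp [sd]

lemma htpy_single {m : ℕ} (σ : C(Simplex m, X)) : htpy X m (Finsupp.single σ 1) =
    ofTuples σ (m + 1) (TupleChain.htpy (bary m) m (Finsupp.single (vert m) 1)) := by simp [htpy]

/-- Singular subdivision is defined on the universal simplex only. Naturality under affine maps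
shows that it agrees with tuple subdivision inside any larger simplex. -/
lemma sd_ofTuples {n : ℕ} (σ : C(Simplex n, X)) (m : ℕ) (x : TupleChain.Chain (Simplex n) m) :
    sd X m (ofTuples σ m x) = ofTuples σ m (TupleChain.sd (bary n) m x) := by
  suffices H : sd X m ∘ₗ ofTuples σ m = ofTuples σ m ∘ₗ TupleChain.sd (bary n) m from
    LinearMap.congr_fun H x
  refine TupleChain.hom_ext fun v => ?_
  rw [LinearMap.comp_apply, LinearMap.comp_apply, ofTuples_single, sd_single, ofTuples_comp,
    ← sd_push _ _ (bary n) (realize_bary v), push_single]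
  simp only [realize_vert]

lemma htpy_ofTuples {n : ℕ} (σ : C(Simplex n, X)) (m : ℕ) (x : TupleChain.Chain (Simplex n) m) :
    htpy X m (ofTuples σ m x) = ofTuples σ (m + 1) (TupleChain.htpy (bary n) m x) := by
  suffices H : htpy X m ∘ₗ ofTuples σ m = ofTuples σ (m + 1) ∘ₗ TupleChain.htpy (bary n) m from
    LinearMap.congr_fun H x
  refine TupleChain.hom_ext fun v => ?_
  rw [LinearMap.comp_apply, LinearMap.comp_apply, ofTuples_single, htpy_single, ofTuples_comp,
    ← htpy_push _ _ (bary n) (realize_bary v), push_single]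
  simp only [realize_vert]

lemma bdry_sd (m : ℕ) (x : Chain X (m + 1)) :
    bdry X m (sd X (m + 1) x) = sd X m (bdry X m x) := by
  suffices H : bdry X m ∘ₗ sd X (m + 1) = sd X m ∘ₗ bdry X m from LinearMap.congr_fun H x
  refine hom_ext fun σ => ?_
  rw [LinearMap.comp_apply, LinearMap.comp_apply, sd_single, bdry_ofTuples, TupleChain.bdry_sd,
    ← sd_ofTuples, ← bdry_ofTuples, ofTuples_vert]

lemma bdry_htpy (m : ℕ) (x : Chain X (m + 1)) :
    bdry X (m + 1) (htpy X (m + 1) x) = x - sd X (m + 1) x - htpy X m (bdry X m x) := by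
  suffices H : bdry X (m + 1) ∘ₗ htpy X (m + 1)
      = LinearMap.id - sd X (m + 1) - htpy X m ∘ₗ bdry X m from LinearMap.congr_fun H x
  refine hom_ext fun σ => ?_
  rw [LinearMap.comp_apply, htpy_single, bdry_ofTuples, TupleChain.bdry_htpy, map_sub, map_sub,
    ← sd_ofTuples, ← htpy_ofTuples, ← bdry_ofTuples, ofTuples_vert]
  simp

/-! ### Small chains -/

/-- The chains supported in a set. -/
def chainsIn (A : Set X) (m : ℕ) : Submodule ℚ (Chain X m) :=
  Finsupp.supported ℚ ℚ {σ | ∀ t, σ t ∈ A}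

/-- The chains whose simplices are contained in one of two sets. -/
def smallChains (A B : Set X) (m : ℕ) : Submodule ℚ (Chain X m) := chainsIn A m ⊔ chainsIn B m

lemma ofTuples_mem_chainsIn {A : Set X} {n : ℕ} {σ : C(Simplex n, X)} (h : ∀ t, σ t ∈ A) (m : ℕ)
    (x : TupleChain.Chain (Simplex n) m) : ofTuples σ m x ∈ chainsIn A m := by
  induction x using Finsupp.induction_linear with
  | zero => simp
  | add x y hx hy => rw [map_add]; exact add_mem hx hy
  | single v a =>
    rw [← mul_one a, ← smul_eq_mul, ← Finsupp.smul_single, map_smul, ofTuples_single]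
    exact Submodule.smul_mem _ _ (Finsupp.single_mem_supported _ _ fun t => h _)

lemma map_mem_of_single {m n : ℕ} {S : Set C(Simplex n, X)} {p : Submodule ℚ (Chain X m)}
    (f : Chain X n →ₗ[ℚ] Chain X m) (h : ∀ σ ∈ S, f (Finsupp.single σ 1) ∈ p) {x : Chain X n}
    (hx : x ∈ Finsupp.supported ℚ ℚ S) : f x ∈ p := by
  rw [Finsupp.supported_eq_span_single] at hx
  induction hx using Submodule.span_induction with
  | mem x hx =>
    obtain ⟨v, hv, rfl⟩ := hx
    exact h v hv
  | zero => simp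
  | add x y _ _ hx hy => rw [map_add]; exact add_mem hx hy
  | smul a x _ hx => rw [map_smul]; exact Submodule.smul_mem _ _ hx

lemma bdry_mem_chainsIn {A : Set X} {m : ℕ} {x : Chain X (m + 1)} (hx : x ∈ chainsIn A (m + 1)) :
    bdry X m x ∈ chainsIn A m := by
  refine map_mem_of_single _ (fun σ hσ => ?_) hx
  rw [← ofTuples_vert, bdry_ofTuples]
  exact ofTuples_mem_chainsIn hσ _ _

lemma sd_mem_chainsIn {A : Set X} {m : ℕ} {x : Chain X m} (hx : x ∈ chainsIn A m) :
    sd X m x ∈ chainsIn A m := by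
  refine map_mem_of_single _ (fun σ hσ => ?_) hx
  rw [sd_single]
  exact ofTuples_mem_chainsIn hσ _ _

lemma htpy_mem_chainsIn {A : Set X} {m : ℕ} {x : Chain X m} (hx : x ∈ chainsIn A m) :
    htpy X m x ∈ chainsIn A (m + 1) := by
  refine map_mem_of_single _ (fun σ hσ => ?_) hx
  rw [htpy_single]
  exact ofTuples_mem_chainsIn hσ _ _

lemma map_mem_smallChains {A B : Set X} {m n : ℕ} (f : Chain X m →ₗ[ℚ] Chain X n)
    (hA : ∀ x ∈ chainsIn A m, f x ∈ chainsIn A n) (hB : ∀ x ∈ chainsIn B m, f x ∈ chainsIn B n)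
    {x : Chain X m} (hx : x ∈ smallChains A B m) : f x ∈ smallChains A B n := by
  obtain ⟨a, ha, b, hb, rfl⟩ := Submodule.mem_sup.mp hx
  rw [map_add]
  exact Submodule.add_mem_sup (hA a ha) (hB b hb)

lemma single_mem_smallChains {A B : Set X} {m : ℕ} {σ : C(Simplex m, X)}
    (h : (∀ t, σ t ∈ A) ∨ ∀ t, σ t ∈ B) : Finsupp.single σ 1 ∈ smallChains A B m := by
  rcases h with h | h
  · exact Submodule.mem_sup_left (Finsupp.single_mem_supported _ _ h)
  · exact Submodule.mem_sup_right (Finsupp.single_mem_supported _ _ h)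

lemma iterate_sd_mem_smallChains {A B : Set X} {m : ℕ} {x : Chain X m}
    (hx : x ∈ smallChains A B m) (k : ℕ) : ((sd X m) ^ k) x ∈ smallChains A B m := by
  induction k with
  | zero => exact hx
  | succ k ih =>
    rw [pow_succ' (sd X m), Module.End.mul_apply]
    exact map_mem_smallChains _ (fun _ => sd_mem_chainsIn) (fun _ => sd_mem_chainsIn) ih

lemma iterate_sd_ofTuples {n : ℕ} (σ : C(Simplex n, X)) (m : ℕ)
    (x : TupleChain.Chain (Simplex n) m) (k : ℕ) :
    ((sd X m) ^ k) (ofTuples σ m x) = ofTuples σ m (((TupleChain.sd (bary n) m) ^ k) x) := by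
  induction k with
  | zero => rfl
  | succ k ih =>
    rw [pow_succ' (sd X m), pow_succ' (TupleChain.sd (bary n) m), Module.End.mul_apply,
      Module.End.mul_apply, ih, sd_ofTuples]

lemma dist_realize_le {m n : ℕ} (v : Fin (m + 1) → Simplex n) {r : ℝ}
    (h : ∀ i j, ‖(v i).1 - (v j).1‖ ≤ r) (t : Simplex (m + 1)) :
    dist (realize v t) (v 0) ≤ r := by
  have : (realize v t).1 ∈ Metric.closedBall (v 0).1 r := by
    refine (convex_closedBall _ _).sum_mem (fun i _ => t.2.1 i) t.2.2 fun i _ => ?_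
    rw [Metric.mem_closedBall, dist_eq_norm]
    exact h i 0
  exact this

/-- The diameters of the pieces shrink by the factor m/(m+1) at each step, so they eventually fall
below a Lebesgue number of the pulled-back cover of the simplex. -/
lemma exists_iterate_sd_single_mem {A B : Set X} (hA : IsOpen A) (hB : IsOpen B)
    (hAB : A ∪ B = Set.univ) {m : ℕ} (σ : C(Simplex (m + 1), X)) :
    ∃ k, ((sd X (m + 1)) ^ k) (Finsupp.single σ 1) ∈ smallChains A B (m + 1) := by
  obtain ⟨δ, hδ, hball⟩ := lebesgue_number_lemma_of_metric (s := (Set.univ : Set (Simplex (m + 1))))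
    (c := fun i : Bool => σ ⁻¹' (if i then A else B)) isCompact_univ
    (fun i => by cases i <;> simp [hA.preimage σ.continuous, hB.preimage σ.continuous])
    (fun t _ => by
      have : σ t ∈ A ∪ B := hAB ▸ trivial
      rcases this with h | h
      · exact Set.mem_iUnion.mpr ⟨true, by simpa using h⟩
      · exact Set.mem_iUnion.mpr ⟨false, by simpa using h⟩)
  obtain ⟨r, hr⟩ : ∃ r : ℝ, ∀ i j, ‖(vert (m + 1) i).1 - (vert (m + 1) j).1‖ ≤ r := by
    obtain ⟨r, hr⟩ := (Set.finite_range fun p : Fin (m + 1) × Fin (m + 1) =>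
      ‖(vert (m + 1) p.1).1 - (vert (m + 1) p.2).1‖).bddAbove
    exact ⟨r, fun i j => hr ⟨(i, j), rfl⟩⟩
  have hlim : Filter.Tendsto (fun k : ℕ => ((m : ℝ) / (m + 1)) ^ k * r) Filter.atTop (𝓝 (0 * r)) :=
    (tendsto_pow_atTop_nhds_zero_of_lt_one (by positivity)
      (by rw [div_lt_one (by positivity)]; linarith)).mul_const r
  rw [zero_mul] at hlim
  obtain ⟨k, hk⟩ := (hlim.eventually (gt_mem_nhds hδ)).exists
  refine ⟨k, ?_⟩
  rw [← ofTuples_vert, iterate_sd_ofTuples]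
  have := iterate_sd_mem_meshSet (isBarycentric_bary (m + 1)) m (vert (m + 1)) hr k
  generalize ((TupleChain.sd (bary (m + 1)) (m + 1)) ^ k) (Finsupp.single (vert (m + 1)) 1) = x
    at this
  rw [Finsupp.supported_eq_span_single] at this
  induction this using Submodule.span_induction with
  | mem x hx =>
    obtain ⟨w, hw, rfl⟩ := hx
    rw [ofTuples_single]
    obtain ⟨i, hi⟩ := hball (w 0) trivial
    have hmem : ∀ t, σ (realize w t) ∈ (if i then A else B) := fun t =>
      hi ((dist_realize_le w hw.2 t).trans_lt hk)
    refine single_mem_smallChains ?_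
    cases i
    · exact Or.inr (by simpa using hmem)
    · exact Or.inl (by simpa using hmem)
  | zero => simp
  | add x y _ _ hx hy => rw [map_add]; exact add_mem hx hy
  | smul a x _ hx => rw [map_smul]; exact Submodule.smul_mem _ _ hx

/-- A chain has finitely many simplices, and small chains stay small under subdivision, so the
numbers of iterations for two summands can be added. -/
lemma exists_iterate_sd_mem {A B : Set X} (hA : IsOpen A) (hB : IsOpen B)
    (hAB : A ∪ B = Set.univ) {m : ℕ} (x : Chain X (m + 1)) :
    ∃ k, ((sd X (m + 1)) ^ k) x ∈ smallChains A B (m + 1) := by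
  induction x using Finsupp.induction_linear with
  | zero => exact ⟨0, by simp⟩
  | add x y hx hy =>
    obtain ⟨k, hk⟩ := hx
    obtain ⟨l, hl⟩ := hy
    refine ⟨k + l, ?_⟩
    rw [map_add]
    refine add_mem ?_ ?_
    · rw [add_comm k l, pow_add, Module.End.mul_apply]
      exact iterate_sd_mem_smallChains hk l
    · rw [pow_add, Module.End.mul_apply]
      exact iterate_sd_mem_smallChains hl k
  | single σ a =>
    obtain ⟨k, hk⟩ := exists_iterate_sd_single_mem hA hB hAB σ
    refine ⟨k, ?_⟩
    rw [← mul_one a, ← smul_eq_mul, ← Finsupp.smul_single, map_smul]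
    exact Submodule.smul_mem _ _ hk

/-- Every relative cycle modulo the small chains is a relative boundary. -/
lemma exists_bdry_sub_mem_smallChains {A B : Set X} (hA : IsOpen A) (hB : IsOpen B)
    (hAB : A ∪ B = Set.univ) {m : ℕ} (x : Chain X (m + 1))
    (hx : bdry X m x ∈ smallChains A B m) :
    ∃ y, x - bdry X (m + 1) y ∈ smallChains A B (m + 1) := by
  obtain ⟨k, hk⟩ := exists_iterate_sd_mem hA hB hAB x
  suffices H : ∀ k : ℕ,
      ∃ y, x - ((sd X (m + 1)) ^ k) x - bdry X (m + 1) y ∈ smallChains A B (m + 1) by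
    obtain ⟨y, hy⟩ := H k
    refine ⟨y, ?_⟩
    have := add_mem hy hk
    rwa [show x - ((sd X (m + 1)) ^ k) x - bdry X (m + 1) y + ((sd X (m + 1)) ^ k) x =
      x - bdry X (m + 1) y by abel] at this
  clear hk k
  have hb : ∀ k : ℕ, bdry X m (((sd X (m + 1)) ^ k) x) ∈ smallChains A B m := by
    intro k
    induction k with
    | zero => exact hx
    | succ k ih =>
      rw [pow_succ' (sd X (m + 1)), Module.End.mul_apply, bdry_sd]
      exact map_mem_smallChains _ (fun _ => sd_mem_chainsIn) (fun _ => sd_mem_chainsIn) ih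
  intro k
  induction k with
  | zero => exact ⟨0, by simp⟩
  | succ k ih =>
    obtain ⟨y, hy⟩ := ih
    -- The identity x − sd^(k+1) x = (x − sd^k x) + (1 − sd) sd^k x telescopes. The last term is the
    -- boundary of the homotopy applied to sd^k x, up to h∂ sd^k x, which is small because ∂x is.
    refine ⟨y + htpy X (m + 1) (((sd X (m + 1)) ^ k) x), ?_⟩
    have h1 := bdry_htpy m (((sd X (m + 1)) ^ k) x)
    have h2 : htpy X m (bdry X m (((sd X (m + 1)) ^ k) x)) ∈ smallChains A B (m + 1) :=
      map_mem_smallChains _ (fun _ => htpy_mem_chainsIn) (fun _ => htpy_mem_chainsIn) (hb k)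
    have := add_mem hy h2
    rw [pow_succ' (sd X (m + 1)), Module.End.mul_apply, map_add, h1]
    convert this using 1
    abel

end SingularChain
end

noncomputable section

/-! ### Euler characteristics of chain complexes -/

namespace EulerChar

open CategoryTheory

/-- The homology of `K` is finite-dimensional and vanishes above degree `q`, and its Euler
characteristic is `e`. -/
structure HasEuler (K : ChainComplex (ModuleCat.{0} ℚ) ℕ) (q : ℕ) (e : ℤ) : Prop where
  finite : ∀ i, Module.Finite ℚ (K.homology i)
  vanish : ∀ i, q < i → Module.finrank ℚ (K.homology i) = 0
  sum_eq : ∑ i ∈ Finset.range (q + 1), (-1 : ℤ) ^ i * Module.finrank ℚ (K.homology i) = e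

lemma HasEuler.sum_eq_of_le {K : ChainComplex (ModuleCat.{0} ℚ) ℕ} {q : ℕ} {e : ℤ}
    (h : HasEuler K q e) {N : ℕ} (hN : q ≤ N) :
    ∑ i ∈ Finset.range (N + 1), (-1 : ℤ) ^ i * Module.finrank ℚ (K.homology i) = e := by
  rw [← h.sum_eq]
  refine (Finset.sum_subset (Finset.range_mono (by omega)) fun i _ hi => ?_).symm
  rw [h.vanish i (by simpa using hi)]
  simp

lemma HasEuler.mono {K : ChainComplex (ModuleCat.{0} ℚ) ℕ} {q q' : ℕ} {e : ℤ}
    (h : HasEuler K q e) (hq : q ≤ q') : HasEuler K q' e :=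
  ⟨h.finite, fun i hi => h.vanish i (by omega), h.sum_eq_of_le hq⟩

lemma hasEuler_congr {K L : ChainComplex (ModuleCat.{0} ℚ) ℕ} {q : ℕ} {e : ℤ}
    (h : ∀ i, Nonempty (K.homology i ≃ₗ[ℚ] L.homology i)) (hK : HasEuler K q e) :
    HasEuler L q e := by
  have hf : ∀ i, Module.finrank ℚ (K.homology i) = Module.finrank ℚ (L.homology i) :=
    fun i => (h i).some.finrank_eq
  refine ⟨fun i => ?_, fun i hi => hf i ▸ hK.vanish i hi, ?_⟩
  · have := hK.finite i
    exact Module.Finite.equiv (h i).some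
  · simp only [← hf, hK.sum_eq]

lemma HasEuler.of_iso {K L : ChainComplex (ModuleCat.{0} ℚ) ℕ} {q : ℕ} {e : ℤ}
    (i : K ≅ L) (hK : HasEuler K q e) : HasEuler L q e :=
  hasEuler_congr (fun n => ⟨(HomologicalComplex.homologyMapIso i n).toLinearEquiv⟩) hK

lemma hasEuler_zero {K : ChainComplex (ModuleCat.{0} ℚ) ℕ} (h : ∀ i, K.ExactAt i) :
    HasEuler K 0 0 := by
  have hs : ∀ i, Subsingleton (K.homology i) := fun i =>
    ModuleCat.subsingleton_of_isZero (h i).isZero_homology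
  have hf : ∀ i, Module.finrank ℚ (K.homology i) = 0 := fun i => by
    have := hs i
    exact Module.finrank_zero_of_subsingleton
  refine ⟨fun i => ?_, fun i _ => hf i, by simp [hf]⟩
  have := hs i
  infer_instance

/-! ### Ranks and Euler characteristics in the long exact homology sequence -/

section LongExact

variable {S : ShortComplex (ChainComplex (ModuleCat.{0} ℚ) ℕ)} (hS : S.ShortExact)
include hS

lemma range_homologyMap_f (i : ℕ) :
    LinearMap.range (HomologicalComplex.homologyMap S.f i).hom =
      LinearMap.ker (HomologicalComplex.homologyMap S.g i).hom :=
  (hS.homology_exact₂ i).moduleCat_range_eq_ker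

lemma range_homologyMap_g (i : ℕ) :
    LinearMap.range (HomologicalComplex.homologyMap S.g (i + 1)).hom =
      LinearMap.ker (hS.δ (i + 1) i rfl).hom :=
  (hS.homology_exact₃ (i + 1) i rfl).moduleCat_range_eq_ker

lemma range_δ (i : ℕ) :
    LinearMap.range (hS.δ (i + 1) i rfl).hom =
      LinearMap.ker (HomologicalComplex.homologyMap S.f i).hom :=
  (hS.homology_exact₁ (i + 1) i rfl).moduleCat_range_eq_ker

lemma range_homologyMap_g_zero :
    LinearMap.range (HomologicalComplex.homologyMap S.g 0).hom = ⊤ := by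
  have := hS.epi_g
  have : Epi (HomologicalComplex.homologyMap S.g 0) :=
    HomologicalComplex.epi_homologyMap_of_epi_of_not_rel S.g 0 (by simp)
  exact LinearMap.range_eq_top.mpr ((ModuleCat.epi_iff_surjective _).mp this)

/-- The number r i is the rank of the connecting map H_i(X₃) → H_{i−1}(X₁), with r 0 = 0 since
nothing lies below degree zero. Rank–nullity for the three kinds of maps gives the relation. -/
lemma exists_connecting_ranks (h1 : ∀ i, Module.Finite ℚ (S.X₁.homology i))
    (h2 : ∀ i, Module.Finite ℚ (S.X₂.homology i)) (h3 : ∀ i, Module.Finite ℚ (S.X₃.homology i)) :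
    ∃ r : ℕ → ℕ, r 0 = 0 ∧ (∀ i, r (i + 1) ≤ Module.finrank ℚ (S.X₁.homology i)) ∧
      (∀ i, r i ≤ Module.finrank ℚ (S.X₃.homology i)) ∧
      ∀ i, Module.finrank ℚ (S.X₂.homology i) + r (i + 1) + r i =
        Module.finrank ℚ (S.X₁.homology i) + Module.finrank ℚ (S.X₃.homology i) := by
  refine ⟨fun i => match i with
    | 0 => 0
    | i + 1 => Module.finrank ℚ (LinearMap.range (hS.δ (i + 1) i rfl).hom), rfl,
    fun i => Submodule.finrank_le _, fun i => ?_, fun i => ?_⟩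
  · cases i with
    | zero => simp
    | succ i => exact LinearMap.finrank_range_le _
  · have e1 := LinearMap.finrank_range_add_finrank_ker (HomologicalComplex.homologyMap S.f i).hom
    have e2 := LinearMap.finrank_range_add_finrank_ker (HomologicalComplex.homologyMap S.g i).hom
    rw [← range_δ hS] at e1
    rw [← range_homologyMap_f hS] at e2
    cases i with
    | zero =>
      rw [range_homologyMap_g_zero hS, finrank_top] at e2
      simp only
      omega
    | succ i =>
      have e3 := LinearMap.finrank_range_add_finrank_ker (hS.δ (i + 1) i rfl).hom
      rw [← range_homologyMap_g hS] at e3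
      simp only
      omega

-- In the alternating sum the ranks cancel between neighbouring degrees; truncation leaves only the
-- last one.
omit hS in
lemma sum_of_connecting_ranks {a b c r : ℕ → ℕ} (h0 : r 0 = 0)
    (h : ∀ i, b i + r (i + 1) + r i = a i + c i) (N : ℕ) :
    ∑ i ∈ Finset.range N, (-1 : ℤ) ^ i * b i + (-1) ^ (N + 1) * r N =
      ∑ i ∈ Finset.range N, (-1 : ℤ) ^ i * a i + ∑ i ∈ Finset.range N, (-1 : ℤ) ^ i * c i := by
  induction N with
  | zero => simp [h0]
  | succ N ih =>
    have hN : (b N : ℤ) + r (N + 1) + r N = a N + c N := by exact_mod_cast h N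
    rw [Finset.sum_range_succ, Finset.sum_range_succ, Finset.sum_range_succ]
    have e : (-1 : ℤ) ^ (N + 1 + 1) = (-1) ^ N := by ring
    have e' : (-1 : ℤ) ^ (N + 1) = -(-1) ^ N := by ring
    rw [e'] at ih
    rw [e]
    linear_combination ih + (-1) ^ N * hN

/-- The connecting map lowers degrees by one, so the quotient can have homology one degree above
that of the subcomplex. This explains the bounds q and q + 1. -/
lemma HasEuler.right {q : ℕ} {a b : ℤ} (h1 : HasEuler S.X₁ q a) (h2 : HasEuler S.X₂ (q + 1) b) :
    HasEuler S.X₃ (q + 1) (b - a) := by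
  have h1f := h1.finite
  have h2f := h2.finite
  have h3f : ∀ i, Module.Finite ℚ (S.X₃.homology i) := by
    intro i
    cases i with
    | zero => exact Module.Finite.of_surjective _ (LinearMap.range_eq_top.mp
        (range_homologyMap_g_zero hS))
    | succ i =>
      have := isNoetherian_of_range_eq_ker _ _ (range_homologyMap_g hS i)
      infer_instance
  obtain ⟨r, hr0, hr1, hr3, hr⟩ := exists_connecting_ranks hS h1f h2f h3f
  refine ⟨h3f, fun i hi => ?_, ?_⟩
  · obtain ⟨j, rfl⟩ : ∃ j, i = j + 1 := ⟨i - 1, by omega⟩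
    have := hr (j + 1)
    have e1 := h1.vanish j (by omega)
    have e1' := h1.vanish (j + 1) (by omega)
    have e2 := h2.vanish (j + 1) (by omega)
    have e3 := hr1 j
    have e4 := hr1 (j + 1)
    omega
  · have := sum_of_connecting_ranks hr0 hr (q + 2)
    rw [h1.sum_eq_of_le (N := q + 1) (by omega), h2.sum_eq] at this
    -- The leftover rank r (q + 2) is bounded by the rank of H_{q+1}(X₁), which is zero.
    have e := hr1 (q + 1)
    rw [h1.vanish (q + 1) (by omega)] at e
    rw [show r (q + 2) = 0 from Nat.le_zero.mp e] at this
    simp only [Nat.cast_zero, mul_zero, add_zero] at this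
    linarith

lemma HasEuler.middle {q : ℕ} {a c : ℤ} (h1 : HasEuler S.X₁ q a) (h3 : HasEuler S.X₃ q c) :
    HasEuler S.X₂ q (a + c) := by
  have h1f := h1.finite
  have h3f := h3.finite
  have h2f : ∀ i, Module.Finite ℚ (S.X₂.homology i) := by
    intro i
    have := isNoetherian_of_range_eq_ker _ _ (range_homologyMap_f hS i)
    infer_instance
  obtain ⟨r, hr0, hr1, hr3, hr⟩ := exists_connecting_ranks hS h1f h2f h3f
  refine ⟨h2f, fun i hi => ?_, ?_⟩
  · have := hr i
    have e1 := h1.vanish i hi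
    have e3 := h3.vanish i hi
    omega
  · have := sum_of_connecting_ranks hr0 hr (q + 1)
    rw [h1.sum_eq, h3.sum_eq] at this
    have e := hr3 (q + 1)
    rw [h3.vanish (q + 1) (by omega)] at e
    rw [show r (q + 1) = 0 from Nat.le_zero.mp e] at this
    simpa using this

end LongExact

/-! ### Complexes of vector spaces given by their differentials -/

section Concrete

variable (V : ℕ → Type) [∀ n, AddCommGroup (V n)] [∀ n, Module ℚ (V n)]
  (d : ∀ n, V (n + 1) →ₗ[ℚ] V n) (hd : ∀ n x, d n (d (n + 1) x) = 0)

/-- The chain complex with the given differentials. -/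
def complex : ChainComplex (ModuleCat.{0} ℚ) ℕ :=
  ChainComplex.of (fun n => ModuleCat.of ℚ (V n)) (fun n => ModuleCat.ofHom (d n))
    fun n => by ext x; exact hd n x

variable {V d}

lemma complex_d (n : ℕ) : (complex V d hd).d (n + 1) n = ModuleCat.ofHom (d n) :=
  ChainComplex.of_d (fun n => ModuleCat.of ℚ (V n)) (fun n => ModuleCat.ofHom (d n)) n

/-- The cycle condition is quantified over all m with m + 1 = n, so that it is empty in degree zero,
where every chain is a cycle. -/
lemma complex_exactAt {n : ℕ} (h : ∀ x : V n, (∀ m, (hm : m + 1 = n) → d m (hm ▸ x) = 0) →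
    ∃ y, d n y = x) : (complex V d hd).ExactAt n := by
  rw [HomologicalComplex.exactAt_iff' _ (n + 1) n ((ComplexShape.down ℕ).next n) (by simp) rfl,
    ShortComplex.moduleCat_exact_iff]
  intro x hx
  obtain ⟨y, hy⟩ := h x fun m hm => by
    subst hm
    have : (ComplexShape.down ℕ).next (m + 1) = m := by simp
    rw [this] at hx
    have e : (complex V d hd).d (m + 1) m = ModuleCat.ofHom (d m) := complex_d _ _
    change ((complex V d hd).d (m + 1) m).hom x = 0 at hx
    rw [e] at hx
    exact hx
  refine ⟨y, ?_⟩
  have e : (complex V d hd).d (n + 1) n = ModuleCat.ofHom (d n) := complex_d _ _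
  change ((complex V d hd).d (n + 1) n).hom y = x
  rw [e]
  exact hy

variable {V₁ V₂ V₃ : ℕ → Type} [∀ n, AddCommGroup (V₁ n)] [∀ n, Module ℚ (V₁ n)]
  [∀ n, AddCommGroup (V₂ n)] [∀ n, Module ℚ (V₂ n)]
  [∀ n, AddCommGroup (V₃ n)] [∀ n, Module ℚ (V₃ n)]
  {d₁ : ∀ n, V₁ (n + 1) →ₗ[ℚ] V₁ n} (hd₁ : ∀ n x, d₁ n (d₁ (n + 1) x) = 0)
  {d₂ : ∀ n, V₂ (n + 1) →ₗ[ℚ] V₂ n} (hd₂ : ∀ n x, d₂ n (d₂ (n + 1) x) = 0)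
  {d₃ : ∀ n, V₃ (n + 1) →ₗ[ℚ] V₃ n} (hd₃ : ∀ n x, d₃ n (d₃ (n + 1) x) = 0)

/-- The chain map given by linear maps that commute with the differentials. -/
def complexMap (f : ∀ n, V₁ n →ₗ[ℚ] V₂ n) (hf : ∀ n x, f n (d₁ n x) = d₂ n (f (n + 1) x)) :
    complex V₁ d₁ hd₁ ⟶ complex V₂ d₂ hd₂ where
  f n := ModuleCat.ofHom (f n)
  comm' i j hij := by
    obtain rfl : j + 1 = i := hij
    have e : (complex V₁ d₁ hd₁).d (j + 1) j = ModuleCat.ofHom (d₁ j) := complex_d _ _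
    have e' : (complex V₂ d₂ hd₂).d (j + 1) j = ModuleCat.ofHom (d₂ j) := complex_d _ _
    rw [e, e']
    ext x
    exact (hf j x).symm

/-- The short exact sequence of complexes given by degreewise short exact sequences. -/
lemma exists_shortExact (f : ∀ n, V₁ n →ₗ[ℚ] V₂ n)
    (hf : ∀ n x, f n (d₁ n x) = d₂ n (f (n + 1) x))
    (g : ∀ n, V₂ n →ₗ[ℚ] V₃ n) (hg : ∀ n x, g n (d₂ n x) = d₃ n (g (n + 1) x))
    (hinj : ∀ n, Function.Injective (f n)) (hsurj : ∀ n, Function.Surjective (g n))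
    (hexact : ∀ n, Function.Exact (f n) (g n)) :
    ∃ S : ShortComplex (ChainComplex (ModuleCat.{0} ℚ) ℕ), S.ShortExact ∧
      S.X₁ = complex V₁ d₁ hd₁ ∧ S.X₂ = complex V₂ d₂ hd₂ ∧ S.X₃ = complex V₃ d₃ hd₃ := by
  refine ⟨⟨complexMap hd₁ hd₂ f hf, complexMap hd₂ hd₃ g hg, ?_⟩, ?_, rfl, rfl, rfl⟩
  · ext n x
    exact (hexact n).apply_apply_eq_zero x
  · refine HomologicalComplex.shortExact_of_degreewise_shortExact _ fun n => ?_
    exact ModuleCat.shortComplex_shortExact _ (hexact n) (hinj n) (hsurj n)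

end Concrete

end EulerChar
end

/-! ### Comparison of finitely supported chains with the categorical singular chain complex -/

noncomputable section

open CategoryTheory AlgebraicTopology Simplicial
namespace SingularChain
open EulerChar

variable (X : Type) [TopologicalSpace X]

/-- The singular chain complex, with chains as finitely supported functions on simplices. -/
def chainComplex : ChainComplex (ModuleCat.{0} ℚ) ℕ :=
  complex (fun n => Chain X (n + 1)) (fun n => bdry X (n + 1)) fun n x => bdry_bdry (n + 1) x

/-- The singular simplices in the singular simplicial set are continuous maps from simplices. -/
def simplexEquiv (n : ℕ) : (TopCat.toSSet.obj (TopCat.of X)) _⦋n⦌ ≃ C(Simplex (n + 1), X) :=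
  TopCat.toSSetObjEquiv (TopCat.of X) (Opposite.op ⦋n⦌)

variable {X}

/-- The simplicial face map pushes barycentric coordinates forward along `succAbove`; the affine
face map sends vertices to vertices. Their agreement identifies the two boundary operators. -/
lemma map_succAbove_eq_face {n : ℕ} (i : Fin (n + 2)) (t : Simplex (n + 1)) :
    stdSimplex.map i.succAbove t = face i t := by
  apply Subtype.ext
  change (stdSimplex.map i.succAbove t : Fin (n + 2) → ℝ) = _
  rw [face, realize_coe, stdSimplex.map_coe]
  funext j
  rw [FunOnFinite.linearMap_apply_apply]
  simp [vert, Pi.single_apply, Finset.sum_apply, Finset.sum_filter, eq_comm]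
  rfl

lemma simplexEquiv_δ {n : ℕ} (x : (TopCat.toSSet.obj (TopCat.of X)) _⦋n + 1⦌) (i : Fin (n + 2)) :
    simplexEquiv X n ((TopCat.toSSet.obj (TopCat.of X)).δ i x) =
      (simplexEquiv X (n + 1) x).comp (face i) := by
  ext1 t
  rw [ContinuousMap.comp_apply, ← map_succAbove_eq_face]
  rfl

/-- The generator of the simplicial chains that belongs to a simplex. -/
def generator {n : ℕ} (x : (TopCat.toSSet.obj (TopCat.of X)) _⦋n⦌) :
    ((TopCat.toSSet.obj (TopCat.of X)).chainComplex (ModuleCat.of ℚ ℚ)).X n :=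
  (SSet.ιChainComplex (R := ModuleCat.of ℚ ℚ) _ x).hom (1 : ℚ)

lemma chain_hom_ext {n : ℕ} {M : ModuleCat.{0} ℚ}
    {f g : ((TopCat.toSSet.obj (TopCat.of X)).chainComplex (ModuleCat.of ℚ ℚ)).X n ⟶ M}
    (h : ∀ x, f.hom (generator x) = g.hom (generator x)) : f = g := by
  refine SSet.chainComplex_hom_ext fun x => ?_
  ext
  exact h x

variable (X) in
/-- The map from simplicial chains to finitely supported functions. -/
def chainHom (n : ℕ) :
    ((TopCat.toSSet.obj (TopCat.of X)).chainComplex (ModuleCat.of ℚ ℚ)).X n ⟶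
      ModuleCat.of ℚ (Chain X (n + 1)) :=
  Limits.Sigma.desc fun x => ModuleCat.ofHom
    (LinearMap.toSpanSingleton ℚ _ (Finsupp.single (simplexEquiv X n x) 1))

lemma chainHom_generator {n : ℕ} (x : (TopCat.toSSet.obj (TopCat.of X)) _⦋n⦌) :
    (chainHom X n).hom (generator x) = Finsupp.single (simplexEquiv X n x) 1 := by
  have h : SSet.ιChainComplex (R := ModuleCat.of ℚ ℚ) _ x ≫ chainHom X n = ModuleCat.ofHom
      (LinearMap.toSpanSingleton ℚ _ (Finsupp.single (simplexEquiv X n x) 1)) :=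
    Limits.Sigma.ι_desc _ _
  have := congrArg (fun f => f.hom (1 : ℚ)) h
  simp only [ModuleCat.hom_ofHom, LinearMap.toSpanSingleton_apply, one_smul] at this
  exact this

lemma d_generator {n : ℕ} (x : (TopCat.toSSet.obj (TopCat.of X)) _⦋n + 1⦌) :
    (((TopCat.toSSet.obj (TopCat.of X)).chainComplex (ModuleCat.of ℚ ℚ)).d (n + 1) n).hom
      (generator x) = ∑ i : Fin (n + 2), (-1 : ℚ) ^ (i : ℕ) •
        generator ((TopCat.toSSet.obj (TopCat.of X)).δ i x) := by
  have h := SSet.ιChainComplex_d (R := ModuleCat.of ℚ ℚ) (TopCat.toSSet.obj (TopCat.of X)) x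
  have := congrArg (fun f => f.hom (1 : ℚ)) h
  simp only [ModuleCat.hom_comp, LinearMap.comp_apply, ModuleCat.hom_sum, LinearMap.sum_apply,
    ModuleCat.hom_zsmul, LinearMap.smul_apply] at this
  refine this.trans (Finset.sum_congr rfl fun i _ => ?_)
  rw [← Int.cast_smul_eq_zsmul ℚ]
  push_cast
  rfl

/-- The map from a free module given by the images of the basis. -/
def freeDesc {ι : Type} {M : ModuleCat.{0} ℚ} (v : ι → M) : ModuleCat.of ℚ (ι →₀ ℚ) ⟶ M :=
  ModuleCat.ofHom (Finsupp.linearCombination ℚ v)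

lemma freeDesc_single {ι : Type} {M : ModuleCat.{0} ℚ} (v : ι → M) (i : ι) :
    (freeDesc v).hom (Finsupp.single i 1) = v i := by
  simp [freeDesc]

variable (X) in
/-- The map from finitely supported functions to simplicial chains. -/
def chainInv (n : ℕ) : ModuleCat.of ℚ (Chain X (n + 1)) ⟶
    ((TopCat.toSSet.obj (TopCat.of X)).chainComplex (ModuleCat.of ℚ ℚ)).X n :=
  freeDesc fun σ => generator ((simplexEquiv X n).symm σ)

lemma chainInv_single {n : ℕ} (σ : C(Simplex (n + 1), X)) :
    (chainInv X n).hom (Finsupp.single σ 1) = generator ((simplexEquiv X n).symm σ) :=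
  freeDesc_single _ σ

variable (X) in
/-- The comparison of the terms of the two singular chain complexes. -/
def chainIso (n : ℕ) :
    ((TopCat.toSSet.obj (TopCat.of X)).chainComplex (ModuleCat.of ℚ ℚ)).X n ≅
      ModuleCat.of ℚ (Chain X (n + 1)) where
  hom := chainHom X n
  inv := chainInv X n
  hom_inv_id := by
    refine chain_hom_ext fun x => ?_
    change (chainInv X n).hom ((chainHom X n).hom (generator x)) = generator x
    rw [chainHom_generator, chainInv_single, Equiv.symm_apply_apply]
  inv_hom_id := by
    ext1
    refine hom_ext fun σ => ?_
    change (chainHom X n).hom ((chainInv X n).hom (Finsupp.single σ 1)) = Finsupp.single σ 1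
    rw [chainInv_single, chainHom_generator, Equiv.apply_symm_apply]

variable (X) in
/-- The singular chain complex of Mathlib is the complex of finitely supported functions. -/
def chainComplexIso :
    (((singularChainComplexFunctor (ModuleCat.{0} ℚ)).obj (ModuleCat.of ℚ ℚ)).obj (TopCat.of X)) ≅
      chainComplex X :=
  HomologicalComplex.Hom.isoOfComponents (chainIso X) fun i j hij => by
    obtain rfl : j + 1 = i := hij
    refine chain_hom_ext (X := X) fun x => ?_
    have e : (chainComplex X).d (j + 1) j = ModuleCat.ofHom (bdry X (j + 1)) := complex_d _ _
    rw [e]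
    change bdry X (j + 1) ((chainHom X (j + 1)).hom (generator x)) = (chainHom X j).hom
      ((((TopCat.toSSet.obj (TopCat.of X)).chainComplex (ModuleCat.of ℚ ℚ)).d (j + 1) j).hom
        (generator x))
    rw [d_generator, chainHom_generator, bdry_single, map_sum]
    refine Finset.sum_congr rfl fun i _ => ?_
    rw [map_smul, chainHom_generator, simplexEquiv_δ]

/-! ### The Mayer-Vietoris principle -/

/-- The chain complex of a family of subspaces that is preserved by the boundary. -/
def subcomplex (p : ∀ n, Submodule ℚ (Chain X (n + 1)))
    (hp : ∀ n, ∀ x ∈ p (n + 1), bdry X (n + 1) x ∈ p n) : ChainComplex (ModuleCat.{0} ℚ) ℕ :=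
  complex (fun n => p n) (fun n => (bdry X (n + 1)).restrict (hp n)) fun n x =>
    Subtype.ext (bdry_bdry (n + 1) x.1)

/-- The quotient of the subcomplex `q` by the part in the subcomplex `p`. -/
def quotcomplex (p q : ∀ n, Submodule ℚ (Chain X (n + 1)))
    (hp : ∀ n, ∀ x ∈ p (n + 1), bdry X (n + 1) x ∈ p n)
    (hq : ∀ n, ∀ x ∈ q (n + 1), bdry X (n + 1) x ∈ q n) : ChainComplex (ModuleCat.{0} ℚ) ℕ :=
  complex (fun n => q n ⧸ (p n).comap (q n).subtype)
    (fun n => Submodule.mapQ ((p (n + 1)).comap (q (n + 1)).subtype) ((p n).comap (q n).subtype)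
      ((bdry X (n + 1)).restrict (hq n)) fun x hx => hp n x.1 hx)
    fun n x => by
      obtain ⟨x, rfl⟩ := Submodule.mkQ_surjective _ x
      have h : (bdry X (n + 1)).restrict (hq n) ((bdry X (n + 1 + 1)).restrict (hq (n + 1)) x) = 0 :=
        Subtype.ext (bdry_bdry (n + 1) x.1)
      refine (Submodule.Quotient.mk_eq_zero _ (x := (bdry X (n + 1)).restrict (hq n)
        ((bdry X (n + 1 + 1)).restrict (hq (n + 1)) x))).mpr ?_
      rw [h]
      exact zero_mem _

/-- The short exact sequence `0 → p ⊓ q → q → (p ⊔ q) / p → 0`. -/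
lemma exists_shortExact_inf (p q s t : ∀ n, Submodule ℚ (Chain X (n + 1)))
    (hp : ∀ n, ∀ x ∈ p (n + 1), bdry X (n + 1) x ∈ p n)
    (hq : ∀ n, ∀ x ∈ q (n + 1), bdry X (n + 1) x ∈ q n)
    (hs : ∀ n, ∀ x ∈ s (n + 1), bdry X (n + 1) x ∈ s n)
    (ht : ∀ n, ∀ x ∈ t (n + 1), bdry X (n + 1) x ∈ t n)
    (hst : ∀ n, s n = p n ⊓ q n) (htt : ∀ n, t n = p n ⊔ q n) :
    ∃ S : ShortComplex (ChainComplex (ModuleCat.{0} ℚ) ℕ), S.ShortExact ∧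
      S.X₁ = subcomplex s hs ∧ S.X₂ = subcomplex q hq ∧ S.X₃ = quotcomplex p t hp ht := by
  have h1 : ∀ n, s n ≤ q n := fun n => hst n ▸ inf_le_right
  have h2 : ∀ n, q n ≤ t n := fun n => htt n ▸ le_sup_right
  refine EulerChar.exists_shortExact _ _ _ (fun n => Submodule.inclusion (h1 n)) (fun n x => rfl)
    (fun n => (Submodule.mkQ _).comp (Submodule.inclusion (h2 n))) (fun n x => rfl)
    (fun n => Submodule.inclusion_injective _) (fun n x => ?_) fun n x => ?_
  · obtain ⟨⟨x, hx⟩, rfl⟩ := Submodule.mkQ_surjective _ x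
    have hx' := hx
    rw [htt] at hx'
    obtain ⟨a, ha, b, hb, rfl⟩ := Submodule.mem_sup.mp hx'
    refine ⟨⟨b, hb⟩, ?_⟩
    simp only [LinearMap.comp_apply, Submodule.mkQ_apply]
    rw [Submodule.Quotient.eq]
    simpa using ha
  · simp only [LinearMap.comp_apply, Submodule.mkQ_apply]
    rw [Submodule.Quotient.mk_eq_zero]
    constructor
    · intro hx
      refine ⟨⟨x.1, ?_⟩, rfl⟩
      rw [hst]
      exact ⟨hx, x.2⟩
    · rintro ⟨y, rfl⟩
      exact ((hst n).le y.2).1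

lemma exists_shortExact_le (p t : ∀ n, Submodule ℚ (Chain X (n + 1)))
    (hp : ∀ n, ∀ x ∈ p (n + 1), bdry X (n + 1) x ∈ p n)
    (ht : ∀ n, ∀ x ∈ t (n + 1), bdry X (n + 1) x ∈ t n) (hpt : ∀ n, p n ≤ t n) :
    ∃ S : ShortComplex (ChainComplex (ModuleCat.{0} ℚ) ℕ), S.ShortExact ∧
      S.X₁ = subcomplex p hp ∧ S.X₂ = subcomplex t ht ∧ S.X₃ = quotcomplex p t hp ht :=
  exists_shortExact_inf p t p t hp ht hp ht (fun n => (inf_of_le_left (hpt n)).symm)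
    (fun n => (sup_of_le_right (hpt n)).symm)

/-- The subcomplex of chains in a set. -/
abbrev complexIn (A : Set X) : ChainComplex (ModuleCat.{0} ℚ) ℕ :=
  subcomplex (fun n => chainsIn A (n + 1)) fun _ _ hx => bdry_mem_chainsIn hx

/-- The push-forward of chains of a subspace. -/
def inclusionChain (A : Set X) (m : ℕ) : Chain A m →ₗ[ℚ] chainsIn A m :=
  LinearMap.codRestrict (chainsIn A m) (Finsupp.lmapDomain ℚ ℚ fun σ =>
    (⟨Subtype.val, continuous_subtype_val⟩ : C(A, X)).comp σ) fun x => by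
      induction x using Finsupp.induction_linear with
      | zero => simp
      | add x y hx hy => rw [map_add]; exact add_mem hx hy
      | single σ a =>
        rw [Finsupp.lmapDomain_apply, Finsupp.mapDomain_single]
        exact Finsupp.single_mem_supported _ _ fun t => (σ t).2

lemma inclusionChain_single (A : Set X) (m : ℕ) (σ : C(Simplex m, A)) (a : ℚ) :
    (inclusionChain A m (Finsupp.single σ a)).1 =
      Finsupp.single ((⟨Subtype.val, continuous_subtype_val⟩ : C(A, X)).comp σ) a := by
  simp [inclusionChain]

lemma inclusionChain_bijective (A : Set X) (m : ℕ) : Function.Bijective (inclusionChain A m) := by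
  constructor
  · intro x y h
    refine Finsupp.mapDomain_injective ?_ (congrArg Subtype.val h)
    intro σ τ hστ
    ext1 t
    exact Subtype.ext (DFunLike.congr_fun hστ t)
  · rw [← LinearMap.range_eq_top, eq_top_iff]
    rintro ⟨x, hx⟩ -
    suffices H : x ∈ (LinearMap.range (inclusionChain A m)).map (chainsIn A m).subtype by
      obtain ⟨y, hy, rfl⟩ := H
      exact hy
    have hx' := hx
    rw [chainsIn, Finsupp.supported_eq_span_single] at hx'
    refine Submodule.span_le.mpr ?_ hx'
    rintro _ ⟨σ, hσ, rfl⟩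
    let τ : C(Simplex m, A) := ⟨fun t => ⟨σ t, hσ t⟩, σ.continuous.subtype_mk _⟩
    exact ⟨_, ⟨Finsupp.single τ 1, rfl⟩, inclusionChain_single A m τ 1⟩

/-- The complex of chains in a set is the singular chain complex of the set. -/
def complexInIso (A : Set X) : chainComplex A ≅ complexIn A :=
  HomologicalComplex.Hom.isoOfComponents
    (fun n => (LinearEquiv.ofBijective _ (inclusionChain_bijective A (n + 1))).toModuleIso)
    fun i j hij => by
      obtain rfl : j + 1 = i := hij
      have e : (chainComplex A).d (j + 1) j = ModuleCat.ofHom (bdry A (j + 1)) := complex_d _ _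
      have e' : (complexIn A).d (j + 1) j = ModuleCat.ofHom ((bdry X (j + 1)).restrict
        fun _ hx => bdry_mem_chainsIn hx) := complex_d _ _
      rw [e, e']
      ext1
      refine hom_ext fun σ => Subtype.ext ?_
      change bdry X (j + 1) (inclusionChain A (j + 2) (Finsupp.single σ 1)).1 =
        (inclusionChain A (j + 1) (bdry A (j + 1) (Finsupp.single σ 1))).1
      rw [inclusionChain_single, bdry_single, bdry_single, map_sum, AddSubmonoidClass.coe_finsetSum]
      refine Finset.sum_congr rfl fun i _ => ?_
      rw [map_smul, Submodule.coe_smul, inclusionChain_single]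
      rfl

lemma bdry_mem_smallChains {A B : Set X} {m : ℕ} {x : Chain X (m + 1)}
    (hx : x ∈ smallChains A B (m + 1)) : bdry X m x ∈ smallChains A B m :=
  map_mem_smallChains _ (fun _ => bdry_mem_chainsIn) (fun _ => bdry_mem_chainsIn) hx

/-- Form in which the theorem of small chains enters the homology sequence: the quotient of all
chains by the small ones is acyclic, so both have the same homology. -/
lemma quotcomplex_small_exactAt {A B : Set X} (hA : IsOpen A) (hB : IsOpen B)
    (hAB : A ∪ B = Set.univ) (n : ℕ) :
    (quotcomplex (fun n => smallChains A B (n + 1)) (fun n => chainsIn Set.univ (n + 1))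
      (fun _ _ hx => bdry_mem_smallChains hx) fun _ _ hx => bdry_mem_chainsIn hx).ExactAt n := by
  refine complex_exactAt _ fun x hx => ?_
  obtain ⟨⟨x, hxu⟩, rfl⟩ := Submodule.mkQ_surjective _ x
  have hb : bdry X n x ∈ smallChains A B n := by
    cases n with
    | zero =>
      refine map_mem_of_single (S := Set.univ) _ (fun σ _ => ?_) (by simp [Finsupp.supported_univ])
      rw [bdry_single]
      refine Submodule.sum_mem _ fun i _ => Submodule.smul_mem _ _ ?_
      refine single_mem_smallChains (Or.inl fun t => ?_)
      -- The simplex without vertices is empty, because its coordinates would have sum 0 instead of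
      -- 1. The augmentation of a chain is therefore vacuously small.
      have := t.2.2
      simp at this
    | succ m =>
      have := hx m rfl
      exact (Submodule.Quotient.mk_eq_zero _ (x := (bdry X (m + 1)).restrict
        (fun _ hx => bdry_mem_chainsIn (A := Set.univ) hx) ⟨x, hxu⟩)).mp this
  obtain ⟨y, hy⟩ := exists_bdry_sub_mem_smallChains hA hB hAB x hb
  have hyu : y ∈ chainsIn Set.univ (n + 2) := by simp [chainsIn, Finsupp.supported_univ]
  refine ⟨Submodule.Quotient.mk ⟨y, hyu⟩, ?_⟩
  refine ((Submodule.Quotient.eq _).mpr ?_).symm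
  exact hy

end SingularChain

/-! ### Additivity of the Euler characteristic -/

namespace EulerChar

open SingularChain

/-- The rational singular homology of `X` is finite-dimensional and vanishes above degree `q`,
and the Euler characteristic of `X` is `e`. -/
def HasChi (X : Type) [TopologicalSpace X] (q : ℕ) (e : ℤ) : Prop :=
  HasEuler (((singularChainComplexFunctor (ModuleCat.{0} ℚ)).obj (ModuleCat.of ℚ ℚ)).obj
    (TopCat.of X)) q e

lemma HasChi.mono {X : Type} [TopologicalSpace X] {q q' : ℕ} {e : ℤ} (h : HasChi X q e)
    (hq : q ≤ q') : HasChi X q' e := HasEuler.mono h hq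

lemma hasChi_iff {X : Type} [TopologicalSpace X] {q : ℕ} {e : ℤ} :
    HasChi X q e ↔ HasEuler (chainComplex X) q e :=
  ⟨fun h => h.of_iso (chainComplexIso X), fun h => h.of_iso (chainComplexIso X).symm⟩

lemma hasChi_subtype_iff {X : Type} [TopologicalSpace X] {A : Set X} {q : ℕ} {e : ℤ} :
    HasChi A q e ↔ HasEuler (complexIn A) q e :=
  hasChi_iff.trans
    ⟨fun h => h.of_iso (complexInIso A), fun h => h.of_iso (complexInIso A).symm⟩

/-- The Mayer-Vietoris principle for Euler characteristics. -/
theorem HasChi.union {X : Type} [TopologicalSpace X] {A B : Set X} (hA : IsOpen A) (hB : IsOpen B)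
    (hAB : A ∪ B = Set.univ) {q : ℕ} {a b c : ℤ} (ha : HasChi A (q + 1) a)
    (hb : HasChi B (q + 1) b) (hc : HasChi (A ∩ B : Set X) q c) :
    HasChi X (q + 1) (a + b - c) := by
  rw [hasChi_subtype_iff] at ha hb hc
  obtain ⟨S, hS, h1, h2, h3⟩ := exists_shortExact_inf (fun n => chainsIn A (n + 1))
    (fun n => chainsIn B (n + 1)) (fun n => chainsIn (A ∩ B) (n + 1))
    (fun n => smallChains A B (n + 1)) (fun _ _ hx => bdry_mem_chainsIn hx)
    (fun _ _ hx => bdry_mem_chainsIn hx) (fun _ _ hx => bdry_mem_chainsIn hx)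
    (fun _ _ hx => bdry_mem_smallChains hx)
    (fun n => by
      rw [chainsIn, chainsIn, chainsIn, ← Finsupp.supported_inter]
      congr 1
      ext σ
      exact forall_and) (fun n => rfl)
  -- By the second isomorphism theorem the complex of A + B modulo A is that of B modulo A ∩ B, with
  -- Euler characteristic b − c.
  have e3 := HasEuler.right hS (by rw [h1]; exact hc) (by rw [h2]; exact hb)
  rw [h3] at e3
  obtain ⟨S', hS', h1', h2', h3'⟩ := exists_shortExact_le (fun n => chainsIn A (n + 1))
    (fun n => smallChains A B (n + 1)) (fun _ _ hx => bdry_mem_chainsIn hx)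
    (fun _ _ hx => bdry_mem_smallChains hx) (fun n => le_sup_left)
  -- Adding back the chains in A gives a + (b − c) for the small chains.
  have e4 := HasEuler.middle hS' (by rw [h1']; exact ha) (by rw [h3']; exact e3)
  rw [h2'] at e4
  obtain ⟨S'', hS'', h1'', h2'', h3''⟩ := exists_shortExact_le (fun n => smallChains A B (n + 1))
    (fun n => chainsIn (Set.univ : Set X) (n + 1)) (fun _ _ hx => bdry_mem_smallChains hx)
    (fun _ _ hx => bdry_mem_chainsIn hx) (fun n => by simp [chainsIn, Finsupp.supported_univ])
  -- The acyclic quotient by the small chains contributes 0.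
  have e5 := HasEuler.middle hS'' (by rw [h1'']; exact e4)
    (by
      rw [h3'']
      exact (hasEuler_zero (quotcomplex_small_exactAt hA hB hAB)).mono (Nat.zero_le _))
  rw [h2''] at e5
  have e6 := hasChi_subtype_iff.mpr e5
  have e7 : HasChi X (q + 1) (a + (b - c) + 0) := by
    refine HasEuler.of_iso ?_ e6
    exact ((singularChainComplexFunctor (ModuleCat.{0} ℚ)).obj (ModuleCat.of ℚ ℚ)).mapIso
      (TopCat.isoOfHomeo (Homeomorph.Set.univ X))
  rwa [add_zero, ← add_sub_assoc] at e7

end EulerChar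
end

noncomputable section

/-! ### Spaces with a finite Euler characteristic -/

namespace EulerChar

open CategoryTheory AlgebraicTopology SingularSurface

lemma HasChi.of_homeomorph {X Y : Type} [TopologicalSpace X] [TopologicalSpace Y] {q : ℕ} {e : ℤ}
    (h : X ≃ₜ Y) (hX : HasChi X q e) : HasChi Y q e :=
  HasEuler.of_iso (((singularChainComplexFunctor (ModuleCat.{0} ℚ)).obj
    (ModuleCat.of ℚ ℚ)).mapIso (TopCat.isoOfHomeo (X := TopCat.of X) (Y := TopCat.of Y) h)) hX

lemma HasChi.of_homotopyEquiv {X Y : Type} [TopologicalSpace X] [TopologicalSpace Y] {q : ℕ}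
    {e : ℤ} (h : ContinuousMap.HomotopyEquiv X Y) (hX : HasChi X q e) : HasChi Y q e := by
  refine hasEuler_congr (fun i => ⟨Iso.toLinearEquiv ?_⟩) hX
  let F := (singularChainComplexFunctor (ModuleCat.{0} ℚ)).obj (ModuleCat.of ℚ ℚ)
  let f : TopCat.of X ⟶ TopCat.of Y := TopCat.ofHom h.toFun
  let g : TopCat.of Y ⟶ TopCat.of X := TopCat.ofHom h.invFun
  have hfg : TopCat.Homotopy (f ≫ g) (𝟙 _) := h.left_inv.some
  have hgf : TopCat.Homotopy (g ≫ f) (𝟙 _) := h.right_inv.some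
  refine ⟨HomologicalComplex.homologyMap (F.map f) i, HomologicalComplex.homologyMap (F.map g) i,
    ?_, ?_⟩
  · have := hfg.congr_homologyMap_singularChainComplexFunctor (ModuleCat.of ℚ ℚ) i
    rw [← HomologicalComplex.homologyMap_comp, ← Functor.map_comp, this, CategoryTheory.Functor.map_id,
      HomologicalComplex.homologyMap_id]
  · have := hgf.congr_homologyMap_singularChainComplexFunctor (ModuleCat.of ℚ ℚ) i
    rw [← HomologicalComplex.homologyMap_comp, ← Functor.map_comp, this, CategoryTheory.Functor.map_id,
      HomologicalComplex.homologyMap_id]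

lemma hasChi_of_finite_discrete (X : Type) [TopologicalSpace X] [DiscreteTopology X] [Finite X] :
    HasChi X 0 (Nat.card X) := by
  classical
  have := Fintype.ofFinite X
  have e0 : (((singularHomologyFunctor (ModuleCat.{0} ℚ) 0).obj (ModuleCat.of ℚ ℚ)).obj
      (TopCat.of X)) ≃ₗ[ℚ] DirectSum X fun _ => ℚ :=
    ((singularHomologyFunctorZeroOfTotallyDisconnectedSpace (ModuleCat.{0} ℚ)
      (ModuleCat.of ℚ ℚ) (TopCat.of X)) ≪≫
      ModuleCat.coprodIsoDirectSum fun _ : X => ModuleCat.of ℚ ℚ).toLinearEquiv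
  have hs : ∀ i, i ≠ 0 → Subsingleton (((singularHomologyFunctor (ModuleCat.{0} ℚ) i).obj
      (ModuleCat.of ℚ ℚ)).obj (TopCat.of X)) := fun i hi =>
    ModuleCat.subsingleton_of_isZero
      (isZero_singularHomologyFunctor_of_totallyDisconnectedSpace _ _ _ _ hi)
  refine ⟨fun i => ?_, fun i hi => ?_, ?_⟩
  · by_cases hi : i = 0
    · subst hi
      exact Module.Finite.equiv e0.symm
    · have := hs i hi
      exact inferInstanceAs (Module.Finite ℚ (((singularHomologyFunctor (ModuleCat.{0} ℚ) i).obj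
        (ModuleCat.of ℚ ℚ)).obj (TopCat.of X)))
  · have := hs i (by omega)
    exact Module.finrank_zero_of_subsingleton (R := ℚ) (M := (((singularHomologyFunctor
      (ModuleCat.{0} ℚ) i).obj (ModuleCat.of ℚ ℚ)).obj (TopCat.of X)))
  · rw [zero_add, Finset.sum_range_one, pow_zero, one_mul]
    have : Module.finrank ℚ (((singularHomologyFunctor (ModuleCat.{0} ℚ) 0).obj
      (ModuleCat.of ℚ ℚ)).obj (TopCat.of X)) = Nat.card X := by
      rw [e0.finrank_eq, Module.finrank_directSum]
      simp
    exact congrArg Nat.cast this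

lemma HasChi.sum_betti {X : Type} [TopologicalSpace X] {q : ℕ} {e : ℤ} (h : HasChi X q e) :
    ∑ i ∈ Finset.range (q + 1), (-1 : ℤ) ^ i * betti i X = e := h.sum_eq

lemma HasChi.eulerChar_eq {X : Type} [TopologicalSpace X] {e : ℤ} (h : HasChi X 2 e) :
    eulerChar X = e := by
  rw [← h.sum_betti, eulerChar]
  simp [Finset.sum_range_succ]
  ring

lemma betti_zero_of_pathConnected (X : Type) [TopologicalSpace X] [PathConnectedSpace X] :
    betti 0 X = 1 := by
  have : PathConnectedSpace (TopCat.of X) := inferInstanceAs (PathConnectedSpace X)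
  have e := (asIso (TopCat.singularHomology₀ε (TopCat.of X) (ModuleCat.of ℚ ℚ))).toLinearEquiv
  rw [betti, e.finrank_eq]
  exact Module.finrank_self ℚ

/-- The Mayer-Vietoris principle for two relatively open subsets of a subset. -/
theorem HasChi.union_subset {X : Type} [TopologicalSpace X] {A B C U V : Set X} (hU : IsOpen U)
    (hV : IsOpen V) (hA : A = C ∩ U) (hB : B = C ∩ V) (hC : C ⊆ U ∪ V) {q : ℕ} {a b c : ℤ}
    (ha : HasChi A (q + 1) a) (hb : HasChi B (q + 1) b) (hc : HasChi (A ∩ B : Set X) q c) :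
    HasChi C (q + 1) (a + b - c) := by
  have key : ∀ S : Set X, S ⊆ C → Nonempty (S ≃ₜ (Subtype.val ⁻¹' S : Set C)) := by
    intro S hS
    exact ⟨{ toFun := fun x => ⟨⟨x.1, hS x.2⟩, x.2⟩
             invFun := fun x => ⟨x.1.1, x.2⟩
             left_inv := fun _ => rfl
             right_inv := fun _ => rfl
             continuous_toFun := by fun_prop
             continuous_invFun := by fun_prop }⟩
  have hAC : A ⊆ C := hA ▸ Set.inter_subset_left
  have hBC : B ⊆ C := hB ▸ Set.inter_subset_left
  refine HasChi.union (A := Subtype.val ⁻¹' A) (B := Subtype.val ⁻¹' B) ?_ ?_ ?_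
    (ha.of_homeomorph (key A hAC).some) (hb.of_homeomorph (key B hBC).some)
    (hc.of_homeomorph (key _ (Set.inter_subset_left.trans hAC)).some)
  · have : (Subtype.val ⁻¹' A : Set C) = Subtype.val ⁻¹' U := by
      ext x
      simp [hA]
    rw [this]
    exact hU.preimage continuous_subtype_val
  · have : (Subtype.val ⁻¹' B : Set C) = Subtype.val ⁻¹' V := by
      ext x
      simp [hB]
    rw [this]
    exact hV.preimage continuous_subtype_val
  · ext x
    simpa [hA, hB, x.2] using hC x.2

end EulerChar
end

noncomputable section

/-! ### Local structure of branched coverings -/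

namespace SingularSurface

open Filter Set

/-! #### The wedge of disks -/

lemma wedgeBranch_zero {m : ℕ} (i : Fin m) (h : (0 : ℂ) ∈ unitDisk) :
    wedgeBranch i ⟨0, h⟩ = wedgeCenter m := by
  apply Subtype.ext
  simp [wedgeBranch, wedgeCenter]

lemma wedgeBranch_apply_same {m : ℕ} (i : Fin m) (z : unitDisk) : (wedgeBranch i z).1 i = z := by
  simp [wedgeBranch]

lemma wedgeBranch_apply_of_ne {m : ℕ} {i j : Fin m} (h : j ≠ i) (z : unitDisk) :
    (wedgeBranch i z).1 j = 0 := by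
  simp [wedgeBranch, h]

lemma eq_wedgeBranch {m : ℕ} (p : diskWedge m) {i : Fin m} (h : ∀ j ≠ i, p.1 j = 0) :
    p = wedgeBranch i ⟨p.1 i, mem_ball_zero_iff.mpr (p.2.1 i)⟩ := by
  apply Subtype.ext
  funext j
  by_cases hj : j = i
  · subst hj
    rw [wedgeBranch_apply_same]
  · rw [wedgeBranch_apply_of_ne hj, h j hj]

lemma eq_wedgeBranch_of_ne_zero {m : ℕ} (p : diskWedge m) {i : Fin m} (h : p.1 i ≠ 0) :
    p = wedgeBranch i ⟨p.1 i, mem_ball_zero_iff.mpr (p.2.1 i)⟩ :=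
  eq_wedgeBranch p fun j hj => by
    by_contra hne
    exact hj (p.2.2 j i hne h)

lemma exists_eq_wedgeBranch {m : ℕ} (hm : 1 ≤ m) (p : diskWedge m) :
    ∃ i z, p = wedgeBranch i z := by
  by_cases h : ∃ i, p.1 i ≠ 0
  · obtain ⟨i, hi⟩ := h
    exact ⟨i, _, eq_wedgeBranch_of_ne_zero p hi⟩
  · push Not at h
    exact ⟨⟨0, hm⟩, _, eq_wedgeBranch p fun j _ => h j⟩

lemma continuous_wedgeBranch {m : ℕ} (i : Fin m) : Continuous (wedgeBranch i) := by
  refine Continuous.subtype_mk ?_ _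
  exact (continuous_single i).comp continuous_subtype_val

lemma wedgeBranch_injective {m : ℕ} (i : Fin m) : Function.Injective (wedgeBranch i) := by
  intro z z' h
  apply Subtype.ext
  rw [← wedgeBranch_apply_same i z, h, wedgeBranch_apply_same]

lemma wedgeBranch_eq_iff {m : ℕ} {i j : Fin m} {z w : unitDisk} (hz : (z : ℂ) ≠ 0)
    (h : wedgeBranch i z = wedgeBranch j w) : i = j ∧ z = w := by
  have hij : i = j := by
    by_contra hij
    apply hz
    rw [← wedgeBranch_apply_same i z, h, wedgeBranch_apply_of_ne hij]
  subst hij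
  exact ⟨rfl, wedgeBranch_injective i h⟩

lemma wedgeBranch_isLocalHomeomorphOn {m : ℕ} (i : Fin m) :
    IsLocalHomeomorphOn (wedgeBranch i) {z : unitDisk | (z : ℂ) ≠ 0} := by
  have hc : Continuous fun p : diskWedge m => p.1 i :=
    (continuous_apply i).comp continuous_subtype_val
  let e : OpenPartialHomeomorph unitDisk (diskWedge m) :=
    { toFun := wedgeBranch i
      invFun := fun p => ⟨p.1 i, mem_ball_zero_iff.mpr (p.2.1 i)⟩
      source := {z | (z : ℂ) ≠ 0}
      target := {p | p.1 i ≠ 0}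
      map_source' := fun z hz => by
        change (wedgeBranch i z).1 i ≠ 0
        rwa [wedgeBranch_apply_same]
      map_target' := fun p hp => hp
      left_inv' := fun z _ => Subtype.ext (wedgeBranch_apply_same i z)
      right_inv' := fun p hp => (eq_wedgeBranch_of_ne_zero p hp).symm
      open_source := isOpen_ne.preimage continuous_subtype_val
      open_target := isOpen_ne.preimage hc
      continuousOn_toFun := (continuous_wedgeBranch i).continuousOn
      continuousOn_invFun := (hc.subtype_mk _).continuousOn }
  intro z hz
  exact ⟨e, hz, rfl⟩

lemma isOpenEmbedding_wedgeBranch_one : IsOpenEmbedding (wedgeBranch (0 : Fin 1)) := by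
  have hs : ∀ p : diskWedge 1, p = wedgeBranch 0 ⟨p.1 0, mem_ball_zero_iff.mpr (p.2.1 0)⟩ :=
    fun p => eq_wedgeBranch p fun j hj => absurd (Subsingleton.elim j 0) hj
  let e : unitDisk ≃ₜ diskWedge 1 :=
    { toFun := wedgeBranch 0
      invFun := fun p => ⟨p.1 0, mem_ball_zero_iff.mpr (p.2.1 0)⟩
      left_inv := fun z => Subtype.ext (wedgeBranch_apply_same (0 : Fin 1) z)
      right_inv := fun p => (hs p).symm
      continuous_toFun := continuous_wedgeBranch 0
      continuous_invFun :=
        ((continuous_apply (0 : Fin 1)).comp continuous_subtype_val).subtype_mk _ }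
  exact e.isOpenEmbedding

lemma diskPow_isLocalHomeomorphOn {k : ℕ} (hk : 1 ≤ k) :
    IsLocalHomeomorphOn (diskPow k hk) {z : unitDisk | (z : ℂ) ≠ 0} := by
  have hval : IsLocalHomeomorph (Subtype.val : unitDisk → ℂ) :=
    Metric.isOpen_ball.isOpenEmbedding_subtypeVal.isLocalHomeomorph
  have hpow : IsLocalHomeomorphOn (fun z : ℂ => z ^ k) {0}ᶜ := by
    have := (isCoveringMapOn_npow (𝕜 := ℂ) k (by norm_cast; omega)).isLocalHomeomorphOn
    refine this.mono fun z hz => ?_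
    simpa using pow_ne_zero k hz
  refine IsLocalHomeomorphOn.of_comp_left (g := Subtype.val) ?_
    (hval.isLocalHomeomorphOn.mono (subset_univ _)) fun z _ => ?_
  · have : (Subtype.val ∘ diskPow k hk : unitDisk → ℂ) = (fun z : ℂ => z ^ k) ∘ Subtype.val := rfl
    rw [this]
    refine IsLocalHomeomorphOn.comp hpow (hval.isLocalHomeomorphOn.mono (subset_univ _)) ?_
    intro z hz
    exact hz
  · refine Continuous.continuousAt (Continuous.subtype_mk ?_ _)
    exact continuous_subtype_val.pow k

variable {X : Type} [TopologicalSpace X]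

/-! #### Regular points -/

/-- `f` is a local homeomorphism at `x`. -/
def IsRegularAt (f : X → Sphere2) (x : X) : Prop := IsLocalHomeomorphOn f {x}

/-- Every small punctured neighbourhood of `v` covers a punctured neighbourhood of `f v` exactly
`d` times. -/
def HasLocalCount (f : X → Sphere2) (v : X) (d : ℕ) : Prop :=
  ∀ N ∈ 𝓝 v, ∃ V ⊆ N, IsOpen V ∧ v ∈ V ∧ V ∩ f ⁻¹' {f v} = {v} ∧
    ∀ᶠ w in 𝓝[≠] (f v), (V ∩ f ⁻¹' {w}).encard = d

/-- Connectedness makes the number of sheets independent of the point. Together with nontriviality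
it also excludes isolated points, so values arbitrarily close to f v but different from it exist. -/
instance : ConnectedSpace Sphere2 := by
  refine Subtype.connectedSpace (isConnected_sphere ?_ _ zero_le_one)
  rw [← Module.finrank_eq_rank, finrank_euclideanSpace_fin]
  norm_num

instance : Nontrivial Sphere2 := by
  refine ⟨⟨⟨EuclideanSpace.single 0 1, by simp⟩, ⟨EuclideanSpace.single 1 1, by simp⟩, fun h => ?_⟩⟩
  have := congrArg (fun p : Sphere2 => p.1 0) h
  simp at this

/-- Nesting a neighbourhood that realises one count inside one that realises the other, and
comparing fibres over a common nearby value, gives the inequality. Hence the local degree is a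
topological invariant, free of coordinates. -/
lemma HasLocalCount.le {f : X → Sphere2} {v : X} {d d' : ℕ} (h : HasLocalCount f v d)
    (h' : HasLocalCount f v d') : d ≤ d' := by
  obtain ⟨V, -, hVo, hv, -, hV⟩ := h' univ univ_mem
  obtain ⟨V', hV'V, -, -, -, hV'⟩ := h V (hVo.mem_nhds hv)
  obtain ⟨w, hw, hw'⟩ := (hV.and hV').exists
  have : (d : ℕ∞) ≤ d' := by
    rw [← hw, ← hw']
    exact encard_le_encard (inter_subset_inter_left _ hV'V)
  exact_mod_cast this

lemma HasLocalCount.unique {f : X → Sphere2} {v : X} {d d' : ℕ} (h : HasLocalCount f v d)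
    (h' : HasLocalCount f v d') : d = d' := le_antisymm (h.le h') (h'.le h)

lemma IsRegularAt.hasLocalCount {f : X → Sphere2} {x : X} (h : IsRegularAt f x) :
    HasLocalCount f x 1 := by
  intro N hN
  obtain ⟨e, hxe, rfl⟩ := h x rfl
  obtain ⟨O, hON, hO, hxO⟩ := mem_nhds_iff.mp hN
  refine ⟨e.source ∩ O, inter_subset_right.trans hON, e.open_source.inter hO, ⟨hxe, hxO⟩, ?_, ?_⟩
  · refine Subset.antisymm (fun y hy => e.injOn hy.1.1 hxe hy.2) ?_
    rintro _ rfl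
    exact ⟨⟨hxe, hxO⟩, rfl⟩
  · have hopen : IsOpen (e '' (e.source ∩ O)) :=
      e.isOpen_image_of_subset_source (e.open_source.inter hO) inter_subset_left
    filter_upwards [mem_nhdsWithin_of_mem_nhds (hopen.mem_nhds ⟨x, ⟨hxe, hxO⟩, rfl⟩)] with w hw
    obtain ⟨y, hy, rfl⟩ := hw
    rw [Nat.cast_one, encard_eq_one]
    refine ⟨y, Subset.antisymm (fun z hz => e.injOn hz.1.1 hy.1 hz.2) ?_⟩
    rintro _ rfl
    exact ⟨hy, rfl⟩

lemma card_nthRoots_toFinset {k : ℕ} (hk : 1 ≤ k) {u : ℂ} (hu : u ≠ 0) :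
    (Polynomial.nthRoots k u).toFinset.card = k := by
  classical
  have hζ := Complex.isPrimitiveRoot_exp k (by omega)
  rw [Multiset.toFinset_card_of_nodup (hζ.nthRoots_nodup hu), hζ.card_nthRoots, if_pos]
  exact ⟨u ^ ((k : ℂ)⁻¹), Complex.cpow_nat_inv_pow u (by omega)⟩

/-- Over a value near f v, but different from it, the i-th branch contributes the k_i distinct
k_i-th roots of a non-zero number. Branches meet only at the centre, so these contributions are
disjoint. -/
lemma HasBranchDegrees.hasLocalCount {f : X → Sphere2} {v : X} {m : ℕ} {k : Fin m → ℕ}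
    (h : HasBranchDegrees f v m k) : HasLocalCount f v (∑ i, k i) := by
  classical
  obtain ⟨hm, φ, hφ, hφv, hbr⟩ := h
  choose hk ψ hψ hf using hbr
  have h0 : (0 : ℂ) ∈ unitDisk := by simp
  have hf0 : ∀ i, ψ i ⟨0, h0⟩ = f v := by
    intro i
    rw [← hφv, ← wedgeBranch_zero i h0, hf]
    congr 1
    apply Subtype.ext
    simp [diskPow, show k i ≠ 0 by have := hk i; omega]
  intro N hN
  rw [← hφv] at hN
  obtain ⟨ε, hε, hball⟩ := Metric.mem_nhds_iff.mp (hφ.continuous.continuousAt hN)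
  have hmem : ∀ i (z : unitDisk), ‖(z : ℂ)‖ < ε → wedgeBranch i z ∈ Metric.ball (wedgeCenter m) ε := by
    intro i z hz
    change dist (wedgeBranch i z).1 (wedgeCenter m).1 < ε
    rw [dist_pi_lt_iff hε]
    intro j
    change dist ((wedgeBranch i z).1 j) 0 < ε
    rw [dist_zero_right]
    by_cases hj : j = i
    · subst hj
      rwa [wedgeBranch_apply_same]
    · rw [wedgeBranch_apply_of_ne hj, norm_zero]
      exact hε
  have hmem' : ∀ i (z : unitDisk), wedgeBranch i z ∈ Metric.ball (wedgeCenter m) ε → ‖(z : ℂ)‖ < ε := by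
    intro i z hz
    change dist (wedgeBranch i z).1 (wedgeCenter m).1 < ε at hz
    rw [dist_pi_lt_iff hε] at hz
    have := hz i
    change dist ((wedgeBranch i z).1 i) 0 < ε at this
    rwa [dist_zero_right, wedgeBranch_apply_same] at this
  refine ⟨φ '' Metric.ball (wedgeCenter m) ε, image_subset_iff.mpr hball,
    hφ.isOpenMap _ Metric.isOpen_ball, ⟨_, Metric.mem_ball_self hε, hφv⟩, ?_, ?_⟩
  · refine Subset.antisymm ?_ ?_
    · rintro _ ⟨⟨p, hp, rfl⟩, hpv⟩
      obtain ⟨i, z, rfl⟩ := exists_eq_wedgeBranch hm p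
      rw [mem_preimage, mem_singleton_iff, hf, ← hf0 i] at hpv
      have hz := congrArg Subtype.val ((hψ i).injective hpv)
      have hz0 : (z : ℂ) = 0 := eq_zero_of_pow_eq_zero (n := k i) hz
      have : z = ⟨0, h0⟩ := Subtype.ext hz0
      rw [this, wedgeBranch_zero, hφv]
      rfl
    · rintro _ rfl
      exact ⟨⟨_, Metric.mem_ball_self hε, hφv⟩, rfl⟩
  · have hW : ∀ i, ψ i '' {u : unitDisk | ‖(u : ℂ)‖ < ε ^ k i} ∈ 𝓝 (f v) := by
      intro i
      refine ((hψ i).isOpenMap _ ?_).mem_nhds ⟨⟨0, h0⟩, by simp [hε], hf0 i⟩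
      exact isOpen_lt continuous_subtype_val.norm continuous_const
    filter_upwards [mem_nhdsWithin_of_mem_nhds (iInter_mem.mpr hW), self_mem_nhdsWithin] with w hw hwv
    rw [mem_iInter] at hw
    choose u hu huw using hw
    have hu0 : ∀ i, (u i : ℂ) ≠ 0 := by
      intro i hi
      apply hwv
      rw [mem_singleton_iff, ← huw i, ← hf0 i]
      congr 1
      exact Subtype.ext hi
    let R : Fin m → Finset ℂ := fun i => (Polynomial.nthRoots (k i) (u i : ℂ)).toFinset
    have hR : ∀ i z, z ∈ R i ↔ z ^ k i = u i := fun i z => by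
      simp [R, Polynomial.mem_nthRoots (hk i)]
    -- The radius ε may exceed 1, so membership of the roots in the unit disk is checked separately
    -- from the bound by ε.
    have hdisk : ∀ i, ∀ z ∈ R i, z ∈ unitDisk := by
      intro i z hz
      rw [hR] at hz
      rw [mem_ball_zero_iff]
      by_contra hge
      have h1 : ‖(u i : ℂ)‖ < 1 := mem_ball_zero_iff.mp (u i).2
      rw [← hz, norm_pow] at h1
      exact absurd h1 (not_lt.mpr (one_le_pow₀ (not_lt.mp hge)))
    let F : (Σ i, R i) → X := fun q => φ (wedgeBranch q.1 ⟨q.2.1, hdisk q.1 q.2.1 q.2.2⟩)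
    have hFinj : Function.Injective F := by
      rintro ⟨i, z, hz⟩ ⟨j, z', hz'⟩ h
      have hz0 : z ≠ 0 := by
        rintro rfl
        rw [hR, zero_pow (by have := hk i; omega)] at hz
        exact hu0 i hz.symm
      obtain ⟨hij, hzz⟩ := wedgeBranch_eq_iff hz0 (hφ.injective h)
      obtain rfl : i = j := hij
      obtain rfl : z = z' := congrArg Subtype.val hzz
      rfl
    have hrange : φ '' Metric.ball (wedgeCenter m) ε ∩ f ⁻¹' {w} = range F := by
      refine Subset.antisymm ?_ ?_
      · rintro _ ⟨⟨p, hp, rfl⟩, hpw⟩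
        obtain ⟨i, z, rfl⟩ := exists_eq_wedgeBranch hm p
        rw [mem_preimage, mem_singleton_iff, hf, ← huw i] at hpw
        have hz := congrArg Subtype.val ((hψ i).injective hpw)
        exact ⟨⟨i, z, (hR i z).mpr hz⟩, rfl⟩
      · rintro _ ⟨⟨i, z, hz⟩, rfl⟩
        have hz' := (hR i z).mp hz
        refine ⟨⟨_, hmem i _ ?_, rfl⟩, ?_⟩
        · by_contra hge
          have h1 : ‖(u i : ℂ)‖ < ε ^ k i := hu i
          rw [← hz', norm_pow] at h1
          exact absurd h1 (not_lt.mpr (pow_le_pow_left₀ hε.le (not_lt.mp hge) _))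
        · rw [mem_preimage, mem_singleton_iff, hf, ← huw i]
          congr 1
          exact Subtype.ext hz'
    rw [hrange, ← image_univ, hFinj.injOn.encard_image, encard_univ, ENat.card_eq_coe_fintype_card,
      Fintype.card_sigma]
    congr 1
    refine Finset.sum_congr rfl fun i _ => ?_
    rw [Fintype.card_coe]
    exact card_nthRoots_toFinset (hk i) (hu0 i)

/-- Away from the centre a branch is locally open in the wedge and the power map is a local
homeomorphism. -/
lemma HasBranchDegrees.eventually_isRegularAt {f : X → Sphere2} {v : X} {m : ℕ} {k : Fin m → ℕ}
    (h : HasBranchDegrees f v m k) : ∀ᶠ x in 𝓝[≠] v, IsRegularAt f x := by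
  obtain ⟨hm, φ, hφ, hφv, hbr⟩ := h
  have h0 : (0 : ℂ) ∈ unitDisk := by simp
  have hr : range φ ∈ 𝓝 v := hφ.isOpen_range.mem_nhds ⟨_, hφv⟩
  filter_upwards [mem_nhdsWithin_of_mem_nhds hr, self_mem_nhdsWithin] with x hx hxv
  obtain ⟨p, rfl⟩ := hx
  obtain ⟨i, z, rfl⟩ := exists_eq_wedgeBranch hm p
  have hz : (z : ℂ) ≠ 0 := by
    intro hz
    apply hxv
    have : z = ⟨0, h0⟩ := Subtype.ext hz
    rw [mem_singleton_iff, this, wedgeBranch_zero, hφv]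
  obtain ⟨hk, ψ, hψ, hf⟩ := hbr i
  have h1 : IsLocalHomeomorphOn (φ ∘ wedgeBranch i) {z : unitDisk | (z : ℂ) ≠ 0} :=
    IsLocalHomeomorphOn.comp (hφ.isLocalHomeomorph.isLocalHomeomorphOn)
      (wedgeBranch_isLocalHomeomorphOn i) (mapsTo_univ _ _)
  have h2 : IsLocalHomeomorphOn (f ∘ (φ ∘ wedgeBranch i)) {z : unitDisk | (z : ℂ) ≠ 0} := by
    have : f ∘ (φ ∘ wedgeBranch i) = ψ ∘ diskPow (k i) hk := funext hf
    rw [this]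
    exact IsLocalHomeomorphOn.comp (hψ.isLocalHomeomorph.isLocalHomeomorphOn)
      (diskPow_isLocalHomeomorphOn hk) (mapsTo_univ _ _)
  exact (IsLocalHomeomorphOn.of_comp_right h2 h1).mono
    (singleton_subset_iff.mpr ⟨z, hz, rfl⟩)

/-- All local descriptions of f at v give the same count, so the infimum that defines the local
degree runs over a single number. -/
lemma HasBranchDegrees.localDegree_eq {f : X → Sphere2} {v : X} {m : ℕ} {k : Fin m → ℕ}
    (h : HasBranchDegrees f v m k) : localDegree f v = ∑ i, k i := by
  have hset : {d | ∃ (m : ℕ) (k : Fin m → ℕ), HasBranchDegrees f v m k ∧ d = ∑ i, k i}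
      = {∑ i, k i} := by
    ext d
    refine ⟨?_, fun hd => ⟨m, k, h, hd⟩⟩
    rintro ⟨m', k', h', rfl⟩
    exact h'.hasLocalCount.unique h.hasLocalCount
  rw [localDegree, hset, csInf_singleton]

lemma HasBranchDegrees.le_sum {f : X → Sphere2} {v : X} {m : ℕ} {k : Fin m → ℕ}
    (h : HasBranchDegrees f v m k) : m ≤ ∑ i, k i := by
  obtain ⟨-, φ, -, -, hbr⟩ := h
  calc m = ∑ _i : Fin m, 1 := by simp
    _ ≤ ∑ i, k i := Finset.sum_le_sum fun i _ => (hbr i).1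

lemma HasBranchDegrees.hasWedgeNbhd {f : X → Sphere2} {v : X} {m : ℕ} {k : Fin m → ℕ}
    (h : HasBranchDegrees f v m k) : HasWedgeNbhd X v m := by
  obtain ⟨hm, φ, hφ, hφv, -⟩ := h
  exact ⟨hm, φ, hφ, hφv⟩

/-- As every k_i is at least 1, total degree one forces a single branch with exponent one. -/
lemma IsRegularAt.of_localDegree {f : X → Sphere2} {v : X} {m : ℕ} {k : Fin m → ℕ}
    (h : HasBranchDegrees f v m k) (hd : localDegree f v = 1) : IsRegularAt f v := by
  have hs := h.localDegree_eq
  have hle := h.le_sum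
  obtain ⟨hm, φ, hφ, hφv, hbr⟩ := h
  obtain rfl : m = 1 := by omega
  obtain ⟨hk, ψ, hψ, hf⟩ := hbr 0
  have hk1 : k 0 = 1 := by
    have : ∑ i, k i = k 0 := by simp
    omega
  have h0 : (0 : ℂ) ∈ unitDisk := by simp
  have hp : ∀ z, diskPow (k 0) hk z = z := fun z => Subtype.ext (by simp [diskPow, hk1])
  have h1 : IsLocalHomeomorphOn (φ ∘ wedgeBranch 0) univ :=
    ((hφ.comp isOpenEmbedding_wedgeBranch_one).isLocalHomeomorph).isLocalHomeomorphOn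
  have h2 : IsLocalHomeomorphOn (f ∘ (φ ∘ wedgeBranch 0)) univ := by
    have : f ∘ (φ ∘ wedgeBranch 0) = ψ := funext fun z => (hf z).trans (by rw [hp])
    rw [this]
    exact hψ.isLocalHomeomorph.isLocalHomeomorphOn
  refine (IsLocalHomeomorphOn.of_comp_right h2 h1).mono
    (singleton_subset_iff.mpr ⟨⟨0, h0⟩, trivial, ?_⟩)
  rw [Function.comp_apply, wedgeBranch_zero, hφv]

end SingularSurface
end

noncomputable section

/-! ### Sums of local degrees over fibres -/

namespace SingularSurface

open Filter Set

variable {X : Type} [TopologicalSpace X]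

/-- A subset of a compact space without accumulation points is finite. -/
lemma finite_of_eventually_not [CompactSpace X] {s : Set X}
    (h : ∀ v, ∀ᶠ x in 𝓝[≠] v, x ∉ s) : s.Finite := by
  by_contra hs
  obtain ⟨x, -, hx⟩ := Set.Infinite.exists_accPt_of_subset_isCompact hs isCompact_univ
    (subset_univ _)
  rw [accPt_iff_frequently] at hx
  refine hx ?_
  have := eventually_nhdsWithin_iff.mp (h x)
  filter_upwards [this] with y hy hy'
  exact hy hy'.1 hy'.2

/-- A continuous map that has the local form of a branched covering at every point. -/
structure IsBranched (f : X → Sphere2) : Prop where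
  continuous : Continuous f
  branched : ∀ v, ∃ (m : ℕ) (k : Fin m → ℕ), HasBranchDegrees f v m k

namespace IsBranched

variable {f : X → Sphere2} (hf : IsBranched f)
include hf

lemma hasLocalCount (v : X) : HasLocalCount f v (localDegree f v) := by
  obtain ⟨m, k, h⟩ := hf.branched v
  exact h.localDegree_eq ▸ h.hasLocalCount

lemma eventually_isRegularAt (v : X) : ∀ᶠ x in 𝓝[≠] v, IsRegularAt f x := by
  obtain ⟨m, k, h⟩ := hf.branched v
  exact h.eventually_isRegularAt

lemma one_le_localDegree (v : X) : 1 ≤ localDegree f v := by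
  obtain ⟨m, k, h⟩ := hf.branched v
  rw [h.localDegree_eq]
  exact h.1.trans h.le_sum

lemma isRegularAt_iff (v : X) : IsRegularAt f v ↔ localDegree f v = 1 := by
  obtain ⟨m, k, h⟩ := hf.branched v
  exact ⟨fun hr => (hf.hasLocalCount v).unique hr.hasLocalCount, IsRegularAt.of_localDegree h⟩

lemma finite_not_isRegularAt [CompactSpace X] : {x | ¬ IsRegularAt f x}.Finite :=
  finite_of_eventually_not fun v => by
    filter_upwards [hf.eventually_isRegularAt v] with x hx using not_not.mpr hx

lemma finite_fiber [CompactSpace X] (w : Sphere2) : (f ⁻¹' {w}).Finite := by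
  refine finite_of_eventually_not fun v => ?_
  by_cases hv : f v = w
  · obtain ⟨V, -, hVo, hvV, hV, -⟩ := hf.hasLocalCount v univ univ_mem
    filter_upwards [mem_nhdsWithin_of_mem_nhds (hVo.mem_nhds hvV), self_mem_nhdsWithin]
      with x hx hxv hxw
    subst hv
    exact hxv (hV.subset ⟨hx, hxw⟩)
  · have : f ⁻¹' {w}ᶜ ∈ 𝓝 v := hf.continuous.continuousAt (isOpen_ne.mem_nhds hv)
    filter_upwards [mem_nhdsWithin_of_mem_nhds this] with x hx using hx

end IsBranched

/-- `E` is an open and closed subset of `R`. -/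
structure IsClopenIn (E R : Set X) : Prop where
  subset : E ⊆ R
  eventually : ∀ x ∈ R, ∀ᶠ y in 𝓝 x, y ∈ R → (y ∈ E ↔ x ∈ E)

lemma isClopenIn_self (R : Set X) : IsClopenIn R R :=
  ⟨Subset.rfl, fun x hx => Eventually.of_forall fun y hy => by simp [hx, hy]⟩

lemma IsClopenIn.inter {E R R' : Set X} (h : IsClopenIn E R) (hR : R' ⊆ R) :
    IsClopenIn (E ∩ R') R' :=
  ⟨inter_subset_right, fun x hx => by
    filter_upwards [h.eventually x (hR hx)] with y hy hyR
    rw [mem_inter_iff, mem_inter_iff, hy (hR hyR)]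
    simp [hx, hyR]⟩

/-- The sum of the local degrees over the part in `E` of a fibre. -/
def fiberSum (f : X → Sphere2) (E : Set X) (w : Sphere2) : ℕ :=
  ∑ᶠ x ∈ E ∩ f ⁻¹' {w}, localDegree f x

lemma finsum_mem_const_one {α : Type*} {s : Set α} (hs : s.Finite) :
    ∑ᶠ x ∈ s, (1 : ℕ) = s.ncard := by
  rw [finsum_mem_eq_finite_toFinset_sum _ hs, Finset.sum_const, smul_eq_mul, mul_one,
    ncard_eq_toFinset_card _ hs]

/-- A point x of the fibre over w₀ splits into as many regular points as its local degree. By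
compactness no point of a nearby fibre lies elsewhere, and points over P near x lie in E exactly
when x does. -/
lemma IsBranched.fiberSum_eventuallyEq [CompactSpace X] [T2Space X] {f : X → Sphere2}
    (hf : IsBranched f) {E : Set X} {P : Set Sphere2} (hE : IsClopenIn E (f ⁻¹' P)) {w₀ : Sphere2}
    (hw₀ : w₀ ∈ P) : ∀ᶠ w in 𝓝[P] w₀, fiberSum f E w = fiberSum f E w₀ := by
  have hfin := hf.finite_fiber w₀
  obtain ⟨U, hU, hdisj⟩ := hfin.t2_separation
  have hN : ∀ x ∈ f ⁻¹' {w₀}, U x ∩ {y | y ≠ x → IsRegularAt f y} ∩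
      {y | y ∈ f ⁻¹' P → (y ∈ E ↔ x ∈ E)} ∈ 𝓝 x := by
    intro x hx
    refine inter_mem (inter_mem ((hU x).2.mem_nhds (hU x).1) ?_) (hE.eventually x ?_)
    · exact eventually_nhdsWithin_iff.mp (hf.eventually_isRegularAt x)
    · rw [mem_preimage, mem_singleton_iff.mp hx]
      exact hw₀
  choose! V hVN hVo hxV hVx hVc using fun x (hx : x ∈ f ⁻¹' {w₀}) =>
    hf.hasLocalCount x _ (hN x hx)
  have hopen : (⋃ x ∈ f ⁻¹' {w₀}, V x) ∈ 𝓝ˢ (f ⁻¹' {w₀}) :=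
    (isOpen_biUnion hVo).mem_nhdsSet.mpr fun x hx => mem_biUnion hx (hxV x hx)
  -- The map is closed, so all fibres close to the one over w₀ lie in the union of the chosen
  -- neighbourhoods.
  obtain ⟨W, hW, hWV⟩ := isClosedMap_iff_comap_nhds_le.mp hf.continuous.isClosedMap hopen
  have hcount : ∀ᶠ w in 𝓝 w₀, ∀ x ∈ f ⁻¹' {w₀},
      w ≠ w₀ → (V x ∩ f ⁻¹' {w}).encard = localDegree f x := by
    rw [eventually_all_finite hfin]
    intro x hx
    have := eventually_nhdsWithin_iff.mp (hVc x hx)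
    rwa [mem_singleton_iff.mp hx] at this
  filter_upwards [mem_nhdsWithin_of_mem_nhds hW, mem_nhdsWithin_of_mem_nhds hcount,
    self_mem_nhdsWithin] with w hwW hwc hwP
  by_cases hne : w = w₀
  · rw [hne]
  have hset : E ∩ f ⁻¹' {w} = ⋃ x ∈ E ∩ f ⁻¹' {w₀}, V x ∩ f ⁻¹' {w} := by
    ext y
    simp only [mem_iUnion, exists_prop]
    constructor
    · rintro ⟨hyE, hyw⟩
      have hy : y ∈ f ⁻¹' W := by rw [mem_preimage, mem_singleton_iff.mp hyw]; exact hwW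
      obtain ⟨x, hx, hyx⟩ := mem_iUnion₂.mp (hWV hy)
      have hyP : y ∈ f ⁻¹' P := by rw [mem_preimage, mem_singleton_iff.mp hyw]; exact hwP
      exact ⟨x, ⟨((hVN x hx hyx).2 hyP).mp hyE, hx⟩, hyx, hyw⟩
    · rintro ⟨x, ⟨hxE, hx⟩, hyx, hyw⟩
      have hyP : y ∈ f ⁻¹' P := by rw [mem_preimage, mem_singleton_iff.mp hyw]; exact hwP
      exact ⟨((hVN x hx hyx).2 hyP).mpr hxE, hyw⟩
  have hfw := hf.finite_fiber w
  rw [fiberSum, fiberSum, hset, finsum_mem_biUnion]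
  · refine finsum_mem_congr rfl fun x hx => ?_
    have h1 : ∀ y ∈ V x ∩ f ⁻¹' {w}, localDegree f y = 1 := by
      intro y hy
      rw [← hf.isRegularAt_iff]
      refine (hVN x hx.2 hy.1).1.2 ?_
      rintro rfl
      exact hne (hy.2.symm.trans hx.2)
    rw [finsum_mem_congr rfl h1, finsum_mem_const_one (hfw.subset inter_subset_right)]
    have := hwc x hx.2 hne
    rw [ncard_def, this, ENat.toNat_natCast]
  · intro x hx y hy hxy
    refine Disjoint.mono ?_ ?_ (hdisj hx.2 hy.2 hxy)
    · exact fun z hz => (hVN x hx.2 hz.1).1.1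
    · exact fun z hz => (hVN y hy.2 hz.1).1.1
  · exact hfin.subset inter_subset_right
  · exact fun x _ => hfw.subset inter_subset_right

lemma IsBranched.fiberSum_eq [CompactSpace X] [T2Space X] {f : X → Sphere2}
    (hf : IsBranched f) {E : Set X} {P : Set Sphere2} (hE : IsClopenIn E (f ⁻¹' P))
    (hP : IsPreconnected P) {w w' : Sphere2} (hw : w ∈ P) (hw' : w' ∈ P) :
    fiberSum f E w = fiberSum f E w' := by
  refine hP.constant (f := fiberSum f E) (fun u hu => ?_) hw hw'
  exact continuousWithinAt_const.congr_of_eventuallyEq (hf.fiberSum_eventuallyEq hE hu) rfl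

lemma IsBranched.fiberSum_univ_eq [CompactSpace X] [T2Space X] {f : X → Sphere2}
    (hf : IsBranched f) (w w' : Sphere2) : fiberSum f univ w = fiberSum f univ w' := by
  refine hf.fiberSum_eq (P := univ) ?_ isPreconnected_univ trivial trivial
  rw [preimage_univ]
  exact isClopenIn_self _

lemma fiberSum_eq_ncard {f : X → Sphere2} (hf : IsBranched f) [CompactSpace X] {E : Set X}
    {w : Sphere2} (h : ∀ x ∈ E ∩ f ⁻¹' {w}, IsRegularAt f x) :
    fiberSum f E w = (E ∩ f ⁻¹' {w}).ncard := by
  rw [fiberSum, finsum_mem_congr rfl fun x hx => (hf.isRegularAt_iff x).mp (h x hx),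
    finsum_mem_const_one ((hf.finite_fiber w).subset inter_subset_right)]

/-! ### Critical points of branched coverings -/

namespace BranchedCovering

instance (F : BranchedCovering) : CompactSpace F.surface.carrier := F.compact

lemma isBranched (F : BranchedCovering) : IsBranched F.map := ⟨F.continuous_map, F.branched⟩

end BranchedCovering

lemma Surface.branches_le (S : Surface) {v : S.carrier} {m : ℕ} (h : HasWedgeNbhd S.carrier v m) :
    S.branches v ≤ m := by
  classical
  have h' : ∃ m, HasWedgeNbhd S.carrier v m := ⟨m, h⟩
  rw [Surface.branches, dif_pos h']
  exact Nat.find_le h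

lemma Surface.one_le_branches (S : Surface) (v : S.carrier) : 1 ≤ S.branches v := by
  classical
  rw [Surface.branches]
  split_ifs with h
  · exact (Nat.find_spec h).1
  · exact le_rfl

namespace BranchedCovering

variable (F : BranchedCovering)

lemma branches_le_localDegree (v : F.surface.carrier) :
    F.surface.branches v ≤ localDegree F.map v := by
  obtain ⟨m, k, h⟩ := F.branched v
  rw [h.localDegree_eq]
  exact (F.surface.branches_le h.hasWedgeNbhd).trans h.le_sum

lemma branches_eq_one {v : F.surface.carrier} (h : IsRegularAt F.map v) :
    F.surface.branches v = 1 := by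
  have h1 := F.branches_le_localDegree v
  rw [(F.isBranched.isRegularAt_iff v).mp h] at h1
  have := F.surface.one_le_branches v
  omega

/-- The number of branches lies between 1 and the local degree, so local degree one already forces a
single branch; the genus is then the only source of singularity. -/
lemma notMem_criticalPoints_iff {v : F.surface.carrier} :
    v ∉ F.criticalPoints ↔ IsRegularAt F.map v ∧ F.surface.genus v = 0 := by
  have h1 := F.surface.one_le_branches v
  have h2 := F.branches_le_localDegree v
  rw [F.isBranched.isRegularAt_iff]
  simp only [criticalPoints, mem_ofPred_eq, IsRamificationPoint, Surface.IsSingularPoint,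
    Surface.milnor]
  omega

lemma finite_criticalPoints : F.criticalPoints.Finite := by
  refine (F.isBranched.finite_not_isRegularAt.union F.surface.genus_finite).subset fun v hv => ?_
  by_contra h
  rw [mem_union, not_or] at h
  exact absurd hv (F.notMem_criticalPoints_iff.mpr ⟨not_not.mp h.1, Function.notMem_support.mp h.2⟩)

lemma finite_criticalValues : F.criticalValues.Finite := F.finite_criticalPoints.image _

/-- The number of sheets. -/
def sheets (w : Sphere2) : ℕ := fiberSum F.map univ w

lemma sheets_eq (w w' : Sphere2) : F.sheets w = F.sheets w' := F.isBranched.fiberSum_univ_eq w w'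

lemma sheets_eq_ncard {w : Sphere2} (hw : w ∉ F.criticalValues) :
    F.sheets w = (F.map ⁻¹' {w}).ncard := by
  rw [sheets, fiberSum_eq_ncard F.isBranched, univ_inter]
  rintro x ⟨-, hx⟩
  exact (F.notMem_criticalPoints_iff.mp fun hc => hw ⟨x, hc, hx⟩).1

/-- Counting with local degrees gives the same total over every value and agrees with plain counting
off the critical values, some of which must be missed because the sphere is infinite. -/
lemma isFold_iff (n : ℕ) : F.IsFold n ↔ ∀ w, F.sheets w = n := by
  constructor
  · intro h w
    obtain ⟨w', hw'⟩ : ∃ w', w' ∉ F.criticalValues := by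
      by_contra hc
      push Not at hc
      have : (univ : Set Sphere2).Finite := F.finite_criticalValues.subset fun w _ => hc w
      have hi := infinite_of_mem_nhds w (univ_mem : univ ∈ 𝓝 w)
      exact hi this
    rw [F.sheets_eq w w', F.sheets_eq_ncard hw', ncard_def, h w' hw', ENat.toNat_natCast]
  · intro h w hw
    rw [← (F.isBranched.finite_fiber w).cast_ncard_eq, ← F.sheets_eq_ncard hw, h]

/-- The contribution of a point to the multiplicity of its image. -/
def defect (v : F.surface.carrier) : ℤ := F.surface.milnor v + localDegree F.map v - 1

lemma defect_eq_zero {v : F.surface.carrier} (hv : v ∉ F.criticalPoints) : F.defect v = 0 := by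
  have h := F.notMem_criticalPoints_iff.mp hv
  rw [defect, Surface.milnor, h.2, F.branches_eq_one h.1, (F.isBranched.isRegularAt_iff v).mp h.1]
  norm_num

lemma finite_support_defect : (Function.support F.defect).Finite :=
  F.finite_criticalPoints.subset fun _ hv => by
    by_contra h
    exact hv (F.defect_eq_zero h)

/-- The fibres over the critical values are disjoint, and every point outside them is non-critical
and has defect zero. -/
lemma sum_multiplicity : ∑ᶠ w ∈ F.criticalValues, F.multiplicity w = ∑ᶠ v, F.defect v := by
  have h1 : ∀ w, F.multiplicity w = ∑ᶠ v ∈ F.map ⁻¹' {w}, F.defect v := by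
    intro w
    refine finsum_mem_congr rfl fun v _ => ?_
    simp only [index, defect]
    push_cast
    ring
  simp only [h1]
  rw [← finsum_mem_biUnion, ← finsum_mem_univ F.defect]
  · refine finsum_mem_inter_support_eq' _ _ _ fun x hx => ?_
    simp only [mem_univ, iff_true]
    refine mem_biUnion (x := F.map x) ?_ rfl
    refine mem_image_of_mem _ ?_
    by_contra h
    exact hx (F.defect_eq_zero h)
  · intro w _ w' _ hne
    exact Disjoint.preimage _ (disjoint_singleton.mpr hne)
  · exact F.finite_criticalValues
  · exact fun w _ => F.isBranched.finite_fiber w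

end BranchedCovering

end SingularSurface
end

noncomputable section

/-! ### Coverings of star-convex sets branched over the centre -/

namespace SingularSurface

open Filter Set unitInterval

section Star

variable {E : Type} [TopologicalSpace E] {W : Set ℂ} {c : W}

/-- The point that divides the segment from `w` to the centre `c` in the ratio `T : 1 - T`. -/
def contract (hW : StarConvex ℝ (c : ℂ) W) (w : W) (T : I) : W :=
  ⟨(T : ℝ) • (c : ℂ) + (1 - (T : ℝ)) • (w : ℂ),
    hW w.2 T.2.1 (sub_nonneg.mpr T.2.2) (by ring)⟩

lemma continuous_contract (hW : StarConvex ℝ (c : ℂ) W) :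
    Continuous fun p : W × I => contract hW p.1 p.2 := by
  unfold contract
  fun_prop

lemma contract_zero (hW : StarConvex ℝ (c : ℂ) W) (w : W) : contract hW w 0 = w := by
  simp [contract]

lemma contract_sub (hW : StarConvex ℝ (c : ℂ) W) (w : W) (T : I) :
    (contract hW w T : ℂ) - c = (1 - (T : ℝ)) • ((w : ℂ) - c) := by
  simp only [contract, Complex.real_smul]
  push_cast
  ring

lemma dist_contract (hW : StarConvex ℝ (c : ℂ) W) (w : W) (T : I) :
    dist (contract hW w T) c = (1 - (T : ℝ)) * dist w c := by
  rw [Subtype.dist_eq, Subtype.dist_eq, dist_eq_norm, contract_sub, norm_smul, Real.norm_eq_abs,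
    abs_of_nonneg (sub_nonneg.mpr T.2.2), dist_eq_norm]

lemma contract_ne (hW : StarConvex ℝ (c : ℂ) W) {w : W} (hw : w ≠ c) {T : I} (hT : T ≠ 1) :
    contract hW w T ≠ c := by
  rw [← dist_pos, dist_contract]
  have h1 : (T : ℝ) < 1 := unitInterval.lt_one_iff_ne_one.mpr hT
  exact mul_pos (by linarith) (dist_pos.mpr hw)

/-- Lifting the contraction of a punctured star-convex set to a covering space. -/
lemma exists_lift_contract (hW : StarConvex ℝ (c : ℂ) W) {p : E → W}
    (hp : IsCoveringMapOn p {c}ᶜ) :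
    ∃ L : {x // p x ≠ c} × {T : I // T ≠ 1} → E, Continuous L ∧
      (∀ a, p (L a) = contract hW (p a.1) a.2) ∧ ∀ x, L (x, ⟨0, zero_ne_one⟩) = x := by
  have cov := hp.isCoveringMap_restrictPreimage
  let A : Type := {x // p x ≠ c} × {T : I // T ≠ 1}
  have hpc : Continuous fun x : {x // p x ≠ c} => p x :=
    continuous_subtype_val.comp cov.continuous
  have hmul : ∀ (t T : I), T ≠ 1 → t * T ≠ 1 := by
    intro t T hT h
    have h1 : (T : ℝ) < 1 := unitInterval.lt_one_iff_ne_one.mpr hT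
    have h2 : (t : ℝ) * T = 1 := congrArg Subtype.val h
    nlinarith [t.2.1, t.2.2, T.2.1]
  -- The final time T belongs to the parameter space and t is the homotopy variable: t moves to t·T
  -- along the contraction. Homotopy lifting then gives a lift jointly continuous in x and T, read
  -- off at t = 1. The time T = 1 is excluded because it reaches the branch point.
  let H : C(I × A, ({c}ᶜ : Set W)) :=
    { toFun := fun q => ⟨contract hW (p q.2.1) (q.1 * q.2.2),
        contract_ne hW q.2.1.2 (hmul _ _ q.2.2.2)⟩
      continuous_toFun := by
        refine Continuous.subtype_mk ((continuous_contract hW).comp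
          (f := fun q : I × A => (p q.2.1, q.1 * (q.2.2 : I))) ?_) _
        exact (hpc.comp (continuous_fst.comp continuous_snd)).prodMk
          (continuous_fst.mul (continuous_subtype_val.comp (continuous_snd.comp continuous_snd))) }
  let f : C(A, (p ⁻¹' {c}ᶜ : Set E)) := ⟨fun a => a.1, continuous_fst⟩
  have H0 : ∀ a, H (0, a) = ({c}ᶜ : Set W).restrictPreimage p (f a) := by
    intro a
    apply Subtype.ext
    change contract hW (p a.1) (0 * a.2) = p a.1
    rw [zero_mul, contract_zero]
  let K := cov.liftHomotopy H f H0
  refine ⟨fun a => (K (1, a) : E), ?_, ?_, ?_⟩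
  · exact continuous_subtype_val.comp (K.continuous.comp (Continuous.prodMk_right 1))
  · intro a
    have := congrArg Subtype.val (congrFun (cov.liftHomotopy_lifts H f H0) (1, a))
    refine this.trans ?_
    change contract hW (p a.1) (1 * a.2) = _
    rw [one_mul]
  · intro x
    -- For T = 0 the path in the base is constant, so its lift is constant by uniqueness.
    let a : A := (x, ⟨0, zero_ne_one⟩)
    have h0 : (ContinuousMap.const I (({c}ᶜ : Set W).restrictPreimage p (f a))) 0
      = ({c}ᶜ : Set W).restrictPreimage p (f a) := rfl
    have h1 : (fun t => K (t, a)) = cov.liftPath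
        (.const I (({c}ᶜ : Set W).restrictPreimage p (f a))) (f a) h0 := by
      rw [cov.eq_liftPath_iff]
      refine ⟨K.continuous.comp (Continuous.prodMk_left a), ?_, ?_⟩
      · funext t
        refine (congrFun (cov.liftHomotopy_lifts H f H0) (t, a)).trans ?_
        apply Subtype.ext
        change contract hW (p x) (t * 0) = p x
        rw [mul_zero, contract_zero]
      · exact cov.liftHomotopy_zero H f H0 a
    have h2 := cov.liftPath_const (e := f a) (hpe := rfl)
    exact congrArg Subtype.val ((congrFun h1 1).trans (DFunLike.congr_fun h2 1))

/-- A branched covering of a star-convex set, branched only over the centre, deformation retracts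
onto the central fibre. -/
theorem exists_deformation_retraction [T2Space E] (hW : StarConvex ℝ (c : ℂ) W) {p : E → W}
    (hpc : Continuous p) (hcl : IsClosedMap p) (hfin : (p ⁻¹' {c}).Finite)
    (hp : IsCoveringMapOn p {c}ᶜ) :
    ∃ Λ : E × I → E, Continuous Λ ∧ (∀ x, Λ (x, 0) = x) ∧ (∀ x, p (Λ (x, 1)) = c) ∧
      ∀ x T, p x = c → Λ (x, T) = x := by
  classical
  obtain ⟨L, hLc, hLp, hL0⟩ := exists_lift_contract hW hp
  obtain ⟨V, hV, hdisj⟩ := hfin.t2_separation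
  -- Closedness of p makes every neighbourhood of the central fibre contain the preimage of a small
  -- ball.
  have hnear : ∀ O : Set E, IsOpen O → p ⁻¹' {c} ⊆ O → ∃ ε > 0, ∀ x, dist (p x) c < ε → x ∈ O := by
    intro O hO hsub
    obtain ⟨B, hB, hBO⟩ := isClosedMap_iff_comap_nhds_le.mp hcl (hO.mem_nhdsSet.mpr hsub)
    obtain ⟨ε, hε, hεB⟩ := Metric.mem_nhds_iff.mp hB
    exact ⟨ε, hε, fun x hx => hBO (hεB hx)⟩
  obtain ⟨ε₀, hε₀, hcov⟩ := hnear (⋃ y ∈ p ⁻¹' {c}, V y) (isOpen_biUnion fun y _ => (hV y).2)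
    fun y hy => mem_biUnion hy (hV y).1
  have hkey : ∀ z ∈ p ⁻¹' {c}, ∀ O : Set E, IsOpen O → z ∈ O →
      ∃ ε > 0, ε ≤ ε₀ ∧ ∀ x, dist (p x) c < ε → x ∈ V z → x ∈ O := by
    intro z hz O hO hzO
    obtain ⟨ε, hε, h⟩ := hnear (O ∪ ⋃ y ∈ p ⁻¹' {c} \ {z}, V y)
      (hO.union (isOpen_biUnion fun y _ => (hV y).2)) (fun y hy => by
        by_cases hyz : y = z
        · exact Or.inl (hyz ▸ hzO)
        · exact Or.inr (mem_biUnion (x := y) ⟨hy, hyz⟩ (hV y).1))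
    refine ⟨min ε ε₀, lt_min hε hε₀, min_le_right _ _, fun x hx hxV => ?_⟩
    refine (h x (hx.trans_le (min_le_left _ _))).resolve_right fun hx' => ?_
    obtain ⟨y, ⟨hy, hyz⟩, hxy⟩ := mem_iUnion₂.mp hx'
    exact (hdisj hy hz hyz).le_bot ⟨hxy, hxV⟩
  have hdist : ∀ a, dist (p (L a)) c = (1 - ((a.2 : I) : ℝ)) * dist (p a.1) c := fun a => by
    rw [hLp, dist_contract]
  have hle : ∀ (x : E) {T₀ T : I}, T₀ ≤ T →
      (1 - (T : ℝ)) * dist (p x) c ≤ (1 - (T₀ : ℝ)) * dist (p x) c := fun x T₀ T h =>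
    mul_le_mul_of_nonneg_right (sub_le_sub_left (show (T₀ : ℝ) ≤ T from h) _) dist_nonneg
  -- Close to the central fibre a lifted curve runs in a disjoint union of the open sets V y, so by
  -- connectedness it cannot change from one to another.
  have hstay : ∀ z ∈ p ⁻¹' {c}, ∀ (x : {x // p x ≠ c}) (T₀ T : {T : I // T ≠ 1}), T₀ ≤ T →
      L (x, T₀) ∈ V z → (1 - ((T₀ : I) : ℝ)) * dist (p x) c < ε₀ → L (x, T) ∈ V z := by
    intro z hz x T₀ T hT hLV hd
    have hmin : ∀ τ : I, min τ T ≠ 1 := fun τ h =>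
      T.2 (le_antisymm le_one' (h.ge.trans (min_le_right _ _)))
    let u : I → E := fun τ => L (x, ⟨min τ T, hmin τ⟩)
    have hu : Continuous u := hLc.comp (continuous_const.prodMk
      (Continuous.subtype_mk (continuous_id.min continuous_const) _))
    have hpre : IsPreconnected (u '' Icc (T₀ : I) T) := isPreconnected_Icc.image u hu.continuousOn
    have hu0 : u T₀ = L (x, T₀) := by
      have : min (T₀ : I) T = T₀ := min_eq_left hT
      simp only [u, this]
    have hu1 : u T = L (x, T) := by simp only [u, min_self]
    have hsub : u '' Icc (T₀ : I) T ⊆ V z ∪ ⋃ y ∈ p ⁻¹' {c} \ {z}, V y := by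
      rintro _ ⟨τ, hτ, rfl⟩
      have h1 : dist (p (u τ)) c < ε₀ := by
        rw [hdist]
        exact (hle x (le_min hτ.1 hT)).trans_lt hd
      obtain ⟨y, hy, hyV⟩ := mem_iUnion₂.mp (hcov _ h1)
      by_cases hyz : y = z
      · exact Or.inl (hyz ▸ hyV)
      · exact Or.inr (mem_biUnion (x := y) ⟨hy, hyz⟩ hyV)
    have hd' : Disjoint (V z) (⋃ y ∈ p ⁻¹' {c} \ {z}, V y) := by
      rw [disjoint_iUnion₂_right]
      exact fun y hy => hdisj hz hy.1 (Ne.symm hy.2)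
    have := hpre.subset_left_of_subset_union (hV z).2 (isOpen_biUnion fun y _ => (hV y).2) hd'
      hsub ⟨u T₀, mem_image_of_mem u ⟨le_rfl, hT⟩, hu0 ▸ hLV⟩
    exact hu1 ▸ this (mem_image_of_mem u ⟨hT, le_rfl⟩)
  have hsmall : ∀ (x : E) (ε : ℝ), 0 < ε → ∃ T : {T : I // T ≠ 1},
      (1 - ((T : I) : ℝ)) * dist (p x) c < ε := by
    intro x ε hε
    set δ := dist (p x) c
    have hδ : 0 ≤ δ := dist_nonneg
    have h1 : δ / (δ + ε) < 1 := (div_lt_one (by positivity)).mpr (by linarith)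
    -- At this time the remaining distance is εδ/(δ + ε), which is less than ε, and the time is less
    -- than 1 even if δ = 0.
    refine ⟨⟨⟨δ / (δ + ε), by positivity, h1.le⟩, fun h => h1.ne (congrArg Subtype.val h)⟩, ?_⟩
    change (1 - δ / (δ + ε)) * δ < ε
    have : (1 - δ / (δ + ε)) * δ = ε * (δ / (δ + ε)) := by
      field_simp
      ring
    rw [this]
    nlinarith
  have hlim : ∀ x : {x // p x ≠ c}, ∃ z ∈ p ⁻¹' {c}, ∃ T₀ : {T : I // T ≠ 1},
      (1 - ((T₀ : I) : ℝ)) * dist (p x) c < ε₀ ∧ L (x, T₀) ∈ V z := by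
    intro x
    obtain ⟨T, hT⟩ := hsmall x ε₀ hε₀
    obtain ⟨z, hz, hzV⟩ := mem_iUnion₂.mp (hcov (L (x, T)) ((hdist _).trans_lt hT))
    exact ⟨z, hz, T, hT, hzV⟩
  -- The point r x is the endpoint of the curve of x: from the time R x on, the curve stays in the
  -- neighbourhood V (r x).
  choose r hrF R hR hRV using hlim
  let Λ : E × I → E := fun q =>
    if hx : p q.1 = c then q.1 else if hT : q.2 = 1 then r ⟨q.1, hx⟩ else L (⟨q.1, hx⟩, ⟨q.2, hT⟩)
  have hΛc : ∀ (x : E) (T : I), p x = c → Λ (x, T) = x := fun x T hx => dif_pos hx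
  have hΛ1 : ∀ (x : {x // p x ≠ c}), Λ (x, 1) = r x := fun x => by
    simp only [Λ, dif_neg x.2, dif_pos]
  have hΛL : ∀ (x : {x // p x ≠ c}) (T : {T : I // T ≠ 1}), Λ (x, T) = L (x, T) := fun x T => by
    simp only [Λ, dif_neg x.2, dif_neg T.2]
  -- The common estimate behind continuity at the fibre and at time 1: a curve that is near z at
  -- time T₀ remains in O afterwards, and its endpoint is z.
  have hK : ∀ z ∈ p ⁻¹' {c}, ∀ (O : Set E) (ε : ℝ), z ∈ O → ε ≤ ε₀ →
      (∀ x, dist (p x) c < ε → x ∈ V z → x ∈ O) → ∀ (x : {x // p x ≠ c}) (T₀ : {T : I // T ≠ 1}),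
      L (x, T₀) ∈ V z → (1 - ((T₀ : I) : ℝ)) * dist (p x) c < ε → ∀ T : I, T₀ ≤ T →
      Λ (x, T) ∈ O := by
    intro z hz O ε hzO hε hO x T₀ hLV hd T hT
    by_cases h1 : T = 1
    · subst h1
      rw [hΛ1]
      have h2 : L (x, max T₀ (R x)) ∈ V z :=
        hstay z hz x T₀ _ (le_max_left _ _) hLV (hd.trans_le hε)
      have h3 : L (x, max T₀ (R x)) ∈ V (r x) :=
        hstay (r x) (hrF x) x (R x) _ (le_max_right _ _) (hRV x) (hR x)
      have : r x = z := by
        by_contra hne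
        exact (hdisj (hrF x) hz hne).le_bot ⟨h3, h2⟩
      exact this ▸ hzO
    · rw [hΛL x ⟨T, h1⟩]
      refine hO _ ?_ (hstay z hz x T₀ ⟨T, h1⟩ hT hLV (hd.trans_le hε))
      rw [hdist]
      exact (hle x hT).trans_lt hd
  refine ⟨Λ, ?_, ?_, ?_, hΛc⟩
  · rw [continuous_iff_continuousAt]
    rintro ⟨x, T⟩
    by_cases hx : p x = c
    · rw [ContinuousAt, hΛc x T hx, tendsto_nhds]
      intro O hO hxO
      obtain ⟨ε, hε, hεle, h⟩ := hkey x hx O hO hxO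
      have h1 : ∀ᶠ q : E × I in 𝓝 (x, T), q.1 ∈ V x :=
        continuousAt_fst.eventually ((hV x).2.mem_nhds (hV x).1)
      have h2 : ∀ᶠ q : E × I in 𝓝 (x, T), dist (p q.1) c < ε := by
        refine ContinuousAt.eventually_lt (f := fun q : E × I => dist (p q.1) c) (by fun_prop)
          continuousAt_const ?_
        simpa [hx] using hε
      filter_upwards [h1, h2] with q hq1 hq2
      by_cases hq : p q.1 = c
      · rw [mem_preimage, hΛc q.1 q.2 hq]
        exact h _ hq2 hq1
      · refine hK x hx O ε hxO hεle h ⟨q.1, hq⟩ ⟨0, zero_ne_one⟩ ?_ ?_ q.2 nonneg'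
        · rw [hL0]
          exact hq1
        · simpa using hq2
    · by_cases hT : T = 1
      · subst hT
        rw [ContinuousAt, hΛ1 ⟨x, hx⟩, tendsto_nhds]
        intro O hO hxO
        set z := r ⟨x, hx⟩
        obtain ⟨ε, hε, hεle, h⟩ := hkey z (hrF _) O hO hxO
        obtain ⟨T₁, hT₁⟩ := hsmall x ε hε
        -- By T₁ the curve is ε-close to the fibre, and by R it has settled in V z. Both properties
        -- at T₂ are open in x, which gives continuity at time 1.
        set T₂ := max T₁ (R ⟨x, hx⟩)
        have h1 : L (⟨x, hx⟩, T₂) ∈ V z :=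
          hstay z (hrF _) ⟨x, hx⟩ (R ⟨x, hx⟩) T₂ (le_max_right _ _) (hRV _) (hR _)
        have h2 : (1 - ((T₂ : I) : ℝ)) * dist (p x) c < ε :=
          (hle x (le_max_left T₁ (R ⟨x, hx⟩))).trans_lt hT₁
        have h3 : ∀ᶠ q : E × I in 𝓝 (x, 1), (1 - ((T₂ : I) : ℝ)) * dist (p q.1) c < ε :=
          ContinuousAt.eventually_lt (f := fun q : E × I => (1 - ((T₂ : I) : ℝ)) * dist (p q.1) c)
            (by fun_prop) continuousAt_const h2
        have h4 : IsOpen (Subtype.val '' {y : {x // p x ≠ c} | L (y, T₂) ∈ V z}) := by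
          refine (isOpen_ne.preimage hpc).isOpenMap_subtype_val _ ?_
          exact (hV z).2.preimage (hLc.comp (Continuous.prodMk_left T₂))
        have h5 : ∀ᶠ q : E × I in 𝓝 (x, 1),
            q.1 ∈ Subtype.val '' {y : {x // p x ≠ c} | L (y, T₂) ∈ V z} :=
          continuousAt_fst.eventually (h4.mem_nhds ⟨⟨x, hx⟩, h1, rfl⟩)
        have h6 : ∀ᶠ q : E × I in 𝓝 (x, 1), (T₂ : I) < q.2 :=
          continuousAt_snd.eventually (lt_mem_nhds (unitInterval.lt_one_iff_ne_one.mpr T₂.2))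
        filter_upwards [h3, h5, h6] with q hq3 hq5 hq6
        obtain ⟨y, hy, hyq⟩ := hq5
        have := hK z (hrF _) O ε hxO hεle h y T₂ hy (hyq ▸ hq3) q.2 hq6.le
        rwa [hyq] at this
      · have hι : IsOpenEmbedding (Prod.map (Subtype.val : {x // p x ≠ c} → E)
            (Subtype.val : {T : I // T ≠ 1} → I)) :=
          (isOpen_ne.preimage hpc).isOpenEmbedding_subtypeVal.prodMap
            isOpen_ne.isOpenEmbedding_subtypeVal
        refine (hι.continuousAt_iff (x := (⟨x, hx⟩, ⟨T, hT⟩))).mp ?_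
        have : Λ ∘ Prod.map (Subtype.val : {x // p x ≠ c} → E)
            (Subtype.val : {T : I // T ≠ 1} → I) = L := by
          funext a
          exact hΛL a.1 a.2
        rw [this]
        exact hLc.continuousAt
  · intro x
    by_cases hx : p x = c
    · exact hΛc x 0 hx
    · rw [hΛL ⟨x, hx⟩ ⟨0, zero_ne_one⟩, hL0]
  · intro x
    by_cases hx : p x = c
    · rw [hΛc x 1 hx, hx]
    · rw [hΛ1 ⟨x, hx⟩]
      exact hrF _

end Star

/-! ### Sets that retract onto finite subsets -/

section Retract

variable {X : Type} [TopologicalSpace X]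

/-- The set `E` deformation retracts onto its subset `F`. -/
def RetractsOnto (E F : Set X) : Prop :=
  F ⊆ E ∧ ∃ Λ : E × I → E, Continuous Λ ∧ (∀ x, Λ (x, 0) = x) ∧ (∀ x, (Λ (x, 1) : X) ∈ F) ∧
    ∀ (x : E) (T : I), (x : X) ∈ F → Λ (x, T) = x

lemma RetractsOnto.hasChi [T1Space X] {E F : Set X} (h : RetractsOnto E F) (hF : F.Finite) :
    EulerChar.HasChi E 0 F.ncard := by
  obtain ⟨hFE, Λ, hΛ, h0, h1, hfix⟩ := h
  have : Finite F := hF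
  have : DiscreteTopology F := inferInstance
  refine EulerChar.HasChi.of_homotopyEquiv ?_ (EulerChar.hasChi_of_finite_discrete F)
  refine ContinuousMap.HomotopyEquiv.symm ⟨⟨fun x => ⟨Λ (x, 1), h1 x⟩, ?_⟩,
    ⟨inclusion hFE, continuous_inclusion hFE⟩, ⟨?_⟩, ?_⟩
  · exact Continuous.subtype_mk
      (continuous_subtype_val.comp (hΛ.comp (Continuous.prodMk_left (1 : I)))) _
  · exact ContinuousMap.Homotopy.symm
      { toFun := fun q => Λ (q.2, q.1)
        continuous_toFun := hΛ.comp continuous_swap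
        map_zero_left := h0
        map_one_left := fun x => rfl }
  · convert ContinuousMap.Homotopic.refl _
    ext x
    exact (congrArg Subtype.val (hfix (inclusion hFE x) 1 x.2)).symm

/-- The end of the retraction maps a connected set onto a finite set, and finite connected sets in a
T₁ space have at most one point. -/
lemma RetractsOnto.subsingleton_of_isPreconnected [T1Space X] {E F : Set X} (h : RetractsOnto E F)
    (hF : F.Finite) (hE : IsPreconnected E) : F.Subsingleton := by
  obtain ⟨hFE, Λ, hΛ, h0, h1, hfix⟩ := h
  have : PreconnectedSpace E := isPreconnected_iff_preconnectedSpace.mp hE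
  have hr : IsPreconnected (range fun z : E => (Λ (z, 1) : X)) :=
    isPreconnected_range (continuous_subtype_val.comp (hΛ.comp (Continuous.prodMk_left (1 : I))))
  have hsub : F ⊆ range fun z : E => (Λ (z, 1) : X) := fun x hx =>
    ⟨⟨x, hFE hx⟩, congrArg Subtype.val (hfix ⟨x, hFE hx⟩ 1 hx)⟩
  refine Subsingleton.anti ?_ hsub
  by_contra hs
  refine hr.infinite_of_nontrivial (not_subsingleton_iff.mp hs) (hF.subset ?_)
  rintro _ ⟨z, rfl⟩
  exact h1 z

/-- Disjoint open neighbourhoods make both pieces open in the union, so the two retractions may be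
pasted. This serves for the two half-disks of a punctured disk. -/
lemma RetractsOnto.union {E F U E' F' U' : Set X} (h : RetractsOnto E F) (h' : RetractsOnto E' F')
    (hU : IsOpen U) (hU' : IsOpen U') (hd : Disjoint U U') (hE : E ⊆ U) (hE' : E' ⊆ U') :
    RetractsOnto (E ∪ E') (F ∪ F') := by
  classical
  obtain ⟨hFE, Λ, hΛ, h0, h1, hfix⟩ := h
  obtain ⟨hFE', Λ', hΛ', h0', h1', hfix'⟩ := h'
  have hdE : ∀ x ∈ E', x ∉ E := fun x hx' hx => hd.le_bot ⟨hE hx, hE' hx'⟩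
  have hmem : ∀ x : (E ∪ E' : Set X), (x : X) ∉ E → (x : X) ∈ E' := fun x hx => x.2.resolve_left hx
  let ι : E → (E ∪ E' : Set X) := inclusion subset_union_left
  let ι' : E' → (E ∪ E' : Set X) := inclusion subset_union_right
  let Γ : (E ∪ E' : Set X) × I → (E ∪ E' : Set X) := fun q =>
    if hq : (q.1 : X) ∈ E then ι (Λ (⟨q.1, hq⟩, q.2)) else ι' (Λ' (⟨q.1, hmem q.1 hq⟩, q.2))
  have hΓ : ∀ x T, Γ (ι x, T) = ι (Λ (x, T)) := fun x T => dif_pos x.2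
  have hΓ' : ∀ x T, Γ (ι' x, T) = ι' (Λ' (x, T)) := fun x T => dif_neg (hdE x x.2)
  have hι : IsOpenEmbedding ι := by
    refine ⟨IsEmbedding.inclusion _, ?_⟩
    rw [range_inclusion]
    have : {x : (E ∪ E' : Set X) | (x : X) ∈ E} = Subtype.val ⁻¹' U := by
      ext x
      refine ⟨fun hx => hE hx, fun hx => ?_⟩
      by_contra hx'
      exact hd.le_bot ⟨hx, hE' (hmem x hx')⟩
    rw [this]
    exact hU.preimage continuous_subtype_val
  have hι' : IsOpenEmbedding ι' := by
    refine ⟨IsEmbedding.inclusion _, ?_⟩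
    rw [range_inclusion]
    have : {x : (E ∪ E' : Set X) | (x : X) ∈ E'} = Subtype.val ⁻¹' U' := by
      ext x
      refine ⟨fun hx => hE' hx, fun hx => ?_⟩
      by_contra hx'
      exact hd.le_bot ⟨hE (x.2.resolve_right hx'), hx⟩
    rw [this]
    exact hU'.preimage continuous_subtype_val
  have hcases : ∀ x : (E ∪ E' : Set X), (∃ y, ι y = x) ∨ ∃ y, ι' y = x := by
    rintro ⟨x, hx | hx⟩
    · exact Or.inl ⟨⟨x, hx⟩, rfl⟩
    · exact Or.inr ⟨⟨x, hx⟩, rfl⟩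
  refine ⟨union_subset_union hFE hFE', Γ, ?_, ?_, ?_, ?_⟩
  · rw [continuous_iff_continuousAt]
    rintro ⟨x, T⟩
    rcases hcases x with ⟨y, rfl⟩ | ⟨y, rfl⟩
    · refine ((hι.prodMap IsOpenEmbedding.id).continuousAt_iff (x := (y, T))).mp ?_
      have : Γ ∘ Prod.map ι id = ι ∘ Λ := funext fun q => hΓ q.1 q.2
      rw [this]
      exact (hι.continuous.comp hΛ).continuousAt
    · refine ((hι'.prodMap IsOpenEmbedding.id).continuousAt_iff (x := (y, T))).mp ?_
      have : Γ ∘ Prod.map ι' id = ι' ∘ Λ' := funext fun q => hΓ' q.1 q.2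
      rw [this]
      exact (hι'.continuous.comp hΛ').continuousAt
  · intro x
    rcases hcases x with ⟨y, rfl⟩ | ⟨y, rfl⟩
    · rw [hΓ, h0]
    · rw [hΓ', h0']
  · intro x
    rcases hcases x with ⟨y, rfl⟩ | ⟨y, rfl⟩
    · rw [hΓ]
      exact Or.inl (h1 y)
    · rw [hΓ']
      exact Or.inr (h1' y)
  · intro x T hx
    rcases hcases x with ⟨y, rfl⟩ | ⟨y, rfl⟩
    · rw [hΓ, hfix y T (hx.resolve_right fun h => hdE _ (hFE' h) y.2)]
    · rw [hΓ', hfix' y T (hx.resolve_left fun h => hdE _ y.2 (hFE h))]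

end Retract

/-! ### Retraction of a branched covering onto a fibre -/

section Fiber

variable {X : Type} [TopologicalSpace X]

lemma IsClopenIn.isClosed {E R : Set X} (h : IsClopenIn E R) :
    IsClosed {x : R | (x : X) ∈ E} := by
  rw [isClosed_iff_frequently]
  intro x hx
  by_contra hxE
  have h1 := continuous_subtype_val.continuousAt.eventually (h.eventually x x.2)
  obtain ⟨y, hy, hyE⟩ := (h1.and_frequently hx).exists
  exact hxE ((hy y.2).mp hyE)

lemma IsClopenIn.exists_isOpen {E R : Set X} (h : IsClopenIn E R) {x : X} (hx : x ∈ E) :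
    ∃ O, IsOpen O ∧ x ∈ O ∧ O ∩ R ⊆ E := by
  obtain ⟨O, hO, hOo, hxO⟩ := eventually_nhds_iff.mp (h.eventually x (h.subset hx))
  exact ⟨O, hOo, hxO, fun y hy => (hO y hy.1 hy.2).mpr hx⟩

variable [CompactSpace X] {f : X → Sphere2} {φ : ℂ → Sphere2} {W : Set ℂ} {E : Set X}

/-- In a chart of the sphere, a branched covering restricts to a closed map over every subset of
the chart, which is a local homeomorphism at the regular points. -/
lemma IsBranched.exists_chart (hf : IsBranched f) (hφ : IsEmbedding φ)
    (hE : IsClopenIn E (f ⁻¹' (φ '' W))) :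
    ∃ p : E → W, Continuous p ∧ IsClosedMap p ∧ (∀ x, φ (p x) = f x) ∧
      IsLocalHomeomorphOn p {x | IsRegularAt f x} := by
  let e : W ≃ₜ φ '' W := hφ.homeomorphImage W
  let h : E → φ '' W := (φ '' W).restrictPreimage f ∘ inclusion hE.subset
  have hcl : IsClosedMap h := (hf.continuous.isClosedMap.restrictPreimage _).comp
    (IsClosedEmbedding.inclusion hE.subset hE.isClosed).isClosedMap
  have hc : Continuous h := hf.continuous.restrictPreimage.comp (continuous_inclusion hE.subset)
  have hp : ∀ x, φ (e.symm (h x)) = f x := fun x => congrArg Subtype.val (e.apply_symm_apply (h x))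
  refine ⟨e.symm ∘ h, e.symm.continuous.comp hc, e.symm.isClosedMap.comp hcl, hp, ?_⟩
  rw [isLocalHomeomorphOn_iff_isOpenEmbedding_restrict]
  rintro ⟨x, hxE⟩ hx
  obtain ⟨u, hxu, hu⟩ := hx x rfl
  obtain ⟨O, hO, hxO, hOE⟩ := hE.exists_isOpen hxE
  let N : Set E := Subtype.val ⁻¹' (u.source ∩ O)
  have hNo : IsOpen N := (u.open_source.inter hO).preimage continuous_subtype_val
  refine ⟨N, hNo.mem_nhds ⟨hxu, hxO⟩, ?_⟩
  have hNc : Continuous (N.domRestrict (e.symm ∘ h)) :=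
    (e.symm.continuous.comp hc).comp continuous_subtype_val
  have hφc : Continuous fun w : W => φ w := hφ.continuous.comp continuous_subtype_val
  have hcomp : (fun w : W => φ w) ∘ N.domRestrict (e.symm ∘ h)
      = u.source.domRestrict u ∘ fun y : N => ⟨y.1.1, y.2.1⟩ := by
    funext y
    refine (hp y.1).trans ?_
    rw [hu]
    rfl
  have hemb : IsEmbedding (N.domRestrict (e.symm ∘ h)) := by
    refine IsEmbedding.of_comp hNc hφc ?_
    rw [hcomp]
    refine u.isOpenEmbedding_restrict.isEmbedding.comp ?_
    exact IsEmbedding.codRestrict (IsEmbedding.subtypeVal.comp IsEmbedding.subtypeVal)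
      u.source fun y : N => y.2.1
  refine ⟨hemb, ?_⟩
  have hrange : range (N.domRestrict (e.symm ∘ h))
      = (fun w : W => φ w) ⁻¹' (u '' (u.source ∩ O)) := by
    ext w
    constructor
    · rintro ⟨y, rfl⟩
      exact ⟨y.1.1, y.2, by rw [← hu]; exact (hp y.1).symm⟩
    · rintro ⟨y, hy, hyw⟩
      rw [← hu] at hyw
      have hyR : y ∈ f ⁻¹' (φ '' W) := ⟨w, w.2, hyw.symm⟩
      refine ⟨⟨⟨y, hOE ⟨hy.2, hyR⟩⟩, hy⟩, Subtype.ext (hφ.injective ?_)⟩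
      exact (hp _).trans hyw
  rw [hrange]
  exact (u.isOpen_image_of_subset_source (u.open_source.inter hO) inter_subset_left).preimage hφc

variable [T2Space X] {c : ℂ}

/-- Over a star-convex set with no critical values except its centre, a branched covering deformation
retracts onto its central fibre. -/
theorem IsBranched.retractsOnto (hf : IsBranched f) (hφ : IsEmbedding φ)
    (hc : c ∈ W) (hW : StarConvex ℝ c W) (hE : IsClopenIn E (f ⁻¹' (φ '' W)))
    (hreg : ∀ x ∈ E, f x ≠ φ c → IsRegularAt f x) : RetractsOnto E (E ∩ f ⁻¹' {φ c}) := by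
  obtain ⟨p, hpc, hcl, hp, hloc⟩ := hf.exists_chart hφ hE
  have hpw : ∀ (x : E) (w : W), p x = w ↔ f x = φ w := fun x w => by
    rw [← hp, hφ.injective.eq_iff, Subtype.ext_iff]
  have hfin : ∀ w, (p ⁻¹' {w}).Finite := fun w => by
    refine Finite.of_finite_image ((hf.finite_fiber (φ w)).subset ?_)
      Subtype.val_injective.injOn
    rintro _ ⟨x, hx, rfl⟩
    exact (hpw x w).mp hx
  -- A closed map with finite fibres that is a local homeomorphism over a set is a covering there.
  have hcov : IsCoveringMapOn p {(⟨c, hc⟩ : W)}ᶜ :=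
    hcl.isCoveringMapOn_of_isLocalHomeomorphOn (fun w _ => hfin w)
      (hloc.mono fun x hx => hreg x x.2 fun h => hx ((hpw x ⟨c, hc⟩).mpr h))
  obtain ⟨Λ, h1, h2, h3, h4⟩ := SingularSurface.exists_deformation_retraction (c := ⟨c, hc⟩)
    hW hpc hcl (hfin _) hcov
  exact ⟨inter_subset_left, Λ, h1, h2, fun x => ⟨(Λ (x, 1)).2, (hpw _ _).mp (h3 x)⟩,
    fun x T hx => h4 x T ((hpw x ⟨c, hc⟩).mpr hx.2)⟩

theorem IsBranched.hasChi_of_starConvex (hf : IsBranched f) (hφ : IsEmbedding φ)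
    (hc : c ∈ W) (hW : StarConvex ℝ c W) (hE : IsClopenIn E (f ⁻¹' (φ '' W)))
    (hreg : ∀ x ∈ E, f x ≠ φ c → IsRegularAt f x) :
    EulerChar.HasChi E 0 (E ∩ f ⁻¹' {φ c}).ncard :=
  (hf.retractsOnto hφ hc hW hE hreg).hasChi ((hf.finite_fiber _).subset inter_subset_right)

/-- A connected piece retracts onto its part of the central fibre, which is therefore a single
point. This identifies the degree on the neighbourhood of a critical point with the local degree. -/
lemma IsBranched.eq_of_isPreconnected (hf : IsBranched f) (hφ : IsEmbedding φ)
    (hc : c ∈ W) (hW : StarConvex ℝ c W) (hE : IsClopenIn E (f ⁻¹' (φ '' W)))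
    (hreg : ∀ x ∈ E, f x ≠ φ c → IsRegularAt f x) (hpre : IsPreconnected E) {x y : X}
    (hx : x ∈ E) (hy : y ∈ E) (hfx : f x = φ c) (hfy : f y = φ c) : x = y := by
  exact (hf.retractsOnto hφ hc hW hE hreg).subsingleton_of_isPreconnected
    ((hf.finite_fiber _).subset inter_subset_right) hpre ⟨hx, hfx⟩ ⟨hy, hfy⟩

end Fiber

end SingularSurface
end

noncomputable section

/-! ### The Euler characteristic of a branched covering of a convex set -/

namespace SingularSurface

open Filter Set

variable {X : Type} [TopologicalSpace X]

/-- The total ramification of `f` on `E`. -/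
def ramification (f : X → Sphere2) (E : Set X) : ℕ := ∑ᶠ x ∈ E, (localDegree f x - 1)

lemma inter_preimage_image_inter {X : Type} {f : X → Sphere2} {φ : ℂ → Sphere2}
    (hφ : Function.Injective φ) {K : Set ℂ} {E : Set X} (hE : E ⊆ f ⁻¹' (φ '' K)) (H : Set ℂ) :
    E ∩ f ⁻¹' (φ '' (K ∩ H)) = E ∩ f ⁻¹' (φ '' H) := by
  ext x
  simp only [image_inter hφ, preimage_inter, mem_inter_iff]
  exact ⟨fun h => ⟨h.1, h.2.2⟩, fun h => ⟨h.1, hE h.1, h.2⟩⟩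

variable {f : X → Sphere2}

lemma IsBranched.ramification_congr (hf : IsBranched f) {E E' : Set X}
    (h : ∀ x, ¬ IsRegularAt f x → (x ∈ E ↔ x ∈ E')) : ramification f E = ramification f E' := by
  refine finsum_mem_inter_support_eq' _ _ _ fun x hx => h x fun hr => hx ?_
  simp [(hf.isRegularAt_iff x).mp hr]

lemma IsBranched.ramification_eq_zero (hf : IsBranched f) {E : Set X}
    (h : ∀ x ∈ E, IsRegularAt f x) : ramification f E = 0 := by
  rw [hf.ramification_congr (E' := ∅) fun x hx => ⟨fun hxE => hx (h x hxE), fun h => h.elim⟩,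
    ramification, finsum_mem_empty]

lemma fiberSum_inter {E : Set X} {P : Set Sphere2} {w : Sphere2} (hw : w ∈ P) :
    fiberSum f (E ∩ f ⁻¹' P) w = fiberSum f E w := by
  rw [fiberSum, fiberSum, inter_assoc, inter_eq_self_of_subset_right (s := f ⁻¹' P)]
  rintro x rfl
  exact hw

variable [CompactSpace X]

lemma IsBranched.finite_support_ramification (hf : IsBranched f) :
    (Function.support fun x => localDegree f x - 1).Finite := by
  refine hf.finite_not_isRegularAt.subset fun x hx => ?_
  rw [mem_ofPred_eq, hf.isRegularAt_iff]
  intro h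
  exact hx (by simp [h])

lemma IsBranched.ramification_union_inter (hf : IsBranched f) (E E' : Set X) :
    ramification f (E ∪ E') + ramification f (E ∩ E') = ramification f E + ramification f E' :=
  finsum_mem_union_inter' (hf.finite_support_ramification.subset inter_subset_right)
    (hf.finite_support_ramification.subset inter_subset_right)

/-- Each local degree is 1 plus its excess, so a fibre has as many points as the degree minus the
ramification in it. -/
lemma IsBranched.fiberSum_eq_add (hf : IsBranched f) (E : Set X) (w : Sphere2) :
    fiberSum f E w = (E ∩ f ⁻¹' {w}).ncard + ramification f (E ∩ f ⁻¹' {w}) := by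
  have hfin : (E ∩ f ⁻¹' {w}).Finite := (hf.finite_fiber w).subset inter_subset_right
  rw [fiberSum, ramification, ← finsum_mem_const_one hfin, ← finsum_mem_add_distrib hfin]
  refine finsum_mem_congr rfl fun x _ => ?_
  have := hf.one_le_localDegree x
  omega

variable [T2Space X]

lemma IsBranched.hasChi_of_convex_of_regular (hf : IsBranched f) {φ : ℂ → Sphere2}
    (hφ : IsEmbedding φ) {K : Set ℂ} (hK : Convex ℝ K) {w : ℂ} (hw : w ∈ K) {E : Set X}
    (hE : IsClopenIn E (f ⁻¹' (φ '' K))) (hreg : ∀ x ∈ E, IsRegularAt f x) :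
    EulerChar.HasChi E 0 (fiberSum f E (φ w)) := by
  rw [fiberSum_eq_ncard hf fun x hx => hreg x hx.1]
  exact hf.hasChi_of_starConvex hφ hw (hK.starConvex hw) hE fun x hx _ => hreg x hx

/-- **The Riemann–Hurwitz formula** for a branched covering of a convex set in a chart of the
sphere. -/
theorem IsBranched.hasChi_of_convex (hf : IsBranched f) {φ : ℂ → Sphere2} (hφ : IsOpenEmbedding φ)
    {K : Set ℂ} (hK : Convex ℝ K) {w : ℂ} (hw : w ∈ K) {E : Set X}
    (hE : IsClopenIn E (f ⁻¹' (φ '' K))) :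
    EulerChar.HasChi E 1 (fiberSum f E (φ w) - ramification f E) := by
  -- Induction on the number of critical values coming from E. With at most one, the set is
  -- star-shaped about it and the retraction onto the fibre applies.
  induction hN : (f '' {x ∈ E | ¬ IsRegularAt f x}).ncard using Nat.strong_induction_on
    generalizing K w E with
  | _ N ih =>
  have hCfin : (f '' {x ∈ E | ¬ IsRegularAt f x}).Finite :=
    (hf.finite_not_isRegularAt.subset fun x hx => hx.2).image f
  have hpre : IsPreconnected (φ '' K) := hK.isPreconnected.image φ hφ.continuous.continuousOn
  have hEK : ∀ x ∈ E, ∃ z ∈ K, φ z = f x := fun x hx => hE.subset hx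
  by_cases hsub : (f '' {x ∈ E | ¬ IsRegularAt f x}).Subsingleton
  · obtain ⟨c, hc, hreg⟩ : ∃ c ∈ K, ∀ x ∈ E, f x ≠ φ c → IsRegularAt f x := by
      by_cases hne : ∃ x ∈ E, ¬ IsRegularAt f x
      · obtain ⟨x, hxE, hx⟩ := hne
        obtain ⟨c, hc, hcx⟩ := hEK x hxE
        refine ⟨c, hc, fun y hy hyc => ?_⟩
        by_contra hyr
        exact hyc (hcx ▸ hsub ⟨y, ⟨hy, hyr⟩, rfl⟩ ⟨x, ⟨hxE, hx⟩, rfl⟩)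
      · push Not at hne
        exact ⟨w, hw, fun x hx _ => hne x hx⟩
    have h := hf.hasChi_of_starConvex hφ.isEmbedding hc (hK.starConvex hc) hE hreg
    have h1 : ramification f (E ∩ f ⁻¹' {φ c}) = ramification f E :=
      hf.ramification_congr fun x hx => ⟨fun h => h.1, fun hxE => ⟨hxE, by
        by_contra hxc
        exact hx (hreg x hxE hxc)⟩⟩
    have h2 := hf.fiberSum_eq_add E (φ c)
    rw [hf.fiberSum_eq hE hpre (mem_image_of_mem φ hw) (mem_image_of_mem φ hc), h2, h1]
    convert h.mono (Nat.zero_le 1) using 1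
    push_cast
    ring
  · obtain ⟨_, ⟨xa, hxa, rfl⟩, _, ⟨xb, hxb, rfl⟩, hab⟩ := not_subsingleton_iff.mp hsub
    obtain ⟨a, ha, hfa⟩ := hEK xa hxa.1
    obtain ⟨b₀, hb₀, hfb₀⟩ := hEK xb hxb.1
    have hne : b₀ - a ≠ 0 := by
      rw [sub_ne_zero]
      rintro rfl
      exact hab (hfa.symm.trans hfb₀)
    -- A linear functional that separates two critical values a and b₀.
    set ℓ : ℂ → ℝ := fun z => inner ℝ (b₀ - a) z with hℓ
    have hℓc : Continuous ℓ := by fun_prop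
    have hℓab : ℓ a < ℓ b₀ := by
      rw [← sub_pos, hℓ]
      simp only
      rw [← inner_sub_right]
      exact real_inner_self_pos.mpr hne
    have hSfin : {z ∈ K | φ z ∈ f '' {x ∈ E | ¬ IsRegularAt f x} ∧ ℓ a < ℓ z}.Finite :=
      (hCfin.preimage hφ.injective.injOn).subset fun z hz => hz.2.1
    -- Taking b as the next critical level above that of a leaves the open strip between the levels
    -- of a and b free of critical values. The half-planes below b and above a overlap in this
    -- strip, and each omits one of the two critical values.
    obtain ⟨b, ⟨hbK, hbC, hlab⟩, hbmin⟩ := exists_min_image _ ℓ hSfin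
      ⟨b₀, hb₀, hfb₀ ▸ mem_image_of_mem f hxb, hℓab⟩
    have hH₁ : IsOpen {z | ℓ z < ℓ b} := isOpen_lt hℓc continuous_const
    have hH₂ : IsOpen {z | ℓ a < ℓ z} := isOpen_lt continuous_const hℓc
    obtain ⟨xb', ⟨hxb', hxbr⟩, hfb⟩ := hbC
    let K₁ := K ∩ {z | ℓ z < ℓ b}
    let K₂ := K ∩ {z | ℓ a < ℓ z}
    have hlin : ∀ s t : ℝ, ∀ x y : ℂ, ℓ (s • x + t • y) = s * ℓ x + t * ℓ y := fun s t x y => by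
      simp only [hℓ, inner_add_right, inner_smul_right]
    have hK₁ : Convex ℝ K₁ := hK.inter (convex_halfSpace_lt
      ⟨fun x y => by simp only [hℓ, inner_add_right], fun s x => by
        simp only [hℓ, inner_smul_right, smul_eq_mul]⟩ _)
    have hK₂ : Convex ℝ K₂ := hK.inter (convex_halfSpace_gt
      ⟨fun x y => by simp only [hℓ, inner_add_right], fun s x => by
        simp only [hℓ, inner_smul_right, smul_eq_mul]⟩ _)
    obtain ⟨m, hm₁, hm₂⟩ : ∃ m, m ∈ K₁ ∧ m ∈ K₂ := by
      have h2 : ℓ ((1 / 2 : ℝ) • a + (1 / 2 : ℝ) • b) = (ℓ a + ℓ b) / 2 := by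
        rw [hlin]
        ring
      have h3 := hK ha hbK (by norm_num : (0 : ℝ) ≤ 1 / 2) (by norm_num : (0 : ℝ) ≤ 1 / 2)
        (by norm_num)
      refine ⟨(1 / 2 : ℝ) • a + (1 / 2 : ℝ) • b, ⟨h3, ?_⟩, h3, ?_⟩
      · change ℓ _ < ℓ b
        rw [h2]
        linarith
      · change ℓ a < ℓ _
        rw [h2]
        linarith
    have hsub₁ : f ⁻¹' (φ '' K₁) ⊆ f ⁻¹' (φ '' K) := preimage_mono (image_mono inter_subset_left)
    have hsub₂ : f ⁻¹' (φ '' K₂) ⊆ f ⁻¹' (φ '' K) := preimage_mono (image_mono inter_subset_left)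
    let E₁ := E ∩ f ⁻¹' (φ '' K₁)
    let E₂ := E ∩ f ⁻¹' (φ '' K₂)
    have hE₁ : IsClopenIn E₁ (f ⁻¹' (φ '' K₁)) := hE.inter hsub₁
    have hE₂ : IsClopenIn E₂ (f ⁻¹' (φ '' K₂)) := hE.inter hsub₂
    have hmem₁ : ∀ {x z}, x ∈ E → φ z = f x → (x ∈ E₁ ↔ ℓ z < ℓ b) := by
      intro x z hx hz
      refine ⟨fun h => ?_, fun h => ?_⟩
      · obtain ⟨z', hz', hzx⟩ := h.2
        exact hφ.injective (hz.trans hzx.symm) ▸ hz'.2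
      · obtain ⟨z', hz', hzx⟩ := hEK x hx
        exact ⟨hx, z, ⟨hφ.injective (hz.trans hzx.symm) ▸ hz', h⟩, hz⟩
    have hmem₂ : ∀ {x z}, x ∈ E → φ z = f x → (x ∈ E₂ ↔ ℓ a < ℓ z) := by
      intro x z hx hz
      refine ⟨fun h => ?_, fun h => ?_⟩
      · obtain ⟨z', hz', hzx⟩ := h.2
        exact hφ.injective (hz.trans hzx.symm) ▸ hz'.2
      · obtain ⟨z', hz', hzx⟩ := hEK x hx
        exact ⟨hx, z, ⟨hφ.injective (hz.trans hzx.symm) ▸ hz', h⟩, hz⟩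
    have hreg : ∀ x ∈ E₁ ∩ E₂, IsRegularAt f x := by
      rintro x ⟨hx₁, hx₂⟩
      by_contra hx
      obtain ⟨z, hz, hzx⟩ := hEK x hx₁.1
      refine absurd ((hmem₁ hx₁.1 hzx).mp hx₁) (not_lt.mpr (hbmin z ⟨hz, ?_,
        (hmem₂ hx₁.1 hzx).mp hx₂⟩))
      exact ⟨x, ⟨hx₁.1, hx⟩, hzx.symm⟩
    have hunion : E₁ ∪ E₂ = E := by
      refine Subset.antisymm (union_subset inter_subset_left inter_subset_left) fun x hx => ?_
      obtain ⟨z, hz, hzx⟩ := hEK x hx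
      rcases lt_or_ge (ℓ z) (ℓ b) with h | h
      · exact Or.inl ((hmem₁ hx hzx).mpr h)
      · exact Or.inr ((hmem₂ hx hzx).mpr (hlab.trans_le h))
    have hcard : ∀ {E' : Set X} {y : X}, E' ⊆ E → y ∈ E → ¬ IsRegularAt f y →
        (∀ x ∈ E', f x ≠ f y) → (f '' {x ∈ E' | ¬ IsRegularAt f x}).ncard < N := by
      intro E' y hE' hy hyr hne
      rw [← hN]
      refine ncard_lt_ncard ⟨image_mono fun x hx => ⟨hE' hx.1, hx.2⟩, fun h => ?_⟩ hCfin
      obtain ⟨x, hx, hxy⟩ := h (mem_image_of_mem f ⟨hy, hyr⟩)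
      exact hne x hx.1 hxy
    have hχ₁ := ih _ (hcard inter_subset_left hxb' hxbr fun x hx hxb => by
      exact lt_irrefl _ ((hmem₁ hx.1 (hfb.symm.trans hxb.symm)).mp hx)) hK₁ hm₁ hE₁ rfl
    have hχ₂ := ih _ (hcard inter_subset_left hxa.1 hxa.2 fun x hx hxa => by
      exact lt_irrefl _ ((hmem₂ hx.1 (hfa.trans hxa.symm)).mp hx)) hK₂ hm₂ hE₂ rfl
    have hinter : IsClopenIn (E₁ ∩ E₂) (f ⁻¹' (φ '' (K₁ ∩ K₂))) := by
      have h := hE.inter (R' := f ⁻¹' (φ '' (K₁ ∩ K₂)))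
        (preimage_mono (image_mono (inter_subset_left.trans inter_subset_left)))
      rw [image_inter hφ.injective, preimage_inter] at h ⊢
      rwa [inter_inter_distrib_left] at h
    have hχ₁₂ := hf.hasChi_of_convex_of_regular hφ.isEmbedding (hK₁.inter hK₂) ⟨hm₁, hm₂⟩
      hinter hreg
    have hχ := EulerChar.HasChi.union_subset (A := E₁) (B := E₂) (C := E)
      ((hφ.isOpenMap _ hH₁).preimage hf.continuous) ((hφ.isOpenMap _ hH₂).preimage hf.continuous)
      (inter_preimage_image_inter hφ.injective hE.subset _)
      (inter_preimage_image_inter hφ.injective hE.subset _) ?_ hχ₁ hχ₂ hχ₁₂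
    · have hr := hf.ramification_union_inter E₁ E₂
      rw [hunion, hf.ramification_eq_zero hreg, add_zero] at hr
      have hs₁ : fiberSum f E₁ (φ m) = fiberSum f E (φ m) :=
        fiberSum_inter (mem_image_of_mem φ hm₁)
      have hs₂ : fiberSum f E₂ (φ m) = fiberSum f E (φ m) :=
        fiberSum_inter (mem_image_of_mem φ hm₂)
      have hs₁₂ : fiberSum f (E₁ ∩ E₂) (φ m) = fiberSum f E (φ m) := by
        rw [← inter_inter_distrib_left, ← preimage_inter]
        exact fiberSum_inter ⟨mem_image_of_mem φ hm₁, mem_image_of_mem φ hm₂⟩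
      -- All three degrees are computed at m, in the strip; the degrees combine to d + d − d and the
      -- ramifications add.
      rw [hf.fiberSum_eq hE hpre (mem_image_of_mem φ hw) (mem_image_of_mem φ hm₁.1), hr]
      rw [hs₁, hs₂, hs₁₂] at hχ
      convert hχ using 1
      push_cast
      ring
    · intro x hx
      rw [← hunion] at hx
      rcases hx with hx | hx
      · exact Or.inl (preimage_mono (image_mono inter_subset_right) hx.2)
      · exact Or.inr (preimage_mono (image_mono inter_subset_right) hx.2)

end SingularSurface
end

noncomputable section

/-! ### The Riemann–Hurwitz formula for the sphere -/

namespace SingularSurface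

open Filter Set

lemma exists_chart_range_eq (w : Sphere2) :
    ∃ φ : ℂ → Sphere2, IsOpenEmbedding φ ∧ range φ = {w}ᶜ := by
  have : Fact (Module.finrank ℝ (EuclideanSpace ℝ (Fin 3)) = 2 + 1) := ⟨by simp⟩
  let e := stereographic' 2 w
  let L : ℂ ≃ₜ EuclideanSpace ℝ (Fin 2) :=
    Complex.orthonormalBasisOneI.repr.toContinuousLinearEquiv.toHomeomorph
  have ht : e.target = univ := stereographic'_target w
  have he : IsOpenEmbedding e.symm := e.symm.isOpenEmbedding ht
  refine ⟨e.symm ∘ L, he.comp L.isOpenEmbedding, ?_⟩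
  have hs : e.source = {w}ᶜ := stereographic'_source w
  rw [range_comp, L.surjective.range_eq, ← hs, ← e.symm_image_target_eq_source, ht]

lemma exists_chart_apply_zero (w : Sphere2) :
    ∃ φ : ℂ → Sphere2, IsOpenEmbedding φ ∧ φ 0 = w := by
  obtain ⟨v, hv⟩ := exists_ne w
  obtain ⟨φ, hφ, hr⟩ := exists_chart_range_eq v
  obtain ⟨z, hz⟩ : w ∈ range φ := hr ▸ hv.symm
  exact ⟨φ ∘ (Homeomorph.addLeft z), hφ.comp (Homeomorph.addLeft z).isOpenEmbedding, by simpa⟩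

/-- Along a segment from a positive real number the imaginary part stays non-zero unless the other
endpoint is real, hence positive. -/
lemma starConvex_slitPlane {t : ℝ} (ht : 0 < t) : StarConvex ℝ (t : ℂ) Complex.slitPlane := by
  intro y hy a b ha hb hab
  rw [Complex.mem_slitPlane_iff] at hy ⊢
  simp only [Complex.add_re, Complex.smul_re, Complex.ofReal_re, smul_eq_mul, Complex.add_im,
    Complex.smul_im, Complex.ofReal_im, mul_zero, zero_add]
  rcases hb.eq_or_lt with rfl | hb
  · left
    nlinarith
  · rcases hy with hy | hy
    · left
      have := mul_nonneg ha ht.le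
      nlinarith [mul_pos hb hy]
    · exact Or.inr (mul_ne_zero hb.ne' hy)

variable {X : Type} [TopologicalSpace X] [CompactSpace X] [T2Space X] {f : X → Sphere2}

/-- Over a punctured disk without critical values the Euler characteristic vanishes. -/
lemma IsBranched.hasChi_punctured (hf : IsBranched f) {φ : ℂ → Sphere2} (hφ : IsOpenEmbedding φ)
    {r : ℝ} (hr : 0 < r) (hreg : ∀ x ∈ f ⁻¹' (φ '' (Metric.ball 0 r \ {0})), IsRegularAt f x) :
    EulerChar.HasChi (f ⁻¹' (φ '' (Metric.ball 0 r \ {0})) : Set X) 1 0 := by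
  set B : Set ℂ := Metric.ball 0 r with hB
  set n : ℕ := fiberSum f univ (φ 0)
  have hcount : ∀ {P : Set ℂ} {z : ℂ}, P ⊆ B \ {0} → z ∈ P →
      (f ⁻¹' (φ '' P) ∩ f ⁻¹' {φ z}).ncard = n := by
    intro P z hP hz
    rw [← fiberSum_eq_ncard hf fun x hx => hreg x ⟨z, hP hz, hx.2.symm⟩,
      ← univ_inter (f ⁻¹' (φ '' P)), fiberSum_inter (mem_image_of_mem φ hz)]
    exact hf.fiberSum_univ_eq _ _
  have hret : ∀ {P : Set ℂ} {z : ℂ}, P ⊆ B \ {0} → z ∈ P → StarConvex ℝ z P →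
      RetractsOnto (f ⁻¹' (φ '' P)) (f ⁻¹' (φ '' P) ∩ f ⁻¹' {φ z}) := fun hP hz hs =>
    hf.retractsOnto hφ.isEmbedding hz hs (isClopenIn_self _)
      fun x hx _ => hreg x (preimage_mono (image_mono hP) hx)
  have hfin : ∀ (P : Set X) (w : Sphere2), (P ∩ f ⁻¹' {w}).Finite := fun P w =>
    (hf.finite_fiber w).subset inter_subset_right
  have hhalf : ∀ t : ℝ, |t| = r / 2 → (t : ℂ) ∈ B := fun t ht => by
    rw [hB, mem_ball_zero_iff, Complex.norm_real, Real.norm_eq_abs, ht]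
    linarith
  have hhalfI : ∀ t : ℝ, |t| = r / 2 → (t : ℂ) * Complex.I ∈ B := fun t ht => by
    rw [hB, mem_ball_zero_iff, norm_mul, Complex.norm_real, Real.norm_eq_abs, ht, Complex.norm_I]
    linarith
  have hBc : Convex ℝ B := convex_ball 0 r
  have hr2 : |r / 2| = r / 2 := abs_of_pos (by positivity)
  have hr2' : |-(r / 2)| = r / 2 := by rw [abs_neg, hr2]
  -- The punctured disk is covered by the disk slit along the negative and along the positive real
  -- axis. Both are star-shaped, and they meet in the two open half-disks.
  let S : Set ℂ := B ∩ Complex.slitPlane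
  let S' : Set ℂ := B ∩ -Complex.slitPlane
  let H : Set ℂ := B ∩ {z | 0 < z.im}
  let H' : Set ℂ := B ∩ {z | z.im < 0}
  have hS : S ⊆ B \ {0} := fun z hz => ⟨hz.1, fun h => by simp [mem_singleton_iff.mp h, S] at hz⟩
  have hS' : S' ⊆ B \ {0} := fun z hz => ⟨hz.1, fun h => by simp [mem_singleton_iff.mp h, S'] at hz⟩
  have hH : H ⊆ B \ {0} := fun z hz => ⟨hz.1, fun h => by simp [mem_singleton_iff.mp h, H] at hz⟩
  have hH' : H' ⊆ B \ {0} := fun z hz => ⟨hz.1, fun h => by simp [mem_singleton_iff.mp h, H'] at hz⟩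
  have zS : ((r / 2 : ℝ) : ℂ) ∈ S := ⟨hhalf _ hr2, Or.inl (by simpa using hr)⟩
  have zS' : ((-(r / 2) : ℝ) : ℂ) ∈ S' := ⟨hhalf _ hr2', Or.inl (by simpa using hr)⟩
  have zH : ((r / 2 : ℝ) : ℂ) * Complex.I ∈ H := ⟨hhalfI _ hr2, by simpa using hr⟩
  have zH' : ((-(r / 2) : ℝ) : ℂ) * Complex.I ∈ H' := ⟨hhalfI _ hr2', by simpa using hr⟩
  have sS : StarConvex ℝ ((r / 2 : ℝ) : ℂ) S :=
    (hBc.starConvex zS.1).inter (starConvex_slitPlane (by positivity))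
  have sS' : StarConvex ℝ ((-(r / 2) : ℝ) : ℂ) S' := by
    refine (hBc.starConvex zS'.1).inter ?_
    have := (starConvex_slitPlane (t := r / 2) (by positivity)).neg
    simpa using this
  have sH : StarConvex ℝ (((r / 2 : ℝ) : ℂ) * Complex.I) H :=
    (hBc.inter (convex_halfSpace_im_gt 0)).starConvex zH
  have sH' : StarConvex ℝ (((-(r / 2) : ℝ) : ℂ) * Complex.I) H' :=
    (hBc.inter (convex_halfSpace_im_lt 0)).starConvex zH'
  have hχS := (hret hS zS sS).hasChi (hfin _ _)
  have hχS' := (hret hS' zS' sS').hasChi (hfin _ _)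
  have hopen : ∀ P : Set ℂ, IsOpen P → IsOpen (f ⁻¹' (φ '' P)) := fun P hP =>
    (hφ.isOpenMap _ hP).preimage hf.continuous
  have hHH' : Disjoint H H' := by
    rw [disjoint_left]
    rintro z ⟨-, h1⟩ ⟨-, h2⟩
    rw [mem_ofPred_eq] at h1 h2
    exact lt_asymm h1 h2
  have hd : Disjoint (f ⁻¹' (φ '' H)) (f ⁻¹' (φ '' H')) :=
    ((disjoint_image_iff hφ.injective).mpr hHH').preimage f
  have hχH := ((hret hH zH sH).union (hret hH' zH' sH')
    (hopen _ (Metric.isOpen_ball.inter (isOpen_lt continuous_const Complex.continuous_im)))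
    (hopen _ (Metric.isOpen_ball.inter (isOpen_lt Complex.continuous_im continuous_const)))
    hd subset_rfl subset_rfl).hasChi ((hfin _ _).union (hfin _ _))
  have hSS' : f ⁻¹' (φ '' S) ∩ f ⁻¹' (φ '' S') = f ⁻¹' (φ '' H) ∪ f ⁻¹' (φ '' H') := by
    rw [← preimage_inter, ← preimage_union, ← image_inter hφ.injective, ← image_union]
    congr 2
    ext z
    simp only [S, S', H, H', mem_inter_iff, mem_union, Set.mem_neg, Complex.mem_slitPlane_iff,
      Complex.neg_re, Complex.neg_im, neg_ne_zero, mem_ofPred_eq]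
    constructor
    · rintro ⟨⟨h1, h2⟩, -, h3⟩
      have h4 : z.im ≠ 0 := by
        rcases h2 with h2 | h2
        · exact h3.resolve_left (by linarith)
        · exact h2
      rcases h4.lt_or_gt with h | h
      · exact Or.inr ⟨h1, h⟩
      · exact Or.inl ⟨h1, h⟩
    · rintro (⟨h1, h2⟩ | ⟨h1, h2⟩)
      · exact ⟨⟨h1, Or.inr h2.ne'⟩, h1, Or.inr h2.ne'⟩
      · exact ⟨⟨h1, Or.inr h2.ne⟩, h1, Or.inr h2.ne⟩
  have hcover : B \ {0} ⊆ Complex.slitPlane ∪ -Complex.slitPlane := by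
    rintro z ⟨-, hz⟩
    simp only [mem_union, Set.mem_neg, Complex.mem_slitPlane_iff, Complex.neg_re, Complex.neg_im,
      neg_ne_zero]
    by_contra h
    push Not at h
    exact hz (Complex.ext (by simp; linarith [h.1.1, h.2.1]) h.1.2)
  have hSeq : S = (B \ {0}) ∩ Complex.slitPlane :=
    Subset.antisymm (fun z hz => ⟨hS hz, hz.2⟩) fun z hz => ⟨hz.1.1, hz.2⟩
  have hSeq' : S' = (B \ {0}) ∩ -Complex.slitPlane :=
    Subset.antisymm (fun z hz => ⟨hS' hz, hz.2⟩) fun z hz => ⟨hz.1.1, hz.2⟩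
  rw [hcount hS zS] at hχS
  rw [hcount hS' zS'] at hχS'
  rw [ncard_union_eq (hd.mono inter_subset_left inter_subset_left) (hfin _ _) (hfin _ _),
    hcount hH zH, hcount hH' zH', ← hSS'] at hχH
  have hχ := EulerChar.HasChi.union_subset (C := f ⁻¹' (φ '' (B \ {0})))
    (hopen _ Complex.isOpen_slitPlane) (hopen _ Complex.isOpen_slitPlane.neg)
    (by rw [hSeq, image_inter hφ.injective, preimage_inter])
    (by rw [hSeq', image_inter hφ.injective, preimage_inter])
    (by rw [← preimage_union, ← image_union]; exact preimage_mono (image_mono hcover))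
    (hχS.mono (Nat.zero_le 1)) (hχS'.mono (Nat.zero_le 1)) hχH
  -- Each slit disk contributes n and the overlap 2n, so the total is n + n − 2n.
  convert hχ using 1
  push_cast
  ring

/-- **The Riemann–Hurwitz formula** for a branched covering of the sphere. -/
theorem IsBranched.hasChi (hf : IsBranched f) (w : Sphere2) :
    EulerChar.HasChi X 2 (2 * fiberSum f univ w - ramification f univ) := by
  set C : Set Sphere2 := f '' {x | ¬ IsRegularAt f x}
  have hC : C.Finite := hf.finite_not_isRegularAt.image f
  -- With v not critical, the plane complementary to v carries all ramification and a small disk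
  -- about v carries none. The overlap is a punctured disk, so the total is (n − ram) + n − 0.
  obtain ⟨v, hv⟩ : ∃ v, v ∉ C := by
    by_contra hc
    push Not at hc
    exact infinite_of_mem_nhds w (univ_mem : univ ∈ 𝓝 w) (hC.subset fun w _ => hc w)
  have hreg : ∀ x, f x ∉ C → IsRegularAt f x := fun x hx => by
    by_contra h
    exact hx ⟨x, h, rfl⟩
  obtain ⟨φ, hφ, hφr⟩ := exists_chart_range_eq v
  obtain ⟨ψ, hψ, hψ0⟩ := exists_chart_apply_zero v
  obtain ⟨r, hr, hrC⟩ := Metric.mem_nhds_iff.mp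
    (hψ.continuous.continuousAt.preimage_mem_nhds (hC.isClosed.isOpen_compl.mem_nhds (hψ0 ▸ hv)))
  have h0 : (0 : ℂ) ∈ Metric.ball 0 r := Metric.mem_ball_self hr
  have hregB : ∀ x ∈ f ⁻¹' (ψ '' Metric.ball 0 r), IsRegularAt f x := by
    rintro x ⟨z, hz, hzx⟩
    exact hreg x (hzx ▸ hrC hz)
  have hA := hf.hasChi_of_convex hφ convex_univ (mem_univ 0) (isClopenIn_self _)
  have hB := hf.hasChi_of_convex_of_regular hψ.isEmbedding (convex_ball (0 : ℂ) r) h0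
    (isClopenIn_self _) hregB
  have hAB := hf.hasChi_punctured hψ hr fun x hx =>
    hregB x (preimage_mono (image_mono sdiff_subset) hx)
  have hAB' : f ⁻¹' (φ '' univ) ∩ f ⁻¹' (ψ '' Metric.ball 0 r)
      = f ⁻¹' (ψ '' (Metric.ball 0 r \ {0})) := by
    rw [image_univ, hφr, image_sdiff hψ.injective, image_singleton, hψ0, ← preimage_inter,
      inter_comm, sdiff_eq]
  have hram : ramification f (f ⁻¹' (φ '' univ)) = ramification f univ := by
    refine hf.ramification_congr fun x hx => ⟨fun _ => trivial, fun _ => ?_⟩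
    rw [image_univ, hφr]
    exact fun hxv => hv ⟨x, hx, hxv⟩
  have hs : fiberSum f (f ⁻¹' (φ '' univ)) (φ 0) = fiberSum f univ w := by
    rw [← univ_inter (f ⁻¹' _), fiberSum_inter (mem_image_of_mem φ (mem_univ 0))]
    exact hf.fiberSum_univ_eq _ _
  have hs' : fiberSum f (f ⁻¹' (ψ '' Metric.ball 0 r)) (ψ 0) = fiberSum f univ w := by
    rw [← univ_inter (f ⁻¹' _), fiberSum_inter (mem_image_of_mem ψ h0)]
    exact hf.fiberSum_univ_eq _ _
  rw [hs, hram] at hA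
  rw [hs'] at hB
  rw [← hAB'] at hAB
  have hχ := EulerChar.HasChi.union_subset (C := univ)
    ((hφ.isOpenMap _ isOpen_univ).preimage hf.continuous)
    ((hψ.isOpenMap _ Metric.isOpen_ball).preimage hf.continuous)
    (univ_inter _).symm (univ_inter _).symm ?_
    (hA.mono one_le_two) (hB.mono zero_le_two) hAB
  · refine EulerChar.HasChi.of_homeomorph (Homeomorph.Set.univ X) ?_
    convert hχ using 1
    ring
  · intro x _
    by_cases hx : f x = v
    · exact Or.inr ⟨0, h0, hψ0.trans hx.symm⟩
    · refine Or.inl ?_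
      rw [image_univ, hφr]
      exact hx

end SingularSurface
end

noncomputable section

/-! ### Neighbourhoods in surfaces -/

namespace SingularSurface

open Filter Set unitInterval

/-- Scaling of the wedge of disks. -/
def wedgeScale {m : ℕ} (ε : ℝ) (hε : 0 ≤ ε) (hε1 : ε ≤ 1) (p : diskWedge m) : diskWedge m :=
  ⟨ε • p.1, fun i => by
    rw [Pi.smul_apply, norm_smul, Real.norm_of_nonneg hε]
    exact (mul_le_of_le_one_left (norm_nonneg _) hε1).trans_lt (p.2.1 i), fun i j hi hj =>
    p.2.2 i j (fun h => hi (by rw [Pi.smul_apply, h, smul_zero]))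
      fun h => hj (by rw [Pi.smul_apply, h, smul_zero])⟩

lemma wedgeScale_center {m : ℕ} {ε : ℝ} (hε : 0 ≤ ε) (hε1 : ε ≤ 1) :
    wedgeScale ε hε hε1 (wedgeCenter m) = wedgeCenter m :=
  Subtype.ext (smul_zero ε)

lemma range_wedgeScale {m : ℕ} {ε : ℝ} (hε : 0 < ε) (hε1 : ε ≤ 1) :
    range (wedgeScale (m := m) ε hε.le hε1) = {p | ∀ i, ‖p.1 i‖ < ε} := by
  ext p
  constructor
  · rintro ⟨q, rfl⟩ i
    change ‖ε • q.1 i‖ < ε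
    rw [norm_smul, Real.norm_of_nonneg hε.le]
    exact mul_lt_of_lt_one_right hε (q.2.1 i)
  · intro hp
    refine ⟨⟨ε⁻¹ • p.1, fun i => ?_, fun i j hi hj => p.2.2 i j ?_ ?_⟩, ?_⟩
    · rw [Pi.smul_apply, norm_smul, Real.norm_of_nonneg (inv_nonneg.mpr hε.le),
        inv_mul_lt_one₀ hε]
      exact hp i
    · exact fun h => hi (by rw [Pi.smul_apply, h, smul_zero])
    · exact fun h => hj (by rw [Pi.smul_apply, h, smul_zero])
    · exact Subtype.ext (smul_inv_smul₀ hε.ne' p.1)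

lemma isOpen_norm_lt {m : ℕ} (ε : ℝ) : IsOpen {p : diskWedge m | ∀ i, ‖p.1 i‖ < ε} := by
  simp only [ofPred_forall]
  refine isOpen_iInter_of_finite fun i => isOpen_lt ?_ continuous_const
  exact ((continuous_apply i).comp continuous_subtype_val).norm

lemma isOpenEmbedding_wedgeScale {m : ℕ} {ε : ℝ} (hε : 0 < ε) (hε1 : ε ≤ 1) :
    IsOpenEmbedding (wedgeScale (m := m) ε hε.le hε1) := by
  refine ⟨?_, range_wedgeScale hε hε1 ▸ isOpen_norm_lt ε⟩
  have h : IsEmbedding (Subtype.val ∘ wedgeScale (m := m) ε hε.le hε1) :=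
    (Homeomorph.smulOfNeZero ε hε.ne').isEmbedding.comp IsEmbedding.subtypeVal
  refine IsEmbedding.of_comp ?_ continuous_subtype_val h
  exact Continuous.subtype_mk (continuous_subtype_val.const_smul ε) _

lemma exists_norm_lt_subset {m : ℕ} {N : Set (diskWedge m)} (hN : N ∈ 𝓝 (wedgeCenter m)) :
    ∃ ε : ℝ, 0 < ε ∧ ε ≤ 1 ∧ {p : diskWedge m | ∀ i, ‖p.1 i‖ < ε} ⊆ N := by
  obtain ⟨ε, hε, h⟩ := Metric.mem_nhds_iff.mp hN
  refine ⟨min ε 1, lt_min hε one_pos, min_le_right _ _, fun p hp => h ?_⟩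
  rw [Metric.mem_ball, Subtype.dist_eq, dist_pi_lt_iff hε]
  intro i
  rw [show (wedgeCenter m).1 i = 0 from rfl, dist_zero_right]
  exact (hp i).trans_le (min_le_left _ _)

instance (m : ℕ) : PathConnectedSpace (diskWedge m) := by
  have h : ∀ p : diskWedge m, Joined (wedgeCenter m) p := fun p => by
    refine ⟨⟨⟨fun t : I => wedgeScale t t.2.1 t.2.2 p, ?_⟩, ?_, ?_⟩⟩
    · exact Continuous.subtype_mk (continuous_subtype_val.smul continuous_const) _
    · exact Subtype.ext (zero_smul ℝ p.1)
    · exact Subtype.ext (one_smul ℝ p.1)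
  exact ⟨⟨wedgeCenter m⟩, fun p q => (h p).symm.trans (h q)⟩

section Nbhd

variable {X : Type} [TopologicalSpace X]

/-- Scaling towards the centre embeds the wedge into any neighbourhood of its centre. Hence having a
wedge neighbourhood is a local property. -/
lemma HasWedgeNbhd.exists_range_subset {x : X} {m : ℕ} (h : HasWedgeNbhd X x m) {N : Set X}
    (hN : N ∈ 𝓝 x) : ∃ φ : diskWedge m → X, IsOpenEmbedding φ ∧ φ (wedgeCenter m) = x ∧
      range φ ⊆ N := by
  obtain ⟨-, φ, hφ, rfl⟩ := h
  obtain ⟨ε, hε, hε1, hsub⟩ := exists_norm_lt_subset (hφ.continuous.continuousAt hN)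
  refine ⟨φ ∘ wedgeScale ε hε.le hε1, hφ.comp (isOpenEmbedding_wedgeScale hε hε1), ?_, ?_⟩
  · rw [Function.comp_apply, wedgeScale_center]
  · rw [range_comp, range_wedgeScale hε, image_subset_iff]
    exact hsub

/-- Centres of wedges have arbitrarily small path-connected neighbourhoods. -/
lemma HasWedgeNbhd.exists_isPathConnected {x : X} {m : ℕ} (h : HasWedgeNbhd X x m) {N : Set X}
    (hN : N ∈ 𝓝 x) : ∃ M ∈ 𝓝 x, M ⊆ N ∧ IsPathConnected M := by
  obtain ⟨φ, hφ, rfl, hsub⟩ := h.exists_range_subset hN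
  exact ⟨range φ, hφ.isOpen_range.mem_nhds (mem_range_self _), hsub,
    isPathConnected_range hφ.continuous⟩

lemma hasWedgeNbhd_comap_iff {Y : Type} [TopologicalSpace Y] {ι : Y → X} (hι : IsOpenEmbedding ι)
    {y : Y} {m : ℕ} : HasWedgeNbhd X (ι y) m ↔ HasWedgeNbhd Y y m := by
  refine ⟨fun h => ⟨h.1, ?_⟩, fun ⟨hm, φ, hφ, hy⟩ => ⟨hm, ι ∘ φ, hι.comp hφ, congrArg ι hy⟩⟩
  obtain ⟨φ, hφ, hφy, hsub⟩ := h.exists_range_subset (hι.isOpen_range.mem_nhds (mem_range_self y))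
  choose ψ hψ using fun p => hsub (mem_range_self p)
  have hcomp : ι ∘ ψ = φ := funext hψ
  refine ⟨ψ, IsOpenEmbedding.of_comp ψ hι (hcomp ▸ hφ), hι.injective ?_⟩
  rw [hψ, hφy]

lemma HasHalfDiskNbhd.exists_isPathConnected {x : X} (h : HasHalfDiskNbhd X x) :
    ∃ M ∈ 𝓝 x, IsPathConnected M := by
  obtain ⟨φ, hφ, rfl⟩ := h
  have hc : Convex ℝ halfDisk := by
    have : halfDisk = Metric.ball 0 1 ∩ {z | 0 ≤ z.im} := by
      ext z
      simp [halfDisk]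
    rw [this]
    exact (convex_ball 0 1).inter (convex_halfSpace_im_ge 0)
  have : PathConnectedSpace halfDisk := isPathConnected_iff_pathConnectedSpace.mp
    (hc.isPathConnected ⟨0, halfDiskCenter.2⟩)
  exact ⟨range φ, hφ.isOpen_range.mem_nhds (mem_range_self _), isPathConnected_range hφ.continuous⟩

/-- A perturbing piece is only assumed connected, while b₀ = 1 is available for path-connected
spaces; surfaces have path-connected neighbourhoods everywhere. -/
lemma pathConnectedSpace_of_nhds [ConnectedSpace X] (h : ∀ x : X, ∃ M ∈ 𝓝 x, IsPathConnected M) :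
    PathConnectedSpace X := by
  have hj : ∀ x : X, ∀ᶠ y in 𝓝 x, Joined x y := fun x => by
    obtain ⟨M, hM, hMp⟩ := h x
    filter_upwards [hM] with y hy using (hMp.joinedIn x (mem_of_mem_nhds hM) y hy).joined
  obtain ⟨x₀⟩ := (inferInstance : Nonempty X)
  have hclopen : IsClopen {y | Joined x₀ y} := by
    refine ⟨isOpen_compl_iff.mp (isOpen_iff_mem_nhds.mpr fun y hy => ?_),
      isOpen_iff_mem_nhds.mpr fun y hy => ?_⟩
    · filter_upwards [hj y] with z hz hz' using hy (Joined.trans hz' hz.symm)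
    · filter_upwards [hj y] with z hz using Joined.trans hy hz
  have huniv := hclopen.eq_univ ⟨x₀, Joined.refl x₀⟩
  have hall : ∀ y, Joined x₀ y := fun y => huniv.symm.subset (mem_univ y)
  exact ⟨⟨x₀⟩, fun x y => (hall x).symm.trans (hall y)⟩

lemma Surface.pathConnectedSpace (S : Surface) [ConnectedSpace S.carrier] :
    PathConnectedSpace S.carrier := by
  refine pathConnectedSpace_of_nhds fun x => ?_
  rcases S.admissible x with ⟨m, h⟩ | h
  · obtain ⟨M, hM, -, hp⟩ := h.exists_isPathConnected univ_mem
    exact ⟨M, hM, hp⟩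
  · exact h.exists_isPathConnected

/-- The centre of the star is an interior point, so no segment from it to a non-zero point of the
half-disk meets 0. Hence removing the midpoint does not disconnect the half-disk. -/
lemma starConvex_half {ε : ℝ} (hε : 0 < ε) :
    StarConvex ℝ (((ε / 2 : ℝ) : ℂ) * Complex.I) {z : ℂ | ‖z‖ < ε ∧ 0 ≤ z.im ∧ z ≠ 0} := by
  have hb : StarConvex ℝ (((ε / 2 : ℝ) : ℂ) * Complex.I) (Metric.ball (0 : ℂ) ε) := by
    refine (convex_ball 0 ε).starConvex ?_
    rw [mem_ball_zero_iff, norm_mul, Complex.norm_real, Complex.norm_I,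
      Real.norm_of_nonneg (by positivity)]
    linarith
  rintro y ⟨hy1, hy2, hy3⟩ a b ha hb' hab
  have him : (a • (((ε / 2 : ℝ) : ℂ) * Complex.I) + b • y).im = a * (ε / 2) + b * y.im := by
    simp
  refine ⟨mem_ball_zero_iff.mp (hb (mem_ball_zero_iff.mpr hy1) ha hb' hab), ?_, ?_⟩
  · rw [him]
    positivity
  · intro h0
    rcases ha.eq_or_lt with rfl | ha
    · obtain rfl : b = 1 := by linarith
      exact hy3 (by simpa using h0)
    · rw [h0, Complex.zero_im] at him
      nlinarith [mul_pos ha hε, mul_nonneg hb' hy2]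

/-- A point with a half-disk neighbourhood is not the centre of a wedge of several disks. -/
lemma HasHalfDiskNbhd.le_one {x : X} (h : HasHalfDiskNbhd X x) {m : ℕ} (hw : HasWedgeNbhd X x m) :
    m ≤ 1 := by
  by_contra hm
  obtain ⟨φ, hφ, hφx⟩ := h
  obtain ⟨ψ, hψ, hψx, hsub⟩ := hw.exists_range_subset
    (hφ.isOpen_range.mem_nhds (hφx ▸ mem_range_self _))
  have hN : φ ⁻¹' range ψ ∈ 𝓝 halfDiskCenter :=
    hφ.continuous.continuousAt (hφx ▸ hψ.isOpen_range.mem_nhds (hψx ▸ mem_range_self _))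
  obtain ⟨ε, hε, hεN⟩ := Metric.mem_nhds_iff.mp hN
  set δ := min ε 1
  have hδ : 0 < δ := lt_min hε one_pos
  -- A small half-disk without its midpoint is connected, whereas a punctured wedge of at least two
  -- disks is not; the rest of the proof transports A to the wedge.
  let A : Set ℂ := {z | ‖z‖ < δ ∧ 0 ≤ z.im ∧ z ≠ 0}
  have hA : IsPreconnected A := by
    refine ((starConvex_half hδ).isPathConnected ?_).isConnected.isPreconnected
    have h1 : ‖((δ / 2 : ℝ) : ℂ) * Complex.I‖ < δ := by
      rw [norm_mul, Complex.norm_real, Complex.norm_I, Real.norm_of_nonneg (by positivity)]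
      linarith
    exact ⟨h1, by simpa using (half_pos hδ).le, by simpa using hδ.ne'⟩
  let B : Set halfDisk := Subtype.val ⁻¹' A
  have hB : IsPreconnected B := by
    refine IsEmbedding.subtypeVal.isInducing.isPreconnected_image.mp ?_
    rwa [Subtype.image_preimage_coe, inter_eq_self_of_subset_right]
    exact fun z hz => ⟨hz.1.trans_le (min_le_right _ _), hz.2.1⟩
  have hBψ : φ '' B ⊆ range ψ := by
    rintro _ ⟨z, hz, rfl⟩
    refine hεN ?_
    rw [Metric.mem_ball, Subtype.dist_eq, show (halfDiskCenter : ℂ) = 0 from rfl, dist_zero_right]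
    exact hz.1.trans_le (min_le_left _ _)
  let C : Set (diskWedge m) := ψ ⁻¹' (φ '' B)
  have hC : IsPreconnected C := by
    refine hψ.isEmbedding.isInducing.isPreconnected_image.mp ?_
    rw [image_preimage_eq_of_subset hBψ]
    exact hB.image φ hφ.continuous.continuousOn
  have hCcenter : wedgeCenter m ∉ C := by
    rintro ⟨z, hz, hzx⟩
    rw [hψx, ← hφx] at hzx
    exact hz.2.2 (congrArg Subtype.val (hφ.injective hzx))
  have hball : φ '' {z | ‖(z : ℂ)‖ < δ} ∈ 𝓝 x := by
    refine (hφ.isOpenMap _ ?_).mem_nhds ⟨halfDiskCenter, ?_, hφx⟩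
    · exact isOpen_lt continuous_subtype_val.norm continuous_const
    · simpa [halfDiskCenter] using hδ
  obtain ⟨η, hη, hη1, hηsub⟩ := exists_norm_lt_subset
    (hψ.continuous.continuousAt (x := wedgeCenter m) (hψx ▸ hball))
  -- The transported set C contains all points close to the centre of the wedge except the centre,
  -- so it meets every branch.
  have hmemC : ∀ p : diskWedge m, (∀ i, ‖p.1 i‖ < η) → p ≠ wedgeCenter m → p ∈ C := by
    intro p hp hpc
    obtain ⟨z, hz, hzp⟩ := hηsub hp
    refine ⟨z, ⟨hz, z.2.2, fun h0 => hpc (hψ.injective ?_)⟩, hzp⟩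
    rw [← hzp, hψx, ← hφx]
    exact congrArg φ (Subtype.ext h0)
  have hcont : ∀ i, Continuous fun p : diskWedge m => p.1 i := fun i =>
    (continuous_apply i).comp continuous_subtype_val
  let u : Fin m → Set (diskWedge m) := fun i => {p | p.1 i ≠ 0}
  have hu : ∀ i, IsOpen (u i) := fun i => isOpen_ne_fun (hcont i) continuous_const
  have hz0 : (η / 2 : ℂ) ≠ 0 := by simpa using hη.ne'
  have hzn : ‖(η / 2 : ℂ)‖ < η := by
    rw [norm_div, Complex.norm_real, Real.norm_of_nonneg hη.le]
    norm_num
    linarith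
  have hne : ∀ i, (C ∩ u i).Nonempty := by
    intro i
    let z : unitDisk := ⟨(η / 2 : ℂ), mem_ball_zero_iff.mpr (hzn.trans_le hη1)⟩
    have hi : (wedgeBranch i z).1 i = (η / 2 : ℂ) := wedgeBranch_apply_same i z
    refine ⟨wedgeBranch i z, hmemC _ (fun j => ?_) fun h => hz0 ?_, by rw [mem_ofPred_eq, hi]; exact hz0⟩
    · by_cases hj : j = i
      · rw [hj, hi]
        exact hzn
      · rw [wedgeBranch_apply_of_ne hj, norm_zero]
        exact hη
    · rw [← hi, h]
      rfl
  let i₀ : Fin m := ⟨0, by omega⟩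
  let i₁ : Fin m := ⟨1, by omega⟩
  have hi : i₁ ≠ i₀ := fun h => one_ne_zero (congrArg Fin.val h)
  -- Connectedness of C would give a point lying off the centre on one branch and on another one at
  -- the same time.
  obtain ⟨p, -, hp0, hp1⟩ := hC (u i₀) (⋃ i ∈ {i | i ≠ i₀}, u i) (hu i₀)
    (isOpen_biUnion fun i _ => hu i) (fun p hp => by
      by_contra h
      refine hCcenter ?_
      convert hp
      refine (Subtype.ext (funext fun i => ?_)).symm
      by_contra hpi
      refine h ?_
      by_cases hii : i = i₀
      · exact Or.inl (hii ▸ hpi)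
      · exact Or.inr (mem_biUnion (x := i) hii hpi)) (hne i₀)
    ((hne i₁).mono (inter_subset_inter_right _ (subset_biUnion_of_mem (u := u) hi)))
  obtain ⟨i, hii, hpi⟩ := mem_iUnion₂.mp hp1
  exact hii (p.2.2 i i₀ hpi hp0)

end Nbhd

end SingularSurface
end

noncomputable section

/-! ### Gluing -/

namespace SingularSurface

open Filter Set

/-! ### Locality of the number of branches, the degree and the defect -/

section Comap

variable {X Y : Type} [TopologicalSpace X] [TopologicalSpace Y]

/-- Stated for open embeddings, so that local degrees on two surfaces can be compared through a
common open piece. -/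
lemma HasLocalCount.comap {f : X → Sphere2} {ι : Y → X} (hι : IsOpenEmbedding ι) {y : Y} {d : ℕ}
    (h : HasLocalCount f (ι y) d) : HasLocalCount (f ∘ ι) y d := by
  intro N hN
  obtain ⟨V, hVN, hVo, hyV, hV, hc⟩ := h (ι '' N) (hι.isOpenMap.image_mem_nhds hN)
  have himg : ∀ w, ι '' (ι ⁻¹' V ∩ f ∘ ι ⁻¹' {w}) = V ∩ f ⁻¹' {w} := fun w => by
    rw [preimage_comp, ← preimage_inter, image_preimage_eq_of_subset]
    exact inter_subset_left.trans (hVN.trans (image_subset_range ι N))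
  refine ⟨ι ⁻¹' V, ?_, hVo.preimage hι.continuous, hyV, ?_, ?_⟩
  · intro z hz
    obtain ⟨z', hz', hzz⟩ := hVN hz
    exact hι.injective hzz ▸ hz'
  · refine hι.injective.image_injective ?_
    rw [image_singleton, ← hV]
    exact himg _
  · filter_upwards [hc] with w hw
    rw [← hw, ← himg, hι.injective.encard_image]

lemma Surface.branches_comap {S S' : Surface} {ι : Y → S.carrier} {κ : Y → S'.carrier}
    (hι : IsOpenEmbedding ι) (hκ : IsOpenEmbedding κ) (y : Y) :
    S.branches (ι y) = S'.branches (κ y) := by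
  have h : HasWedgeNbhd S.carrier (ι y) = HasWedgeNbhd S'.carrier (κ y) := funext fun m =>
    propext ((hasWedgeNbhd_comap_iff hι).trans (hasWedgeNbhd_comap_iff hκ).symm)
  rw [Surface.branches, Surface.branches]
  generalize HasWedgeNbhd S.carrier (ι y) = p at h
  subst h
  rfl

lemma BranchedCovering.localDegree_comap {F F' : BranchedCovering} {ι : Y → F.surface.carrier}
    {κ : Y → F'.surface.carrier} (hι : IsOpenEmbedding ι) (hκ : IsOpenEmbedding κ)
    (h : F.map ∘ ι = F'.map ∘ κ) (y : Y) :
    localDegree F.map (ι y) = localDegree F'.map (κ y) :=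
  ((F.isBranched.hasLocalCount (ι y)).comap hι).unique
    (h ▸ (F'.isBranched.hasLocalCount (κ y)).comap hκ)

lemma BranchedCovering.defect_comap {F F' : BranchedCovering} {ι : Y → F.surface.carrier}
    {κ : Y → F'.surface.carrier} (hι : IsOpenEmbedding ι) (hκ : IsOpenEmbedding κ)
    (h : F.map ∘ ι = F'.map ∘ κ) (y : Y) (hg : F.surface.genus (ι y) = F'.surface.genus (κ y)) :
    F.defect (ι y) = F'.defect (κ y) := by
  rw [BranchedCovering.defect, BranchedCovering.defect, Surface.milnor, Surface.milnor, hg,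
    Surface.branches_comap hι hκ, BranchedCovering.localDegree_comap hι hκ h]

end Comap

/-! ### Open parts of a glued surface -/

namespace IsGluing

variable {S₀ S₁ T : Surface} {U : Set S₀.carrier} {i : ((interior U)ᶜ : Set S₀.carrier) → S₁.carrier}
  {j : T.carrier → S₁.carrier} (hG : IsGluing S₀ S₁ T U i j)

/-- The inclusion of the unchanged part of the surface. -/
def outer (i : ((interior U)ᶜ : Set S₀.carrier) → S₁.carrier) (x : (Uᶜ : Set S₀.carrier)) :
    S₁.carrier :=
  i (inclusion (compl_subset_compl.mpr interior_subset) x)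

include hG

/-- A closed set is its interior together with its frontier, so outside the interior of U the points
of U are exactly those of the seam. -/
lemma mem_range_iff (hU : IsClosed U) (x : ((interior U)ᶜ : Set S₀.carrier)) :
    i x ∈ range j ↔ (x : S₀.carrier) ∈ U := by
  constructor
  · intro hx
    obtain ⟨x', hx', h⟩ := hG.inter_left.subset ⟨mem_range_self x, hx⟩
    rw [← hG.closed_left.injective h]
    exact hU.frontier_subset hx'
  · intro hx
    exact (hG.inter_left.superset ⟨x, by rw [hU.frontier_eq]; exact ⟨hx, x.2⟩, rfl⟩).2

lemma range_outer (hU : IsClosed U) : range (outer i) = (range j)ᶜ := by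
  ext y
  constructor
  · rintro ⟨x, rfl⟩ hx
    exact x.2 ((hG.mem_range_iff hU _).mp hx)
  · intro hy
    obtain ⟨x, rfl⟩ := (hG.cover.symm.subset (mem_univ y)).resolve_right hy
    exact ⟨⟨x, fun hx => hy ((hG.mem_range_iff hU x).mpr hx)⟩, rfl⟩

lemma isOpenEmbedding_outer (hU : IsClosed U) : IsOpenEmbedding (outer i) := by
  refine ⟨hG.closed_left.isEmbedding.comp (IsEmbedding.inclusion _), ?_⟩
  rw [hG.range_outer hU]
  exact hG.closed_right.isClosed_range.isOpen_compl

lemma mem_range_left_iff (y : T.carrier) : j y ∈ range i ↔ y ∈ T.boundary := by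
  constructor
  · intro hy
    obtain ⟨y', hy', h⟩ := hG.inter_right.subset ⟨hy, mem_range_self y⟩
    rwa [← hG.closed_right.injective h]
  · intro hy
    exact (hG.inter_right.superset ⟨y, hy, rfl⟩).1

/-- The boundary of the piece is the preimage of the closed image of the outer part, so the gluing
itself shows that it is closed. -/
lemma isOpen_boundary_compl : IsOpen (T.boundaryᶜ) := by
  have : T.boundaryᶜ = j ⁻¹' (range i)ᶜ := by
    ext y
    exact not_congr (hG.mem_range_left_iff y).symm
  rw [this]
  exact hG.closed_left.isClosed_range.isOpen_compl.preimage hG.closed_right.continuous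

lemma isOpenEmbedding_inner : IsOpenEmbedding fun y : (T.boundaryᶜ : Set T.carrier) => j y := by
  refine ⟨hG.closed_right.isEmbedding.comp IsEmbedding.subtypeVal, ?_⟩
  have : range (fun y : (T.boundaryᶜ : Set T.carrier) => j y) = (range i)ᶜ := by
    ext x
    constructor
    · rintro ⟨y, rfl⟩ hy
      exact y.2 ((hG.mem_range_left_iff y).mp hy)
    · intro hx
      obtain ⟨y, rfl⟩ := (hG.cover.symm.subset (mem_univ x)).resolve_left hx
      exact ⟨⟨y, fun hy => hx ((hG.mem_range_left_iff y).mpr hy)⟩, rfl⟩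
  rw [this]
  exact hG.closed_left.isClosed_range.isOpen_compl

lemma milnor_eq {y : T.carrier} (hy : y ∉ T.boundary) : T.milnor y = S₁.milnor (j y) := by
  rw [Surface.milnor, Surface.milnor, hG.genus_right,
    Surface.branches_comap (S' := S₁) hG.isOpen_boundary_compl.isOpenEmbedding_subtypeVal
      hG.isOpenEmbedding_inner (⟨y, hy⟩ : (T.boundaryᶜ : Set T.carrier))]

end IsGluing

/-- The branch number is defined by wedge neighbourhoods whenever one exists, so
`HasHalfDiskNbhd.le_one` is needed to exclude several branches at a boundary point. -/
lemma Surface.milnor_of_mem_boundary (S : Surface) {x : S.carrier} (hx : x ∈ S.boundary) :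
    S.milnor x = 0 := by
  classical
  have h : S.branches x ≤ 1 := by
    rw [Surface.branches]
    split_ifs with h
    · exact HasHalfDiskNbhd.le_one hx (Nat.find_spec h)
    · exact le_rfl
  rw [Surface.milnor, S.genus_boundary x hx]
  omega

/-- A component of the preimage of a convex closed disk that contains at most one critical point is
open in the preimage. -/
lemma IsBranched.isClopenIn_connectedComponentIn {X : Type} [TopologicalSpace X] [T2Space X]
    {f : X → Sphere2} (hf : IsBranched f) {φ : ℂ → Sphere2} (hφ : IsOpenEmbedding φ) {K : Set ℂ}
    (hK : Convex ℝ K) (hKc : IsCompact K) {v : X} (hv : f v ∈ interior (φ '' K))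
    (hreg : ∀ x ∈ connectedComponentIn (f ⁻¹' (φ '' K)) v, x ≠ v → IsRegularAt f x) :
    IsClopenIn (connectedComponentIn (f ⁻¹' (φ '' K)) v) (f ⁻¹' (φ '' K)) := by
  set R := f ⁻¹' (φ '' K)
  set U := connectedComponentIn R v
  have hRcl : IsClosed R := (hKc.image hφ.continuous).isClosed.preimage hf.continuous
  have hUR : U ⊆ R := connectedComponentIn_subset R v
  have hvR : v ∈ R := interior_subset (s := φ '' K) hv
  have hUcl : IsClosed U := by
    rw [← closure_subset_iff_isClosed]
    exact isPreconnected_connectedComponentIn.closure.subset_connectedComponentIn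
      (subset_closure (mem_connectedComponentIn hvR)) (hRcl.closure_subset_iff.mpr hUR)
  have hsub : ∀ x ∈ U, ∀ M : Set X, IsPreconnected M → x ∈ M → M ⊆ R → M ⊆ U := by
    intro x hx M hM hxM hMR
    have := hM.subset_connectedComponentIn hxM hMR
    rwa [← connectedComponentIn_eq hx] at this
  refine ⟨hUR, fun x hxR => ?_⟩
  by_cases hx : x ∈ U
  · suffices h : ∀ᶠ y in 𝓝 x, y ∈ R → y ∈ U by
      filter_upwards [h] with y hy hyR
      exact ⟨fun _ => hx, fun _ => hy hyR⟩
    -- Openness of the component needs connected neighbourhoods in the preimage. At v the value is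
    -- interior to the disk, so small wedges serve; elsewhere f is a local homeomorphism, and the
    -- lift of a small convex piece of K serves.
    by_cases hxv : x = v
    · subst hxv
      obtain ⟨m, k, hk⟩ := hf.branched x
      obtain ⟨M, hM, hMR, hMp⟩ := hk.hasWedgeNbhd.exists_isPathConnected
        (hf.continuous.continuousAt (isOpen_interior.mem_nhds hv))
      have := hsub x hx M hMp.isConnected.isPreconnected (mem_of_mem_nhds hM)
        fun y hy => interior_subset (s := φ '' K) (hMR hy)
      filter_upwards [hM] with y hy _ using this hy
    · obtain ⟨e, hxe, hfe⟩ := hreg x hx hxv x rfl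
      obtain ⟨z, hz, hzx⟩ := hxR
      have htgt : e.target ∈ 𝓝 (φ z) := e.open_target.mem_nhds (by
        rw [hzx, hfe]
        exact e.map_source hxe)
      obtain ⟨ε, hε, hεt⟩ := Metric.mem_nhds_iff.mp (hφ.continuous.continuousAt htgt)
      have hPt : φ '' (K ∩ Metric.ball z ε) ⊆ e.target := by
        rintro _ ⟨u, hu, rfl⟩
        exact hεt hu.2
      let M := e.symm '' (φ '' (K ∩ Metric.ball z ε))
      have hM : IsPreconnected M :=
        (((hK.inter (convex_ball z ε)).isPreconnected.image φ hφ.continuous.continuousOn).image _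
          (e.continuousOn_symm.mono hPt))
      have hmem : ∀ y ∈ e.source, f y ∈ φ '' (K ∩ Metric.ball z ε) → y ∈ M := fun y hy hfy =>
        ⟨f y, hfy, by rw [hfe]; exact e.left_inv hy⟩
      have hMR : M ⊆ R := by
        rintro _ ⟨u, hu, rfl⟩
        change f (e.symm u) ∈ φ '' K
        rw [hfe, e.right_inv (hPt hu)]
        exact image_mono inter_subset_left hu
      have hMU := hsub x hx M hM
        (hmem x hxe ⟨z, ⟨hz, Metric.mem_ball_self hε⟩, hzx⟩) hMR
      have hball : f ⁻¹' (φ '' Metric.ball z ε) ∈ 𝓝 x :=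
        hf.continuous.continuousAt ((hφ.isOpenMap _ Metric.isOpen_ball).mem_nhds
          ⟨z, Metric.mem_ball_self hε, hzx⟩)
      filter_upwards [e.open_source.mem_nhds hxe, hball] with y hy hyb hyR
      refine hMU (hmem y hy ?_)
      rw [image_inter hφ.injective]
      exact ⟨hyR, hyb⟩
  · filter_upwards [hUcl.isOpen_compl.mem_nhds hx] with y hy _
    exact ⟨fun h => absurd h hy, fun h => absurd h hx⟩

end SingularSurface
end

noncomputable section

/-! ### Local perturbations -/

namespace SingularSurface

open Filter Set

/-- Used with the common parametrisation of the unchanged parts of the two surfaces by the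
complement of U. -/
lemma finsum_mem_eq_of_range_subset {A B C M : Type*} [AddCommMonoid M] {ι : A → B} {κ : A → C}
    (hι : Function.Injective ι) (hκ : Function.Injective κ) {s : Set B} {t : Set C}
    (hs : s ⊆ range ι) (ht : t ⊆ range κ) (hst : ∀ a, ι a ∈ s ↔ κ a ∈ t) {g : B → M} {h : C → M}
    (hgh : ∀ a, ι a ∈ s → g (ι a) = h (κ a)) : ∑ᶠ x ∈ s, g x = ∑ᶠ y ∈ t, h y := by
  have h1 : BijOn ι (ι ⁻¹' s) s := ⟨fun a ha => ha, hι.injOn, fun x hx => by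
    obtain ⟨a, rfl⟩ := hs hx
    exact ⟨a, hx, rfl⟩⟩
  have h2 : BijOn κ (ι ⁻¹' s) t := ⟨fun a ha => (hst a).mp ha, hκ.injOn, fun x hx => by
    obtain ⟨a, rfl⟩ := ht hx
    exact ⟨a, (hst a).mpr hx, rfl⟩⟩
  rw [← finsum_mem_eq_of_bijOn ι h1 fun a _ => rfl]
  exact finsum_mem_eq_of_bijOn κ h2 hgh

lemma finsum_eq_add_compl {A M : Type*} [AddCommMonoid M] {g : A → M}
    (hg : (Function.support g).Finite) (s : Set A) :
    ∑ᶠ x, g x = ∑ᶠ x ∈ s, g x + ∑ᶠ x ∈ sᶜ, g x := by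
  rw [← finsum_mem_univ, ← union_compl_self s,
    finsum_mem_union' disjoint_compl_right (hg.subset inter_subset_right)
      (hg.subset inter_subset_right)]

section

variable {X : Type} [TopologicalSpace X]

lemma IsClopenIn.isClosed_of_isClosed {E R : Set X} (h : IsClopenIn E R) (hR : IsClosed R) :
    IsClosed E := by
  have := hR.isClosedEmbedding_subtypeVal.isClosedMap _ h.isClosed
  convert this
  ext x
  exact ⟨fun hx => ⟨⟨x, h.subset hx⟩, hx, rfl⟩, fun ⟨y, hy, hyx⟩ => hyx ▸ hy⟩

lemma IsClopenIn.mem_nhds {E R : Set X} (h : IsClopenIn E R) {x : X} (hx : x ∈ E)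
    (hR : R ∈ 𝓝 x) : E ∈ 𝓝 x := by
  filter_upwards [h.eventually x (h.subset hx), hR] with y hy hyR using (hy hyR).mpr hx

lemma IsBranched.fiberSum_add_compl [CompactSpace X] {f : X → Sphere2} (hf : IsBranched f)
    (E : Set X) (w : Sphere2) : fiberSum f univ w = fiberSum f E w + fiberSum f Eᶜ w := by
  have hfin := hf.finite_fiber w
  rw [fiberSum, fiberSum, fiberSum, ← finsum_mem_union _ (hfin.subset inter_subset_right)
    (hfin.subset inter_subset_right), ← union_inter_distrib_right, union_compl_self]
  exact disjoint_compl_right.mono inter_subset_left inter_subset_left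

lemma fiberSum_eq_zero {f : X → Sphere2} {E : Set X} {P : Set Sphere2} (hE : E ⊆ f ⁻¹' P)
    {w : Sphere2} (hw : w ∉ P) : fiberSum f E w = 0 := by
  have : E ∩ f ⁻¹' {w} = ∅ := by
    ext x
    refine ⟨fun ⟨h1, h2⟩ => hw ?_, fun h => h.elim⟩
    rw [← mem_singleton_iff.mp h2]
    exact hE h1
  rw [fiberSum, this, finsum_mem_empty]

end

section Perturbation

variable {F₀ F₁ : BranchedCovering} {T : Surface} {D : Set Sphere2} {U : Set F₀.surface.carrier}
  {i : ((interior U)ᶜ : Set F₀.surface.carrier) → F₁.surface.carrier}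
  {j : T.carrier → F₁.surface.carrier}

/-- The glued piece is an open and closed part of the preimage of the perturbation domain. -/
lemma IsGluing.isClopenIn_range (hG : IsGluing F₀.surface F₁.surface T U i j)
    (hD : IsClosed D) (hU : IsClopenIn U (F₀.map ⁻¹' D)) (hi : ∀ x, F₁.map (i x) = F₀.map x)
    (hj : ∀ y, F₁.map (j y) ∈ D) : IsClopenIn (range j) (F₁.map ⁻¹' D) := by
  have hR : IsClosed (F₀.map ⁻¹' D) := hD.preimage F₀.continuous_map
  have hUcl := hU.isClosed_of_isClosed hR
  refine ⟨range_subset_iff.mpr hj, fun x _ => ?_⟩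
  by_cases hx : x ∈ range j
  · have hQ : IsClosed (F₀.map ⁻¹' D \ U) := by
      refine IsClopenIn.isClosed_of_isClosed ⟨sdiff_subset, fun x hx => ?_⟩ hR
      filter_upwards [hU.eventually x hx] with y hy hyR
      simp only [Set.mem_sdiff, hy hyR, hyR, hx, true_and]
    have hQi : IsClosed (i '' (Subtype.val ⁻¹' (F₀.map ⁻¹' D \ U))) :=
      hG.closed_left.isClosedMap _ (hQ.preimage continuous_subtype_val)
    have hxQ : x ∉ i '' (Subtype.val ⁻¹' (F₀.map ⁻¹' D \ U)) := by
      rintro ⟨z, hz, rfl⟩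
      exact hz.2 ((hG.mem_range_iff hUcl z).mp hx)
    filter_upwards [hQi.isOpen_compl.mem_nhds hxQ] with y hy hyD
    simp only [hx, iff_true]
    by_contra hyj
    obtain ⟨z, rfl⟩ := (hG.cover.symm.subset (mem_univ y)).resolve_right hyj
    exact hy ⟨z, ⟨(congrArg (· ∈ D) (hi z)).mp hyD, fun hz => hyj ((hG.mem_range_iff hUcl z).mpr hz)⟩, rfl⟩
  · filter_upwards [hG.closed_right.isClosed_range.isOpen_compl.mem_nhds hx] with y hy _
    exact ⟨fun h => absurd h hy, fun h => absurd h hx⟩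

/-- On the common boundary of the two parts there are no critical points. -/
lemma IsGluing.notMem_criticalPoints (hG : IsGluing F₀.surface F₁.surface T U i j)
    (hD : IsClosed D) (hU : IsClopenIn U (F₀.map ⁻¹' D)) (hi : ∀ x, F₁.map (i x) = F₀.map x)
    (hj : ∀ y, F₁.map (j y) ∈ D)
    (hcrit : ∀ x ∈ U, x ∈ F₀.criticalPoints → F₀.map x ∈ interior D) {y : T.carrier}
    (hy : y ∈ T.boundary) : j y ∉ F₁.criticalPoints := by
  obtain ⟨x, hx, hxy⟩ := hG.inter_left.subset (hG.inter_right.superset (mem_image_of_mem j hy))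
  rw [← hxy]
  have hUcl := hU.isClosed_of_isClosed (hD.preimage F₀.continuous_map)
  have hxU : (x : F₀.surface.carrier) ∈ U := hUcl.frontier_subset hx
  -- A value interior to D would make x an interior point of U, and such points do not lie on the
  -- seam.
  have hxD : F₀.map x ∉ interior D := fun h => x.2 (mem_interior_iff_mem_nhds.mpr
    (hU.mem_nhds hxU (mem_of_superset
      (F₀.continuous_map.continuousAt (isOpen_interior.mem_nhds h))
      (preimage_mono interior_subset))))
  obtain ⟨hreg, hgenus⟩ := F₀.notMem_criticalPoints_iff.mp fun h => hxD (hcrit x hxU h)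
  refine F₁.notMem_criticalPoints_iff.mpr ⟨?_, (hG.genus_left x).trans hgenus⟩
  rw [F₁.isBranched.isRegularAt_iff]
  refine le_antisymm ?_ (F₁.isBranched.one_le_localDegree _)
  obtain ⟨e, hxe, hfe⟩ := hreg (x : F₀.surface.carrier) rfl
  have hN : (Subtype.val ⁻¹' e.source : Set ((interior U)ᶜ : Set F₀.surface.carrier)) ∈ 𝓝 x :=
    continuous_subtype_val.continuousAt (e.open_source.mem_nhds hxe)
  rw [hG.closed_left.isInducing.nhds_eq_comap, mem_comap] at hN
  obtain ⟨N, hN, hNe⟩ := hN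
  obtain ⟨V, hVN, -, -, -, hV⟩ := F₁.isBranched.hasLocalCount (i x) N hN
  -- The new covering is known to have a local degree, so it may be computed over nearby values
  -- outside D. Their preimages avoid the new piece and lie in the old part, where f₀ is injective
  -- near x.
  have hfreq : ∃ᶠ w in 𝓝 (F₁.map (i x)), w ∈ Dᶜ := by
    rw [← mem_closure_iff_frequently, closure_compl, hi]
    exact hxD
  obtain ⟨w, hwD, hw⟩ := (hfreq.and_eventually (eventually_nhdsWithin_iff.mp hV)).exists
  have hne : w ≠ F₁.map (i x) := fun h => hwD (by
    rw [h, hi]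
    exact hU.subset hxU)
  have hle : (V ∩ F₁.map ⁻¹' {w}).encard ≤ 1 := by
    rw [encard_le_one_iff]
    rintro y₁ y₂ ⟨hy₁, hw₁⟩ ⟨hy₂, hw₂⟩
    have hout : ∀ z, F₁.map z = w → z ∈ range i := fun z hz => by
      refine (hG.cover.symm.subset (mem_univ z)).resolve_right ?_
      rintro ⟨t, rfl⟩
      exact hwD (hz ▸ hj t)
    obtain ⟨x₁, rfl⟩ := hout y₁ hw₁
    obtain ⟨x₂, rfl⟩ := hout y₂ hw₂
    have h : F₀.map x₁ = F₀.map x₂ := by rw [← hi, ← hi, hw₁, hw₂]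
    rw [hfe] at h
    exact congrArg i (Subtype.ext (e.injOn (hNe (hVN hy₁)) (hNe (hVN hy₂)) h))
  rw [hw hne] at hle
  exact_mod_cast hle

/-- Outside the perturbation domain the fibres of the two maps have the same local degrees. -/
lemma IsGluing.fiberSum_compl (hG : IsGluing F₀.surface F₁.surface T U i j) (hU : IsClosed U)
    (hi : ∀ x, F₁.map (i x) = F₀.map x) (w : Sphere2) :
    fiberSum F₁.map (range j)ᶜ w = fiberSum F₀.map Uᶜ w := by
  have hout := hG.isOpenEmbedding_outer hU
  have hcomp : F₁.map ∘ IsGluing.outer i = F₀.map ∘ Subtype.val := funext fun x => hi _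
  refine finsum_mem_eq_of_range_subset hout.injective Subtype.val_injective ?_ ?_ ?_
    fun x _ => BranchedCovering.localDegree_comap hout hU.isOpen_compl.isOpenEmbedding_subtypeVal
      hcomp x
  · rw [hG.range_outer hU]
    exact inter_subset_left
  · rw [Subtype.range_coe]
    exact inter_subset_left
  · intro x
    rw [← hG.range_outer hU]
    simp only [mem_inter_iff, mem_range_self, true_and, x.2]
    exact Eq.congr_left (congrFun hcomp x)

lemma IsGluing.finsum_defect_compl (hG : IsGluing F₀.surface F₁.surface T U i j) (hU : IsClosed U)
    (hi : ∀ x, F₁.map (i x) = F₀.map x) :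
    ∑ᶠ y ∈ (range j)ᶜ, F₁.defect y = ∑ᶠ x ∈ Uᶜ, F₀.defect x := by
  have hout := hG.isOpenEmbedding_outer hU
  have hcomp : F₁.map ∘ IsGluing.outer i = F₀.map ∘ Subtype.val := funext fun x => hi _
  refine finsum_mem_eq_of_range_subset hout.injective Subtype.val_injective
    (hG.range_outer hU).ge Subtype.range_coe.ge ?_ fun x _ => BranchedCovering.defect_comap hout
      hU.isOpen_compl.isOpenEmbedding_subtypeVal hcomp x (hG.genus_left _)
  intro x
  rw [← hG.range_outer hU]
  exact iff_of_true (mem_range_self x) x.2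

/-- Splits the defect into a part supplied by the surface and the ramification entering
Riemann–Hurwitz. Local degrees are at least 1, so the natural subtraction in the ramification is
exact. -/
lemma BranchedCovering.finsum_defect (F : BranchedCovering) (E : Set F.surface.carrier) :
    ∑ᶠ x ∈ E, F.defect x = (∑ᶠ x ∈ E, F.surface.milnor x : ℕ) + ramification F.map E := by
  have hm : (Function.support F.surface.milnor).Finite :=
    F.finite_criticalPoints.subset fun x hx => Or.inr (Nat.pos_of_ne_zero hx)
  have hr := F.isBranched.finite_support_ramification
  rw [ramification, ← Nat.cast_add, ← finsum_mem_add_distrib' (hm.subset inter_subset_right)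
    (hr.subset inter_subset_right)]
  have hcast := (Nat.castAddMonoidHom ℤ).map_finsum_mem' (s := E)
    (f := fun x => F.surface.milnor x + (localDegree F.map x - 1))
    (((hm.union hr).subset (Function.support_add _ _)).subset inter_subset_right)
  refine Eq.trans ?_ hcast.symm
  refine finsum_mem_congr rfl fun x _ => ?_
  have := F.isBranched.one_le_localDegree x
  rw [BranchedCovering.defect, Nat.coe_castAddMonoidHom]
  omega

/-- A local perturbation preserves the number of sheets and the sum of the multiplicities. -/
theorem IsLocalPerturbation.invariants (hD : IsClosedDisk D) (h : IsLocalPerturbation F₀ F₁ D) :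
    (∀ w, F₁.sheets w = F₀.sheets w) ∧ ∑ᶠ x, F₁.defect x = ∑ᶠ x, F₀.defect x := by
  obtain ⟨φ, hφ, rfl⟩ := hD
  obtain ⟨v, hvc, hvD, hcrit, T, hT, i, j, hG, hi, hj⟩ := h
  set K : Set ℂ := Metric.closedBall 0 1 with hK
  set U := connectedComponentIn (F₀.map ⁻¹' (φ '' K)) v
  have hKc : IsCompact K := isCompact_closedBall 0 1
  have hKconv : Convex ℝ K := convex_closedBall 0 1
  have hDcl : IsClosed (φ '' K) := (hKc.image hφ.continuous).isClosed
  have hreg : ∀ x ∈ U, x ≠ v → IsRegularAt F₀.map x := fun x hx hxv =>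
    (F₀.notMem_criticalPoints_iff.mp fun hc => hxv (hcrit x hx hc)).1
  have hU : IsClopenIn U (F₀.map ⁻¹' (φ '' K)) :=
    F₀.isBranched.isClopenIn_connectedComponentIn hφ hKconv hKc hvD hreg
  have hUcl := hU.isClosed_of_isClosed (hDcl.preimage F₀.continuous_map)
  have hJ := hG.isClopenIn_range hDcl hU hi hj
  have hvR : v ∈ F₀.map ⁻¹' (φ '' K) := interior_subset (s := φ '' K) hvD
  have hvU : v ∈ U := mem_connectedComponentIn hvR
  have hpre : IsPreconnected (φ '' K) := hKconv.isPreconnected.image φ hφ.continuous.continuousOn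
  have h0 : (0 : ℂ) ∈ K := Metric.mem_closedBall_self zero_le_one
  -- the number of sheets
  obtain ⟨w₀, hw₀⟩ : ∃ w₀, w₀ ∉ φ '' K := by
    refine ⟨φ 2, fun ⟨z, hz, hz2⟩ => ?_⟩
    rw [hφ.injective hz2, hK, mem_closedBall_zero_iff] at hz
    norm_num at hz
  have hsum₀ := F₀.isBranched.fiberSum_add_compl U
  have hsum₁ := F₁.isBranched.fiberSum_add_compl (range j)
  have hcompl := hG.fiberSum_compl hUcl hi
  have hsheets : ∀ w, F₁.sheets w = F₀.sheets w := fun w => by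
    rw [F₁.sheets_eq w w₀, F₀.sheets_eq w w₀, BranchedCovering.sheets, BranchedCovering.sheets,
      hsum₀, hsum₁, fiberSum_eq_zero hU.subset hw₀, fiberSum_eq_zero hJ.subset hw₀, hcompl]
  refine ⟨hsheets, ?_⟩
  -- the local degree
  have hdeg : fiberSum F₁.map (range j) (φ 0) = localDegree F₀.map v := by
    have h1 : fiberSum F₁.map (range j) (φ 0) = fiberSum F₀.map U (φ 0) := by
      have h2 := hsheets (φ 0)
      rw [BranchedCovering.sheets, BranchedCovering.sheets, hsum₀, hsum₁, hcompl] at h2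
      exact Nat.add_right_cancel h2
    obtain ⟨c, hc, hcv⟩ := hvR
    -- The component U is connected and branched at most at v, so v is the only point of U over its
    -- image.
    have hfib : U ∩ F₀.map ⁻¹' {φ c} = {v} := by
      refine Subset.antisymm ?_ (singleton_subset_iff.mpr ⟨hvU, hcv.symm⟩)
      rintro x ⟨hx, hxc⟩
      refine F₀.isBranched.eq_of_isPreconnected hφ.isEmbedding hc (hKconv.starConvex hc) hU ?_
        isPreconnected_connectedComponentIn hx hvU hxc hcv.symm
      intro y hy hyc
      refine hreg y hy ?_
      rintro rfl
      exact hyc hcv.symm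
    rw [h1, F₀.isBranched.fiberSum_eq hU hpre (mem_image_of_mem φ h0) (mem_image_of_mem φ hc),
      fiberSum, hfib, finsum_mem_singleton]
  -- the Euler characteristic of the piece
  have := hT.connected
  have := T.pathConnectedSpace
  have hχ : EulerChar.HasChi T.carrier 1
      (localDegree F₀.map v - ramification F₁.map (range j)) := by
    rw [← hdeg]
    exact (F₁.isBranched.hasChi_of_convex hφ hKconv h0 hJ).of_homeomorph
      hG.closed_right.isEmbedding.toHomeomorph.symm
  -- The Euler characteristic is obtained with homology bounded by degree 1, so it equals 1 − b₁.
  have hb := hχ.sum_betti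
  rw [Finset.sum_range_succ, Finset.sum_range_one, EulerChar.betti_zero_of_pathConnected] at hb
  -- In the interior of the piece the Milnor numbers agree by locality. On the seam both vanish, the
  -- one in the glued surface because there are no critical points there.
  have hmilnor : ∑ᶠ x ∈ range j, F₁.surface.milnor x = ∑ᶠ y, T.milnor y := by
    rw [finsum_mem_range hG.closed_right.injective]
    refine finsum_congr fun y => ?_
    by_cases hy : y ∈ T.boundary
    · have hc := hG.notMem_criticalPoints hDcl hU hi hj (fun x hx hxc => by
        rw [hcrit x hx hxc]
        exact hvD) hy
      rw [T.milnor_of_mem_boundary hy]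
      exact Nat.eq_zero_of_not_pos fun hp => hc (Or.inr hp)
    · exact (hG.milnor_eq hy).symm
  have hUsum : ∑ᶠ x ∈ U, F₀.defect x = F₀.defect v := by
    rw [← finsum_mem_singleton (f := F₀.defect) (a := v)]
    refine finsum_mem_inter_support_eq' _ _ _ fun x hx => ?_
    have hxc : x ∈ F₀.criticalPoints := by
      by_contra hc
      exact hx (F₀.defect_eq_zero hc)
    refine ⟨fun h => hcrit x h hxc, ?_⟩
    rintro rfl
    exact hvU
  have hb1 := hT.betti_one
  -- Off the replaced parts the defects agree. It remains to compare ∑ μ_x + ram(T) with μ_v + deg_v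
  -- − 1, which follows from 1 − b₁ = deg_v − ram(T) and b₁ + ∑ μ_x = μ_v.
  rw [finsum_eq_add_compl F₁.finite_support_defect (range j),
    finsum_eq_add_compl F₀.finite_support_defect U, hG.finsum_defect_compl hUcl hi, hUsum,
    F₁.finsum_defect, hmilnor, BranchedCovering.defect]
  simp only [pow_zero, pow_one, Nat.cast_one] at hb
  push_cast [← hb1]
  linarith

end Perturbation

end SingularSurface
end


/-! ### Degenerations -/

namespace SingularSurface

open Set

theorem IsPerturbation.invariants {F₀ F₁ : BranchedCovering} {D : Sphere2 → Set Sphere2}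
    (h : IsPerturbation F₀ F₁ D) :
    (∀ w, F₁.sheets w = F₀.sheets w) ∧ ∑ᶠ x, F₁.defect x = ∑ᶠ x, F₀.defect x := by
  obtain ⟨hD, -, hchain⟩ := h
  induction hchain with
  | refl => exact ⟨fun _ => rfl, rfl⟩
  | tail _ hstep ih =>
    obtain ⟨w, hw, hloc⟩ := hstep
    have h := hloc.invariants (hD w hw).1
    exact ⟨fun u => (h.1 u).trans (ih.1 u), h.2.trans ih.2⟩

/-- **The Riemann–Hurwitz formula** for a nonsingular surface. -/
theorem BranchedCovering.finsum_defect_eq (F : BranchedCovering) (hF : F.surface.IsNonsingular)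
    (w : Sphere2) : ∑ᶠ x, F.defect x = 2 * F.sheets w - eulerChar F.surface.carrier := by
  have hm : ∀ x, F.surface.milnor x = 0 := fun x => Nat.eq_zero_of_not_pos (hF x)
  have h := F.finsum_defect univ
  rw [finsum_mem_univ] at h
  rw [h, (F.isBranched.hasChi w).eulerChar_eq, BranchedCovering.sheets]
  simp only [hm, finsum_zero, Nat.cast_zero]
  ring

end SingularSurface

theorem proposition1 (F F' : SingularSurface.BranchedCovering) (n : ℕ)
    (hF : F.surface.IsNonsingular) (hn : F.IsFold n)
    (hdeg : SingularSurface.IsDegeneration F' F) :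
    F'.IsFold n ∧ F'.criticalPoints.Finite ∧
      ∑ᶠ w ∈ F'.criticalValues, F'.multiplicity w
        = 2 * (n : ℤ) - SingularSurface.eulerChar F.surface.carrier := by
  obtain ⟨D, hD⟩ := hdeg
  obtain ⟨hs, hd⟩ := hD.invariants
  have hn' := (F.isFold_iff n).mp hn
  refine ⟨(F'.isFold_iff n).mpr fun w => (hs w).symm.trans (hn' w), F'.finite_criticalPoints, ?_⟩
  obtain ⟨w⟩ : Nonempty SingularSurface.Sphere2 := inferInstance
  rw [F'.sum_multiplicity, ← hd, F.finsum_defect_eq hF w, hn']
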